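/- Let $0<\alpha<1$ and $1<q<1+\alpha$, and let $u_0\in L^\infty(\mathbb{R})$ with $u_0\ge 0$ almost everywhere. For $g:\mathbb{R}\to\mathbb{R}$ put $\mathcal{D}^\alpha[g](x)=\frac{1}{\Gamma(-\alpha)}\int_{-\infty}^0\frac{g(x+z)-g(x)}{|z|^{\alpha+1}}\,dz$, so that $\partial_x\mathcal{D}^\alpha$ has Fourier symbol $(i\xi)^{1+\alpha}$ (principal branch). Let $\varepsilon>0$ and let $u_\varepsilon$ be the solution of $$\partial_t u_\varepsilon+|u_\varepsilon|^{q-1}\partial_x u_\varepsilon=\partial_x\mathcal{D}^\alpha[u_\varepsilon(t,\cdot)](x)\quad (t>0,\ x\in\mathbb{R}),\qquad u_\varepsilon(0,x)=u_0(x)+\varepsilon,$$ in the mild sense: $u_\varepsilon$ is bounded and continuous on $(0,\infty)\times\mathbb{R}$ and, for almost every $(t,x)\in(0,\infty)\times\mathbb{R}$, $$u_\varepsilon(t,x)=\big(K(t,\cdot)*(u_0+\varepsilon)\big)(x)-\int_0^t\big(\partial_xK(t-s,\cdot)*f(u_\varepsilon(s,\cdot))\big)(x)\,ds,$$ where $f(v)=|v|^{q-1}v/q$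 and $K(t,x)=\frac1{2\pi}\int_{\mathbb{R}}e^{(i\xi)^{1+\alpha}t}e^{ix\xi}\,d\xi$. Then, for all $t>0$ and all $x\in\mathbb{R}$, $u_\varepsilon(t,x)>0$, the function $u_\varepsilon(t,\cdot)^{q-1}$ is differentiable at $x$, and $$\partial_x\big(u_\varepsilon^{q-1}\big)(t,x)\le\frac1t .$$ -/

import Mathlib

open MeasureTheory Set

noncomputable section

/-- The fundamental solution of the linear equation `∂ₜ U = ∂ₓ 𝒟^α[U]`, whose Fourier symbol is
`(iξ)^(1+α)` (principal branch): `K(t,x) = (2π)⁻¹ ∫ exp((iξ)^(1+α) t) exp(i x ξ) dξ`. It is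
normalised to have mass one, so that `K(t,·) * u₀` solves the linear problem with datum `u₀`.
The integrand is conjugate-symmetric in `ξ`, hence the integral is real. -/
def kernelK (α t x : ℝ) : ℝ :=
  (2 * Real.pi)⁻¹ *
    (∫ ξ : ℝ, Complex.exp ((Complex.I * (ξ : ℂ)) ^ ((1 + α : ℝ) : ℂ) * (t : ℂ)) *
      Complex.exp (Complex.I * (x : ℂ) * (ξ : ℂ))).re

/-- The spatial derivative `∂ₓ K(t,x)` of the kernel. -/
def kernelKx (α t x : ℝ) : ℝ := deriv (fun y : ℝ => kernelK α t y) x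

/-- The flux `f(v) = |v|^(q-1) v / q`. -/
def flux (q v : ℝ) : ℝ := |v| ^ (q - 1) * v / q

/-- `u` is a (global) mild solution on `(0,∞) × ℝ` of
`∂ₜ u + |u|^(q-1) ∂ₓ u = ∂ₓ 𝒟^α[u]`, `u(0,·) = v₀`: it is continuous and bounded on
`(0,∞) × ℝ`, and for almost every `(t,x)` there
`u(t,x) = (K(t,·) * v₀)(x) - ∫₀ᵗ (∂ₓK(t-s,·) * f(u(s,·)))(x) ds`.
Values `u t x` with `t ≤ 0` are irrelevant. -/
structure IsMildSolution (α q : ℝ) (v₀ : ℝ → ℝ) (u : ℝ → ℝ → ℝ) : Prop where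
  continuousOn : ContinuousOn (fun p : ℝ × ℝ => u p.1 p.2) (Ioi (0 : ℝ) ×ˢ (univ : Set ℝ))
  bounded : ∃ C : ℝ, ∀ t : ℝ, 0 < t → ∀ x : ℝ, |u t x| ≤ C
  mild : ∀ᵐ p : ℝ × ℝ, 0 < p.1 →
    u p.1 p.2 = (∫ y : ℝ, kernelK α p.1 (p.2 - y) * v₀ y) -
      ∫ s in (0 : ℝ)..p.1, ∫ y : ℝ, kernelKx α (p.1 - s) (p.2 - y) * flux q (u s y)

end

/-! The natural unknown is w = u^(q-1). Without diffusion, w solves Burgers' equation w_t + w w_x =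
0, whose solutions satisfy w_x ≤ 1/t because W = w_x obeys W' = -W² along characteristics. Diffusion
does not destroy this bound. The kernel K(t,·) is a probability density, and 0 < q-1 < 1, so u^(q-1)
is compared under convolution by Minkowski's inequality with exponent p = 1/(q-1) > 1: if w(x-z) ≤
w(y-z) + d for all z, then (K*u)(x)^(q-1) ≤ (K*u)(y)^(q-1) + d (`KernelEst.heat_rpow_le`).

The two effects are separated by operator splitting. Over a short time h the solution equals
advection along u^(q-1) followed by linear diffusion, up to O(h^(1+κ)) uniformly in x
(`MildSol.exists_step_estimate`). The inequality t (w(x) - w(y)) ≤ x - y + M for y ≤ x survives each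
half step up to O(h²), so after D/h steps the total error is O(h^κ) and vanishes
(`propagate_of_step`, `MildSol.oleinik`). It starts at a small time τ with M = τ sup w, and τ → 0
removes this constant. The same splitting gives the minimum principle u ≥ ε
(`MildSol.ge_of_init_ge`), which makes v ↦ v^(q-1) Lipschitz on the range of u. Only first
derivatives of u are used; the argument never evaluates the nonlocal operator.

The splitting error needs u(t,·) in C^{1,θ} with θ = q-1, and Hölder continuity of u and ∂ₓu in
time. Both come from the mild formula and L¹ bounds on K and ∂ₓK, which scaling reduces to decay of
the profile K(1,·) (`exists_profile_decay`, `exists_kernel_estimates`). A singular Gronwall argument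
gives Lipschitz continuity, and a Hölder bound on difference quotients gives differentiability.

Positivity of K is obtained from Grünwald's approximation of (iξ)^(1+α): for 1 < 1+α < 2 the shifted
binomial sum has nonnegative weights apart from a constant term, so its exponential is a positive
combination of characters (`gaussPositive_exp_oneSub`, `kernelK_nonneg`). -/

noncomputable section

/-! ### Decay of oscillatory half-line integrals. -/

/-- The oscillatory half-line integral `∫₀^∞ ξ^r exp(-ζ ξ^s) exp(i x ξ) dξ`. -/
def halfLineIntegral (ζ : ℂ) (s r x : ℝ) : ℂ :=
  ∫ ξ in Ioi (0 : ℝ), ((ξ ^ r : ℝ) : ℂ) * Complex.exp (-ζ * ((ξ ^ s : ℝ) : ℂ)) *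
    Complex.exp (Complex.I * x * ξ)

lemma norm_halfLineIntegrand (ζ : ℂ) (s r x : ℝ) {ξ : ℝ} (hξ : 0 < ξ) :
    ‖((ξ ^ r : ℝ) : ℂ) * Complex.exp (-ζ * ((ξ ^ s : ℝ) : ℂ)) *
      Complex.exp (Complex.I * x * ξ)‖ = ξ ^ r * Real.exp (-ζ.re * ξ ^ s) := by
  rw [norm_mul, norm_mul, Complex.norm_exp, Complex.norm_exp, Complex.norm_real,
    Real.norm_of_nonneg (Real.rpow_nonneg hξ.le _)]
  have h1 : (Complex.I * x * ξ).re = 0 := by simp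
  have h2 : (-ζ * ((ξ ^ s : ℝ) : ℂ)).re = -ζ.re * ξ ^ s := by
    rw [Complex.re_mul_ofReal]; simp
  rw [h1, h2]; simp

lemma integrableOn_halfLineIntegrand {ζ : ℂ} (hζ : 0 < ζ.re) {s r : ℝ} (hs : 0 < s) (hr : -1 < r)
    (x : ℝ) :
    IntegrableOn (fun ξ : ℝ => ((ξ ^ r : ℝ) : ℂ) * Complex.exp (-ζ * ((ξ ^ s : ℝ) : ℂ)) *
      Complex.exp (Complex.I * x * ξ)) (Ioi 0) := by
  refine (integrableOn_rpow_mul_exp_neg_mul_rpow hr hs hζ).mono' ?_ ?_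
  · apply Measurable.aestronglyMeasurable
    fun_prop
  · filter_upwards [ae_restrict_mem measurableSet_Ioi] with ξ hξ
    exact (norm_halfLineIntegrand ζ s r x hξ).le

lemma norm_halfLineIntegral_le (ζ : ℂ) (s r x : ℝ) :
    ‖halfLineIntegral ζ s r x‖ ≤ ∫ ξ in Ioi (0 : ℝ), ξ ^ r * Real.exp (-ζ.re * ξ ^ s) := by
  refine (norm_integral_le_integral_norm _).trans_eq ?_
  exact setIntegral_congr_fun measurableSet_Ioi fun ξ hξ => norm_halfLineIntegrand ζ s r x hξ

/-- Integration by parts over the half-line. The boundary term `0 ^ r` is 1 for r = 0 and 0 for r >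
0, and this distinction decides how fast the integral decays in x. -/
lemma halfLineIntegral_rec {ζ : ℂ} (hζ : 0 < ζ.re) {s r : ℝ} (hs : 1 ≤ s) (hr : 0 ≤ r) (x : ℝ) :
    Complex.I * x * halfLineIntegral ζ s r x = -(((0 : ℝ) ^ r : ℝ) : ℂ)
      - r * halfLineIntegral ζ s (r - 1) x + ζ * s * halfLineIntegral ζ s (r + s - 1) x := by
  have hs0 : 0 < s := by linarith
  set G : ℝ → ℝ → ℂ := fun r ξ => ((ξ ^ r : ℝ) : ℂ) * Complex.exp (-ζ * ((ξ ^ s : ℝ) : ℂ)) *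
      Complex.exp (Complex.I * x * ξ) with hG
  have hder : ∀ ξ ∈ Ioi (0 : ℝ), HasDerivAt (G r)
      (r * G (r - 1) ξ - ζ * s * G (r + s - 1) ξ + Complex.I * x * G r ξ) ξ := by
    intro ξ hξ
    have hξ0 : ξ ≠ 0 := ne_of_gt hξ
    have e1 : HasDerivAt (fun ξ : ℝ => ((ξ ^ r : ℝ) : ℂ)) ((r * ξ ^ (r - 1) : ℝ) : ℂ) ξ :=
      (Real.hasDerivAt_rpow_const (Or.inl hξ0)).ofReal_comp
    have e2 : HasDerivAt (fun ξ : ℝ => ((ξ ^ s : ℝ) : ℂ)) ((s * ξ ^ (s - 1) : ℝ) : ℂ) ξ :=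
      (Real.hasDerivAt_rpow_const (Or.inl hξ0)).ofReal_comp
    have e3 : HasDerivAt (fun ξ : ℝ => (ξ : ℂ)) 1 ξ := (hasDerivAt_id ξ).ofReal_comp
    have := (e1.mul (e2.const_mul (-ζ)).cexp).mul (e3.const_mul (Complex.I * x)).cexp
    refine this.congr_deriv ?_
    have e4 : ξ ^ (r + s - 1) = ξ ^ r * ξ ^ (s - 1) := by
      rw [← Real.rpow_add hξ]; ring_nf
    simp only [hG, e4, Complex.ofReal_mul, Pi.mul_apply]
    ring
  have hi : ∀ r : ℝ, -1 < r → IntegrableOn (G r) (Ioi 0) := fun r hr =>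
    integrableOn_halfLineIntegrand hζ hs0 hr x
  have i1 : IntegrableOn (fun ξ => (r : ℂ) * G (r - 1) ξ) (Ioi 0) := by
    rcases hr.eq_or_lt with h | h
    -- For r = 0 the function `G (-1)` is not integrable, but its coefficient vanishes.
    · simp [← h, IntegrableOn]
    · exact (hi _ (by linarith)).const_mul _
  have i2 : IntegrableOn (fun ξ => ζ * s * G (r + s - 1) ξ) (Ioi 0) :=
    (hi _ (by linarith)).const_mul _
  have i3 : IntegrableOn (fun ξ => Complex.I * x * G r ξ) (Ioi 0) :=
    (hi _ (by linarith)).const_mul _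
  have hint := (i1.sub i2).add i3
  have hlim := tendsto_zero_of_hasDerivAt_of_integrableOn_Ioi hder hint (hi r (by linarith))
  have hcont : ContinuousWithinAt (G r) (Ici 0) 0 := by
    apply Continuous.continuousWithinAt
    have c1 := Real.continuous_rpow_const (q := r) hr
    have c2 := Real.continuous_rpow_const (q := s) hs0.le
    simp only [hG]
    fun_prop
  have key := integral_Ioi_of_hasDerivAt_of_tendsto hcont hder hint hlim
  have e : ∫ ξ in Ioi (0 : ℝ), (r * G (r - 1) ξ - ζ * s * G (r + s - 1) ξ + Complex.I * x * G r ξ)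
      = r * halfLineIntegral ζ s (r - 1) x - ζ * s * halfLineIntegral ζ s (r + s - 1) x
        + Complex.I * x * halfLineIntegral ζ s r x := by
    rw [integral_add (f := fun ξ => r * G (r - 1) ξ - ζ * s * G (r + s - 1) ξ) (i1.sub i2) i3,
      integral_sub i1 i2, integral_const_mul, integral_const_mul,
      integral_const_mul]
    rfl
  rw [e] at key
  have h0 : G r 0 = (((0 : ℝ) ^ r : ℝ) : ℂ) := by
    simp [hG, Real.zero_rpow hs0.ne']
  rw [h0] at key
  linear_combination key

lemma hasDerivAt_halfLineIntegral {ζ : ℂ} (hζ : 0 < ζ.re) {s r : ℝ} (hs : 0 < s) (hr : -1 < r)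
    (x : ℝ) :
    HasDerivAt (fun y => halfLineIntegral ζ s r y)
      (Complex.I * halfLineIntegral ζ s (r + 1) x) x := by
  have := hasDerivAt_integral_of_dominated_loc_of_deriv_le (μ := volume.restrict (Ioi (0 : ℝ)))
    (F := fun (x ξ : ℝ) => ((ξ ^ r : ℝ) : ℂ) * Complex.exp (-ζ * ((ξ ^ s : ℝ) : ℂ)) *
      Complex.exp (Complex.I * x * ξ))
    (F' := fun (x ξ : ℝ) => Complex.I * (((ξ ^ (r + 1) : ℝ) : ℂ) *
      Complex.exp (-ζ * ((ξ ^ s : ℝ) : ℂ)) * Complex.exp (Complex.I * x * ξ)))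
    (x₀ := x) (s := univ) (bound := fun ξ => ξ ^ (r + 1) * Real.exp (-ζ.re * ξ ^ s))
    Filter.univ_mem ?_ (integrableOn_halfLineIntegrand hζ hs hr x) ?_ ?_
    (integrableOn_rpow_mul_exp_neg_mul_rpow (by linarith) hs hζ) ?_
  · have h2 := this.2
    rw [integral_const_mul] at h2
    exact h2
  · exact Filter.Eventually.of_forall fun x =>
      (integrableOn_halfLineIntegrand hζ hs hr x).aestronglyMeasurable
  · exact ((integrableOn_halfLineIntegrand hζ hs (by linarith) x).const_mul _).aestronglyMeasurable
  · filter_upwards [ae_restrict_mem measurableSet_Ioi] with ξ hξ y _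
    rw [norm_mul, norm_halfLineIntegrand ζ s _ y hξ]; simp
  · filter_upwards [ae_restrict_mem measurableSet_Ioi] with ξ hξ y _
    have e3 : HasDerivAt (fun y : ℝ => (y : ℂ)) 1 y := (hasDerivAt_id y).ofReal_comp
    have := (((e3.const_mul Complex.I).mul_const (ξ : ℂ)).cexp).const_mul
      (((ξ ^ r : ℝ) : ℂ) * Complex.exp (-ζ * ((ξ ^ s : ℝ) : ℂ)))
    refine this.congr_deriv ?_
    rw [Real.rpow_add_one (ne_of_gt hξ)]
    push_cast
    ring

/-- Quadratic decay of the real part for `r = 0`. -/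
lemma sq_mul_re_halfLineIntegral_zero_le {ζ : ℂ} (hζ : 0 < ζ.re) {s : ℝ} (hs : 1 < s) :
    ∃ C : ℝ, ∀ x : ℝ, x ^ 2 * |(halfLineIntegral ζ s 0 x).re| ≤ C := by
  refine ⟨‖ζ * s‖ * (|s - 1| * (∫ ξ in Ioi (0 : ℝ), ξ ^ (s - 1 - 1) * Real.exp (-ζ.re * ξ ^ s)) +
    ‖ζ * s‖ * (∫ ξ in Ioi (0 : ℝ), ξ ^ (s - 1 + s - 1) * Real.exp (-ζ.re * ξ ^ s))), fun x => ?_⟩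
  have h0 := halfLineIntegral_rec hζ hs.le le_rfl x
  have h1 := halfLineIntegral_rec hζ hs.le (r := s - 1) (by linarith) x
  rw [Real.zero_rpow (by linarith)] at h1
  simp only [Real.rpow_zero, zero_add, Complex.ofReal_zero, zero_mul, sub_zero,
    Complex.ofReal_one, neg_zero, zero_sub] at h0 h1
  -- Two integrations by parts. The first boundary term contributes i x, of order 1/x in the
  -- integral but purely imaginary, so it disappears from the real part. The second is zero because
  -- s - 1 > 0.
  have e : (halfLineIntegral ζ s 0 x) * ((x ^ 2 : ℝ) : ℂ) = Complex.I * x +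
      (-(ζ * s) * (-(((s - 1 : ℝ) : ℂ) * halfLineIntegral ζ s (s - 1 - 1) x) +
        ζ * s * halfLineIntegral ζ s (s - 1 + s - 1) x)) := by
    rw [← h1]
    push_cast
    linear_combination (-Complex.I * x) * h0 + x ^ 2 * halfLineIntegral ζ s 0 x * Complex.I_sq
  have e2 := congrArg Complex.re e
  rw [Complex.re_mul_ofReal, Complex.add_re] at e2
  have h3 : (Complex.I * (x : ℂ)).re = 0 := by simp
  rw [h3, zero_add] at e2
  rw [mul_comm, ← abs_of_nonneg (sq_nonneg x), ← abs_mul, e2]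
  refine (Complex.abs_re_le_norm _).trans ?_
  rw [norm_mul, norm_neg]
  refine mul_le_mul_of_nonneg_left ?_ (norm_nonneg _)
  refine (norm_add_le _ _).trans (add_le_add ?_ ?_)
  · rw [norm_neg, norm_mul, Complex.norm_real, Real.norm_eq_abs]
    exact mul_le_mul_of_nonneg_left (norm_halfLineIntegral_le _ _ _ _) (abs_nonneg _)
  · rw [norm_mul]
    exact mul_le_mul_of_nonneg_left (norm_halfLineIntegral_le _ _ _ _) (norm_nonneg _)

/-- One integration by parts, boundary term included, yields first-order decay. It serves as the
second of the two integrations by parts when r ≥ 1. -/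
lemma abs_mul_halfLineIntegral_le {ζ : ℂ} (hζ : 0 < ζ.re) {s r : ℝ} (hs : 1 ≤ s) (hr : 0 ≤ r) :
    ∃ C : ℝ, ∀ x : ℝ, ‖(x : ℂ) * halfLineIntegral ζ s r x‖ ≤ C := by
  refine ⟨‖(((0 : ℝ) ^ r : ℝ) : ℂ)‖ +
    ‖(r : ℂ)‖ * (∫ ξ in Ioi (0 : ℝ), ξ ^ (r - 1) * Real.exp (-ζ.re * ξ ^ s)) +
    ‖ζ * s‖ * (∫ ξ in Ioi (0 : ℝ), ξ ^ (r + s - 1) * Real.exp (-ζ.re * ξ ^ s)), fun x => ?_⟩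
  have h0 := halfLineIntegral_rec hζ hs hr x
  have h1 := congrArg norm h0
  rw [mul_assoc, norm_mul, Complex.norm_I, one_mul] at h1
  rw [h1]
  refine (norm_add_le _ _).trans (add_le_add ((norm_sub_le _ _).trans (add_le_add ?_ ?_)) ?_)
  · rw [norm_neg]
  · rw [norm_mul]
    exact mul_le_mul_of_nonneg_left (norm_halfLineIntegral_le _ _ _ _) (norm_nonneg _)
  · rw [norm_mul]
    exact mul_le_mul_of_nonneg_left (norm_halfLineIntegral_le _ _ _ _) (norm_nonneg _)

/-- Quadratic decay for `r ≥ 1`. -/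
lemma sq_mul_norm_halfLineIntegral_le {ζ : ℂ} (hζ : 0 < ζ.re) {s r : ℝ} (hs : 1 ≤ s) (hr : 1 ≤ r) :
    ∃ C : ℝ, ∀ x : ℝ, x ^ 2 * ‖halfLineIntegral ζ s r x‖ ≤ C := by
  obtain ⟨C1, h1⟩ := abs_mul_halfLineIntegral_le hζ hs (r := r - 1) (by linarith)
  obtain ⟨C2, h2⟩ := abs_mul_halfLineIntegral_le hζ hs (r := r + s - 1) (by linarith)
  refine ⟨‖(r : ℂ)‖ * C1 + ‖ζ * s‖ * C2, fun x => ?_⟩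
  have h0 := halfLineIntegral_rec hζ hs (r := r) (by linarith) x
  rw [Real.zero_rpow (by linarith)] at h0
  have e : Complex.I * ((x ^ 2 : ℝ) * halfLineIntegral ζ s r x) =
      -(r * (x * halfLineIntegral ζ s (r - 1) x)) +
        ζ * s * (x * halfLineIntegral ζ s (r + s - 1) x) := by
    push_cast at h0 ⊢
    linear_combination (x : ℂ) * h0
  have e2 := congrArg norm e
  rw [norm_mul, Complex.norm_I, one_mul, norm_mul, Complex.norm_real,
    Real.norm_of_nonneg (sq_nonneg x)] at e2
  rw [e2]
  refine (norm_add_le _ _).trans (add_le_add ?_ ?_)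
  · rw [norm_neg, norm_mul]
    exact mul_le_mul_of_nonneg_left (h1 x) (norm_nonneg _)
  · rw [norm_mul]
    exact mul_le_mul_of_nonneg_left (h2 x) (norm_nonneg _)

end

/-! ### The multiplier, self-similarity of the kernel and decay of its profile. -/

noncomputable section

/-- The multiplier `exp((iξ)^(1+α) t)`. -/
def kernelSymbol (α t ξ : ℝ) : ℂ :=
  Complex.exp ((Complex.I * (ξ : ℂ)) ^ ((1 + α : ℝ) : ℂ) * (t : ℂ))

/-- The constant `-i^(1+α)`, which has positive real part. -/
def symbolConst (α : ℝ) : ℂ := -(Complex.I ^ ((1 + α : ℝ) : ℂ))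

/-- The real part is -cos(π(1+α)/2), and the angle lies strictly between π/2 and π. -/
lemma symbolConst_re_pos {α : ℝ} (h0 : 0 < α) (h1 : α < 1) : 0 < (symbolConst α).re := by
  have : Complex.I ^ ((1 + α : ℝ) : ℂ) =
      Complex.exp (((Real.pi * (1 + α) / 2 : ℝ) : ℂ) * Complex.I) := by
    rw [Complex.cpow_def_of_ne_zero Complex.I_ne_zero, Complex.log_I]
    push_cast
    ring_nf
  rw [symbolConst, this, Complex.neg_re, Complex.exp_ofReal_mul_I_re, neg_pos]
  have hp := Real.pi_pos
  apply Real.cos_neg_of_pi_div_two_lt_of_lt <;> nlinarith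

lemma I_mul_cpow_of_pos (α : ℝ) {ξ : ℝ} (hξ : 0 < ξ) :
    (Complex.I * (ξ : ℂ)) ^ ((1 + α : ℝ) : ℂ) = -symbolConst α * ((ξ ^ (1 + α) : ℝ) : ℂ) := by
  have hξ' : (ξ : ℂ) ≠ 0 := by exact_mod_cast hξ.ne'
  rw [symbolConst, neg_neg, Complex.cpow_def_of_ne_zero (mul_ne_zero Complex.I_ne_zero hξ'),
    mul_comm Complex.I, Complex.log_ofReal_mul hξ Complex.I_ne_zero, add_mul, Complex.exp_add,
    ← Complex.cpow_def_of_ne_zero Complex.I_ne_zero, mul_comm, Complex.ofReal_log hξ.le,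
    ← Complex.cpow_def_of_ne_zero hξ', Complex.ofReal_cpow hξ.le]

/-- The number iξ is never a negative real, so conjugation commutes with the principal power. -/
lemma I_mul_neg_cpow (α ξ : ℝ) :
    (Complex.I * ((-ξ : ℝ) : ℂ)) ^ ((1 + α : ℝ) : ℂ) =
      (starRingEnd ℂ) ((Complex.I * (ξ : ℂ)) ^ ((1 + α : ℝ) : ℂ)) := by
  have e : Complex.I * ((-ξ : ℝ) : ℂ) = (starRingEnd ℂ) (Complex.I * (ξ : ℂ)) := by
    simp
  rw [e, Complex.conj_cpow, Complex.conj_ofReal]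
  intro h
  have h2 := (Complex.arg_eq_pi_iff.1 h).1
  simp at h2

lemma kernelSymbol_of_pos (α t : ℝ) {ξ : ℝ} (hξ : 0 < ξ) :
    kernelSymbol α t ξ = Complex.exp (-(symbolConst α * t) * ((ξ ^ (1 + α) : ℝ) : ℂ)) := by
  rw [kernelSymbol, I_mul_cpow_of_pos α hξ]; ring_nf

lemma kernelSymbol_neg (α t ξ : ℝ) :
    kernelSymbol α t (-ξ) = (starRingEnd ℂ) (kernelSymbol α t ξ) := by
  rw [kernelSymbol, I_mul_neg_cpow α ξ, kernelSymbol, ← Complex.exp_conj]; simp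

lemma kernelSymbol_zero {α : ℝ} (hα : 0 < α) (t : ℝ) : kernelSymbol α t 0 = 1 := by
  rw [kernelSymbol]
  simp only [Complex.ofReal_zero, mul_zero]
  rw [Complex.zero_cpow]
  · simp
  · exact_mod_cast (by linarith : (1 + α : ℝ) ≠ 0)

lemma norm_kernelSymbol {α : ℝ} (hα : 0 < α) (t ξ : ℝ) :
    ‖kernelSymbol α t ξ‖ = Real.exp (-((symbolConst α).re * t) * |ξ| ^ (1 + α)) := by
  have key : ∀ {ξ : ℝ}, 0 < ξ →
      ‖kernelSymbol α t ξ‖ = Real.exp (-((symbolConst α).re * t) * ξ ^ (1 + α)) := by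
    intro ξ hξ
    rw [kernelSymbol_of_pos α t hξ, Complex.norm_exp, Complex.re_mul_ofReal, Complex.neg_re,
      Complex.re_mul_ofReal]
  rcases lt_trichotomy ξ 0 with h | h | h
  · have h' : 0 < -ξ := by linarith
    have := kernelSymbol_neg α t (-ξ)
    rw [neg_neg] at this
    rw [this, RCLike.norm_conj, key h', abs_of_neg h]
  · subst h
    rw [kernelSymbol_zero hα, abs_zero, Real.zero_rpow (by linarith)]; simp
  · rw [key h, abs_of_pos h]

lemma continuous_I_mul_cpow {α : ℝ} (hα : 0 < α) :
    Continuous fun ξ : ℝ => (Complex.I * (ξ : ℂ)) ^ ((1 + α : ℝ) : ℂ) := by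
  rw [continuous_iff_continuousAt]
  intro ξ
  by_cases h : ξ = 0
  · subst h
    have h1 : ContinuousAt (fun x : ℂ => x ^ ((1 + α : ℝ) : ℂ)) (Complex.I * ((0 : ℝ) : ℂ)) := by
      have := Complex.continuousAt_cpow_zero_of_re_pos (z := ((1 + α : ℝ) : ℂ))
        (by rw [Complex.ofReal_re]; linarith)
      have h2 := this.comp (f := fun x : ℂ => (x, ((1 + α : ℝ) : ℂ))) (x := 0) (by fun_prop)
      have e : Complex.I * ((0 : ℝ) : ℂ) = 0 := by simp
      rw [e]
      exact h2
    exact h1.comp (f := fun ξ : ℝ => Complex.I * (ξ : ℂ)) (by fun_prop)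
  · apply ContinuousAt.cpow (by fun_prop) (by fun_prop)
    rw [Complex.mem_slitPlane_iff]
    right
    simpa using h

lemma continuous_kernelSymbol {α : ℝ} (hα : 0 < α) (t : ℝ) : Continuous (kernelSymbol α t) := by
  have := continuous_I_mul_cpow hα
  unfold kernelSymbol
  fun_prop

lemma integrable_comp_abs_exp {b p : ℝ} (hb : 0 < b) (hp : 0 < p) :
    Integrable fun ξ : ℝ => Real.exp (-b * |ξ| ^ p) := by
  have h := integrableOn_rpow_mul_exp_neg_mul_rpow (p := p) (s := 0) (b := b) (by norm_num) hp hb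
  simp only [Real.rpow_zero, one_mul] at h
  have hf : IntegrableOn (fun ξ : ℝ => Real.exp (-b * |ξ| ^ p)) (Ioi 0) :=
    h.congr_fun (fun ξ hξ => by simp only [abs_of_pos (show (0 : ℝ) < ξ from hξ)]) measurableSet_Ioi
  have hg : IntegrableOn (fun ξ : ℝ => Real.exp (-b * |ξ| ^ p)) (Iic 0) := by
    rw [← Measure.map_neg_eq_self (volume : Measure ℝ)]
    let m : MeasurableEmbedding fun x : ℝ => -x := (Homeomorph.neg ℝ).measurableEmbedding
    rw [m.integrableOn_map_iff]
    simp_rw [Function.comp_def, abs_neg, neg_preimage, neg_Iic, neg_zero]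
    exact Iff.mpr integrableOn_Ici_iff_integrableOn_Ioi hf
  rw [← integrableOn_univ, ← Iic_union_Ioi (a := (0 : ℝ))]
  exact hg.union hf

lemma integrable_kernelSymbol {α : ℝ} (hα : 0 < α) (hα1 : α < 1) {t : ℝ} (ht : 0 < t) :
    Integrable (kernelSymbol α t) := by
  refine (integrable_comp_abs_exp (mul_pos (symbolConst_re_pos hα hα1) ht)
    (by linarith : 0 < 1 + α)).mono' (continuous_kernelSymbol hα t).aestronglyMeasurable ?_
  exact Filter.Eventually.of_forall fun ξ => (norm_kernelSymbol hα t ξ).le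

lemma norm_exp_I_mul (x ξ : ℝ) : ‖Complex.exp (Complex.I * (x : ℂ) * (ξ : ℂ))‖ = 1 := by
  rw [Complex.norm_exp]; simp

lemma integrable_kernelSymbol_mul_exp {α : ℝ} (hα : 0 < α) (hα1 : α < 1) {t : ℝ} (ht : 0 < t)
    (x : ℝ) :
    Integrable fun ξ : ℝ => kernelSymbol α t ξ * Complex.exp (Complex.I * (x : ℂ) * (ξ : ℂ)) := by
  refine (integrable_kernelSymbol hα hα1 ht).mono
    (by have := continuous_kernelSymbol hα t; exact Continuous.aestronglyMeasurable (by fun_prop)) ?_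
  exact Filter.Eventually.of_forall fun ξ => by rw [norm_mul, norm_exp_I_mul, mul_one]

/-- Conjugate symmetry of the multiplier folds the line onto the half-line: the two halves are
conjugate and add up to twice a real part. -/
lemma kernelK_eq_halfLine {α : ℝ} (hα : 0 < α) (hα1 : α < 1) {t : ℝ} (ht : 0 < t) (x : ℝ) :
    kernelK α t x = Real.pi⁻¹ * (halfLineIntegral (symbolConst α * t) (1 + α) 0 x).re := by
  have hi := integrable_kernelSymbol_mul_exp hα hα1 ht x
  have e0 : kernelK α t x = (2 * Real.pi)⁻¹ * (∫ ξ : ℝ, kernelSymbol α t ξ *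
    Complex.exp (Complex.I * (x : ℂ) * (ξ : ℂ))).re := rfl
  have e1 : ∫ ξ in Ioi (0 : ℝ), kernelSymbol α t ξ * Complex.exp (Complex.I * (x : ℂ) * (ξ : ℂ)) =
      halfLineIntegral (symbolConst α * t) (1 + α) 0 x := by
    rw [halfLineIntegral]
    refine setIntegral_congr_fun measurableSet_Ioi fun ξ hξ => ?_
    simp only [Real.rpow_zero, Complex.ofReal_one, one_mul]
    rw [kernelSymbol_of_pos α t hξ]
  have e2 : ∫ ξ in Iic (0 : ℝ), kernelSymbol α t ξ * Complex.exp (Complex.I * (x : ℂ) * (ξ : ℂ)) =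
      (starRingEnd ℂ) (halfLineIntegral (symbolConst α * t) (1 + α) 0 x) := by
    rw [← e1, ← integral_conj]
    have := integral_comp_neg_Ioi (E := ℂ) 0 (fun ξ : ℝ => kernelSymbol α t ξ *
      Complex.exp (Complex.I * (x : ℂ) * (ξ : ℂ)))
    rw [neg_zero] at this
    rw [← this]
    refine setIntegral_congr_fun measurableSet_Ioi fun ξ hξ => ?_
    simp only [map_mul]
    rw [kernelSymbol_neg α t ξ, ← Complex.exp_conj]
    simp
  rw [e0, ← intervalIntegral.integral_Iic_add_Ioi hi.integrableOn hi.integrableOn, e1, e2,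
    Complex.add_re, Complex.conj_re]
  field_simp
  ring

/-- Substitute ξ ↦ cξ with c^(1+α) t = 1. Every estimate on the kernel thereby reduces to time one.
-/
lemma kernelK_scaling {α : ℝ} (hα : 0 < α) (hα1 : α < 1) {t : ℝ} (ht : 0 < t) (x : ℝ) :
    kernelK α t x = t ^ (-(1 + α)⁻¹) * kernelK α 1 (t ^ (-(1 + α)⁻¹) * x) := by
  set c := t ^ (-(1 + α)⁻¹) with hc
  have hc0 : 0 < c := Real.rpow_pos_of_pos ht _
  have hcs : c ^ (1 + α) * t = 1 := by
    rw [hc, ← Real.rpow_mul ht.le, neg_mul, inv_mul_cancel₀ (by linarith), Real.rpow_neg_one,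
      inv_mul_cancel₀ ht.ne']
  rw [kernelK_eq_halfLine hα hα1 ht, kernelK_eq_halfLine hα hα1 one_pos]
  have h := integral_comp_mul_left_Ioi (E := ℂ) (fun ξ : ℝ => ((ξ ^ (0 : ℝ) : ℝ) : ℂ) *
    Complex.exp (-(symbolConst α * t) * ((ξ ^ (1 + α) : ℝ) : ℂ)) *
    Complex.exp (Complex.I * x * ξ)) 0 hc0
  rw [mul_zero] at h
  have e : halfLineIntegral (symbolConst α * (1 : ℝ)) (1 + α) 0 (c * x) =
      c⁻¹ • halfLineIntegral (symbolConst α * t) (1 + α) 0 x := by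
    rw [halfLineIntegral, halfLineIntegral, ← h]
    refine setIntegral_congr_fun measurableSet_Ioi fun ξ hξ => ?_
    simp only [Real.rpow_zero]
    have hξ' : (0 : ℝ) < ξ := hξ
    rw [Real.mul_rpow hc0.le hξ'.le]
    have : (t : ℂ) * ((c ^ (1 + α) : ℝ) : ℂ) = 1 := by rw [mul_comm]; exact_mod_cast hcs
    congr 2
    · congr 1
      push_cast at this ⊢
      linear_combination symbolConst α * ((ξ ^ (1 + α) : ℝ) : ℂ) * this
    · push_cast; ring
  rw [e, Complex.smul_re, smul_eq_mul]
  field_simp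

/-- First and second derivatives of the profile `K(1,·)`. -/
def profileDeriv (α x : ℝ) : ℝ :=
  Real.pi⁻¹ * (Complex.I * halfLineIntegral (symbolConst α * (1 : ℝ)) (1 + α) 1 x).re

def profileDeriv₂ (α x : ℝ) : ℝ :=
  Real.pi⁻¹ * (-halfLineIntegral (symbolConst α * (1 : ℝ)) (1 + α) 2 x).re

lemma symbolConst_mul_re_pos {α : ℝ} (h0 : 0 < α) (h1 : α < 1) {t : ℝ} (ht : 0 < t) :
    0 < (symbolConst α * t).re := by
  rw [Complex.re_mul_ofReal]; exact mul_pos (symbolConst_re_pos h0 h1) ht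

lemma hasDerivAt_profile {α : ℝ} (hα : 0 < α) (hα1 : α < 1) (x : ℝ) :
    HasDerivAt (kernelK α 1) (profileDeriv α x) x := by
  have h := hasDerivAt_halfLineIntegral (symbolConst_mul_re_pos hα hα1 one_pos)
    (by linarith : 0 < 1 + α) (by norm_num : (-1 : ℝ) < 0) x
  have h2 := (Complex.reCLM.hasFDerivAt.comp_hasDerivAt x h).const_mul Real.pi⁻¹
  have e : kernelK α 1 = fun y => Real.pi⁻¹ *
      (Complex.reCLM ∘ fun y => halfLineIntegral (symbolConst α * (1 : ℝ)) (1 + α) 0 y) y := by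
    ext y
    exact kernelK_eq_halfLine hα hα1 one_pos y
  rw [e]
  refine h2.congr_deriv ?_
  rw [zero_add]
  rfl

lemma hasDerivAt_profileDeriv {α : ℝ} (hα : 0 < α) (hα1 : α < 1) (x : ℝ) :
    HasDerivAt (profileDeriv α) (profileDeriv₂ α x) x := by
  have h := (hasDerivAt_halfLineIntegral (symbolConst_mul_re_pos hα hα1 one_pos)
    (by linarith : 0 < 1 + α) (by norm_num : (-1 : ℝ) < 1) x).const_mul Complex.I
  have h2 := (Complex.reCLM.hasFDerivAt.comp_hasDerivAt x h).const_mul Real.pi⁻¹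
  refine h2.congr_deriv ?_
  simp only [profileDeriv₂, Complex.reCLM_apply]
  rw [← mul_assoc, Complex.I_mul_I]
  norm_num

/-- Each function is bounded, and bounded after multiplication by x². Quadratic decay suffices for
integrability and for moments of order below one. -/
lemma exists_profile_decay {α : ℝ} (hα : 0 < α) (hα1 : α < 1) :
    ∃ C : ℝ, 0 < C ∧ ∀ x : ℝ, |kernelK α 1 x| ≤ C * (1 + x ^ 2)⁻¹ ∧
      |profileDeriv α x| ≤ C * (1 + x ^ 2)⁻¹ ∧ |profileDeriv₂ α x| ≤ C * (1 + x ^ 2)⁻¹ := by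
  have hζ := symbolConst_mul_re_pos hα hα1 one_pos
  set ζ := symbolConst α * (1 : ℝ)
  obtain ⟨A0, h0⟩ := sq_mul_re_halfLineIntegral_zero_le hζ (by linarith : 1 < 1 + α)
  obtain ⟨A1, h1⟩ := sq_mul_norm_halfLineIntegral_le hζ (by linarith : 1 ≤ 1 + α) (le_refl 1)
  obtain ⟨A2, h2⟩ := sq_mul_norm_halfLineIntegral_le hζ (by linarith : 1 ≤ 1 + α) one_le_two
  have b0 := fun x => norm_halfLineIntegral_le ζ (1 + α) 0 x
  have b1 := fun x => norm_halfLineIntegral_le ζ (1 + α) 1 x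
  have b2 := fun x => norm_halfLineIntegral_le ζ (1 + α) 2 x
  set B0 := ∫ ξ in Ioi (0 : ℝ), ξ ^ (0 : ℝ) * Real.exp (-ζ.re * ξ ^ (1 + α))
  set B1 := ∫ ξ in Ioi (0 : ℝ), ξ ^ (1 : ℝ) * Real.exp (-ζ.re * ξ ^ (1 + α))
  set B2 := ∫ ξ in Ioi (0 : ℝ), ξ ^ (2 : ℝ) * Real.exp (-ζ.re * ξ ^ (1 + α))
  set D := |A0| + |A1| + |A2| + |B0| + |B1| + |B2| + 1 with hD
  have key : ∀ x v A B : ℝ, x ^ 2 * |v| ≤ A → |v| ≤ B → A + B ≤ D →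
      |Real.pi⁻¹ * v| ≤ (Real.pi⁻¹ * D) * (1 + x ^ 2)⁻¹ := by
    intro x v A B h1 h2 h3
    rw [abs_mul, abs_of_pos (inv_pos.2 Real.pi_pos), mul_assoc]
    refine mul_le_mul_of_nonneg_left ?_ (inv_pos.2 Real.pi_pos).le
    rw [← div_eq_mul_inv, le_div_iff₀ (by positivity)]
    nlinarith
  have hs := abs_nonneg A0
  have hs := abs_nonneg A1
  have hs := abs_nonneg A2
  have hs := abs_nonneg B0
  have hs := abs_nonneg B1
  have hs := abs_nonneg B2
  have hs := le_abs_self A0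
  have hs := le_abs_self A1
  have hs := le_abs_self A2
  have hs := le_abs_self B0
  have hs := le_abs_self B1
  have hs := le_abs_self B2
  refine ⟨Real.pi⁻¹ * D, by positivity, fun x => ⟨?_, ?_, ?_⟩⟩
  · rw [kernelK_eq_halfLine hα hα1 one_pos]
    exact key x _ A0 B0 (h0 x) ((Complex.abs_re_le_norm _).trans (b0 x)) (by rw [hD]; linarith)
  · refine key x _ A1 B1 ?_ ?_ (by rw [hD]; linarith)
    · refine (mul_le_mul_of_nonneg_left (Complex.abs_re_le_norm _) (sq_nonneg x)).trans ?_
      rw [norm_mul, Complex.norm_I, one_mul]; exact h1 x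
    · refine (Complex.abs_re_le_norm _).trans ?_
      rw [norm_mul, Complex.norm_I, one_mul]; exact b1 x
  · refine key x _ A2 B2 ?_ ?_ (by rw [hD]; linarith)
    · refine (mul_le_mul_of_nonneg_left (Complex.abs_re_le_norm _) (sq_nonneg x)).trans ?_
      rw [norm_neg]; exact h2 x
    · refine (Complex.abs_re_le_norm _).trans ?_
      rw [norm_neg]; exact b2 x

end

/-! ### A class of functions with nonnegative Fourier integrals. -/

noncomputable section

open scoped ComplexOrder

/-- A bounded continuous function whose Fourier transform, regularised by a Gaussian, is
nonnegative. -/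
structure GaussPositive (δ : ℝ) (F : ℝ → ℂ) : Prop where
  continuous : Continuous F
  bounded : ∃ B : ℝ, ∀ ξ, ‖F ξ‖ ≤ B
  nonneg : ∀ x : ℝ, 0 ≤ ∫ ξ : ℝ, F ξ * (Complex.exp (Complex.I * (x : ℂ) * (ξ : ℂ)) *
    Complex.exp (-(δ : ℂ) * (ξ : ℂ) ^ 2))

namespace GaussPositive

lemma norm_gauss {δ : ℝ} (x ξ : ℝ) : ‖Complex.exp (Complex.I * (x : ℂ) * (ξ : ℂ)) *
    Complex.exp (-(δ : ℂ) * (ξ : ℂ) ^ 2)‖ = Real.exp (-δ * ξ ^ 2) := by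
  rw [norm_mul, norm_exp_I_mul, one_mul, Complex.norm_exp]
  congr 1
  have : -(δ : ℂ) * (ξ : ℂ) ^ 2 = ((-δ * ξ ^ 2 : ℝ) : ℂ) := by push_cast; ring
  rw [this, Complex.ofReal_re]

lemma integrable {δ : ℝ} (hδ : 0 < δ) {F : ℝ → ℂ} (hc : Continuous F) {B : ℝ}
    (hB : ∀ ξ, ‖F ξ‖ ≤ B) (x : ℝ) :
    Integrable fun ξ : ℝ => F ξ * (Complex.exp (Complex.I * (x : ℂ) * (ξ : ℂ)) *
    Complex.exp (-(δ : ℂ) * (ξ : ℂ) ^ 2)) := by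
  refine ((integrable_exp_neg_mul_sq hδ).const_mul B).mono'
    (Continuous.aestronglyMeasurable (by fun_prop)) (Filter.Eventually.of_forall fun ξ => ?_)
  rw [norm_mul, norm_gauss]
  exact mul_le_mul_of_nonneg_right (hB ξ) (Real.exp_pos _).le

lemma one {δ : ℝ} (hδ : 0 < δ) : GaussPositive δ (fun _ => 1) := by
  refine ⟨continuous_const, ⟨1, fun _ => by simp⟩, fun x => ?_⟩
  simp only [one_mul]
  rw [fourierIntegral_gaussian (by simpa using hδ)]
  have h1 : ((Real.pi : ℂ) / (δ : ℂ)) ^ (1 / 2 : ℂ) = (((Real.pi / δ) ^ (1 / 2 : ℝ) : ℝ) : ℂ) := by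
    rw [Complex.ofReal_cpow (by positivity)]; push_cast; rfl
  have h2 : Complex.exp (-(x : ℂ) ^ 2 / (4 * (δ : ℂ))) = ((Real.exp (-x ^ 2 / (4 * δ)) : ℝ) : ℂ) := by
    push_cast; rfl
  rw [h1, h2, ← Complex.ofReal_mul, Complex.zero_le_real]
  positivity

/-- Multiplying by a character translates the Fourier integral. -/
lemma mul_char {δ : ℝ} {F : ℝ → ℂ} (hF : GaussPositive δ F) (y : ℝ) :
    GaussPositive δ (fun ξ => F ξ * Complex.exp (Complex.I * (y : ℂ) * (ξ : ℂ))) := by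
  obtain ⟨hc, ⟨B, hB⟩, hn⟩ := hF
  refine ⟨by fun_prop, ⟨B, fun ξ => by rw [norm_mul, norm_exp_I_mul, mul_one]; exact hB ξ⟩,
    fun x => ?_⟩
  convert hn (y + x) using 1
  refine integral_congr_ae (Filter.Eventually.of_forall fun ξ => ?_)
  simp only
  rw [mul_assoc, ← mul_assoc (Complex.exp _), ← Complex.exp_add]
  congr 4
  push_cast; ring

lemma add {δ : ℝ} (hδ : 0 < δ) {F G : ℝ → ℂ} (hF : GaussPositive δ F) (hG : GaussPositive δ G) :
    GaussPositive δ (fun ξ => F ξ + G ξ) := by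
  obtain ⟨hc, ⟨B, hB⟩, hn⟩ := hF
  obtain ⟨hc', ⟨B', hB'⟩, hn'⟩ := hG
  refine ⟨by fun_prop, ⟨B + B', fun ξ => (norm_add_le _ _).trans (add_le_add (hB ξ) (hB' ξ))⟩,
    fun x => ?_⟩
  simp only [add_mul]
  rw [integral_add (integrable hδ hc hB x) (integrable hδ hc' hB' x)]
  exact add_nonneg (hn x) (hn' x)

lemma const_mul {δ : ℝ} {F : ℝ → ℂ} (hF : GaussPositive δ F) {c : ℝ} (h0 : 0 ≤ c) :
    GaussPositive δ (fun ξ => (c : ℂ) * F ξ) := by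
  obtain ⟨hc, ⟨B, hB⟩, hn⟩ := hF
  refine ⟨by fun_prop, ⟨c * B, fun ξ => ?_⟩, fun x => ?_⟩
  · rw [norm_mul, Complex.norm_real, Real.norm_of_nonneg h0]
    exact mul_le_mul_of_nonneg_left (hB ξ) h0
  · simp only [mul_assoc (c : ℂ)]
    rw [integral_const_mul]
    exact mul_nonneg (by exact_mod_cast h0) (hn x)

lemma zero (δ : ℝ) : GaussPositive δ (fun _ => 0) :=
  ⟨continuous_const, ⟨0, fun _ => by simp⟩, fun x => by simp⟩

lemma finset_sum {δ : ℝ} (hδ : 0 < δ) {ι : Type*} (S : Finset ι) {F : ι → ℝ → ℂ}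
    (hF : ∀ i ∈ S, GaussPositive δ (F i)) : GaussPositive δ (fun ξ => ∑ i ∈ S, F i ξ) := by
  classical
  induction S using Finset.induction_on with
  | empty => simpa using zero δ
  | insert i S hi ih =>
    simp only [Finset.sum_insert hi]
    exact (hF i (Finset.mem_insert_self _ _)).add hδ
      (ih fun j hj => hF j (Finset.mem_insert_of_mem hj))

/-- The Gaussian factor turns a uniform bound into a dominating function, so pointwise limits
preserve the class. The origin is left out because the Grünwald limit is only taken at ξ ≠ 0. -/
lemma of_tendsto {δ : ℝ} (hδ : 0 < δ) {F : ℕ → ℝ → ℂ} {G : ℝ → ℂ} {B : ℝ}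
    (hF : ∀ n, GaussPositive δ (F n)) (hB : ∀ n ξ, ‖F n ξ‖ ≤ B) (hG : Continuous G)
    (hlim : ∀ ξ, ξ ≠ 0 → Filter.Tendsto (fun n => F n ξ) Filter.atTop (nhds (G ξ))) :
    GaussPositive δ G := by
  have hGB : ∀ ξ, ‖G ξ‖ ≤ B := by
    have h0 : ∀ ξ, ξ ≠ 0 → ‖G ξ‖ ≤ B := fun ξ hξ =>
      le_of_tendsto (hlim ξ hξ).norm (Filter.Eventually.of_forall fun n => hB n ξ)
    intro ξ
    have hcl : IsClosed {ξ | ‖G ξ‖ ≤ B} := isClosed_le (by fun_prop) continuous_const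
    have hd : Dense ({0}ᶜ : Set ℝ) := dense_compl_singleton 0
    -- At ξ = 0 the bound follows from continuity of `G` and density of the other points.
    exact (hcl.closure_subset_iff.2 (fun ξ hξ => h0 ξ hξ)) (hd ξ)
  refine ⟨hG, ⟨B, hGB⟩, fun x => ?_⟩
  have ht := tendsto_integral_of_dominated_convergence
    (F := fun n ξ => F n ξ * (Complex.exp (Complex.I * (x : ℂ) * (ξ : ℂ)) *
      Complex.exp (-(δ : ℂ) * (ξ : ℂ) ^ 2)))
    (f := fun ξ => G ξ * (Complex.exp (Complex.I * (x : ℂ) * (ξ : ℂ)) *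
      Complex.exp (-(δ : ℂ) * (ξ : ℂ) ^ 2)))
    (fun ξ : ℝ => B * Real.exp (-δ * ξ ^ 2))
    (fun n => (integrable hδ (hF n).continuous (hB n) x).aestronglyMeasurable)
    ((integrable_exp_neg_mul_sq hδ).const_mul B)
    (fun n => Filter.Eventually.of_forall fun ξ => by
      rw [norm_mul, norm_gauss]
      exact mul_le_mul_of_nonneg_right (hB n ξ) (Real.exp_pos _).le)
    (by
      filter_upwards [compl_mem_ae_iff.2 (measure_singleton (0 : ℝ))] with ξ hξ
      exact (hlim ξ hξ).mul_const _)
  exact ge_of_tendsto ht (Filter.Eventually.of_forall fun n => (hF n).nonneg x)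

/-- Multiplication by an absolutely convergent nonnegative combination of characters. -/
lemma mul_charSeries {δ : ℝ} (hδ : 0 < δ) {F : ℝ → ℂ} (hF : GaussPositive δ F) {c y : ℕ → ℝ}
    (hc : ∀ k, 0 ≤ c k) (hs : Summable c) {H : ℝ → ℂ} (hHc : Continuous H)
    (hH : ∀ ξ : ℝ, HasSum (fun k => (c k : ℂ) * Complex.exp (Complex.I * (y k : ℂ) * (ξ : ℂ))) (H ξ)) :
    GaussPositive δ (fun ξ => H ξ * F ξ) := by
  obtain ⟨B, hB⟩ := hF.bounded
  have hB0 : 0 ≤ B := (norm_nonneg _).trans (hB 0)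
  refine of_tendsto hδ (F := fun n ξ => ∑ k ∈ Finset.range n,
    ((c k : ℂ) * (F ξ * Complex.exp (Complex.I * (y k : ℂ) * (ξ : ℂ))))) (B := (∑' k, c k) * B)
    (fun n => finset_sum hδ _ fun k _ => (hF.mul_char (y k)).const_mul (hc k)) ?_
    (hHc.mul hF.continuous) ?_
  · intro n ξ
    refine (norm_sum_le _ _).trans ?_
    calc _ ≤ ∑ k ∈ Finset.range n, c k * B := by
          refine Finset.sum_le_sum fun k _ => ?_
          rw [norm_mul, norm_mul, norm_exp_I_mul, mul_one, Complex.norm_real,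
            Real.norm_of_nonneg (hc k)]
          exact mul_le_mul_of_nonneg_left (hB ξ) (hc k)
      _ = (∑ k ∈ Finset.range n, c k) * B := by rw [Finset.sum_mul]
      _ ≤ _ := mul_le_mul_of_nonneg_right (hs.sum_le_tsum _ fun k _ => hc k) hB0
  · intro ξ _
    have := ((hH ξ).mul_right (F ξ)).tendsto_sum_nat
    refine this.congr fun n => Finset.sum_congr rfl fun k _ => ?_
    ring

/-- All powers of `H` stay in the class, hence so do the partial sums of the exponential series,
which are uniformly bounded by the exponential of the total mass of the coefficients. -/
lemma exp_charSeries {δ : ℝ} (hδ : 0 < δ) {c y : ℕ → ℝ}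
    (hc : ∀ k, 0 ≤ c k) (hs : Summable c) {H : ℝ → ℂ} (hHc : Continuous H)
    (hH : ∀ ξ : ℝ, HasSum (fun k => (c k : ℂ) * Complex.exp (Complex.I * (y k : ℂ) * (ξ : ℂ))) (H ξ)) :
    GaussPositive δ (fun ξ => Complex.exp (H ξ)) := by
  have hHn : ∀ ξ, ‖H ξ‖ ≤ ∑' k, c k := fun ξ => by
    rw [← (hH ξ).tsum_eq]
    refine tsum_of_norm_bounded hs.hasSum fun k => ?_
    rw [norm_mul, norm_exp_I_mul, mul_one, Complex.norm_real, Real.norm_of_nonneg (hc k)]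
  have hpow : ∀ n : ℕ, GaussPositive δ (fun ξ => H ξ ^ n) := by
    intro n
    induction n with
    | zero => simpa using one hδ
    | succ n ih => simpa only [pow_succ'] using mul_charSeries hδ ih hc hs hHc hH
  refine of_tendsto hδ (F := fun n ξ => ∑ j ∈ Finset.range n,
    ((((j.factorial : ℝ)⁻¹ : ℝ) : ℂ) * H ξ ^ j)) (B := Real.exp (∑' k, c k))
    (fun n => finset_sum hδ _ fun j _ => (hpow j).const_mul (by positivity)) ?_
    (by fun_prop) ?_
  · intro n ξ
    refine (norm_sum_le _ _).trans ?_
    have hS : 0 ≤ ∑' k, c k := tsum_nonneg hc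
    refine le_trans (Finset.sum_le_sum fun j _ => ?_) (Real.sum_le_exp_of_nonneg hS n)
    rw [norm_mul, norm_pow, Complex.norm_real, Real.norm_of_nonneg (by positivity), div_eq_inv_mul]
    gcongr
    exact hHn ξ
  · intro ξ _
    have := (NormedSpace.expSeries_div_hasSum_exp (H ξ)).tendsto_sum_nat
    rw [← Complex.exp_eq_exp_ℂ] at this
    refine this.congr fun n => Finset.sum_congr rfl fun j _ => ?_
    push_cast
    ring

end GaussPositive

end

/-! ### Positivity of the kernel by Grünwald approximation. -/

noncomputable section

open scoped ComplexOrder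

/-- Taylor coefficients of `(1 - z)^s`. -/
def oneSubCoeff (s : ℝ) (k : ℕ) : ℝ := (-1) ^ k * Ring.choose s k

lemma oneSubCoeff_zero (s : ℝ) : oneSubCoeff s 0 = 1 := by simp [oneSubCoeff]

lemma oneSubCoeff_one (s : ℝ) : oneSubCoeff s 1 = -s := by simp [oneSubCoeff]

lemma oneSubCoeff_succ (s : ℝ) (k : ℕ) :
    oneSubCoeff s (k + 1) = oneSubCoeff s k * ((k - s) / (k + 1)) := by
  have : Ring.choose s (k + 1) = Ring.choose s k * ((s - k) / (k + 1)) := by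
    rw [Ring.choose_eq_smul, Ring.choose_eq_smul, descPochhammer_succ_right,
      Polynomial.smeval_mul, Polynomial.smeval_sub, Polynomial.smeval_X, Polynomial.smeval_natCast,
      Nat.factorial_succ]
    have : (k.factorial : ℝ) ≠ 0 := by positivity
    simp only [smul_eq_mul, pow_zero, pow_one, nsmul_eq_mul, mul_one]
    push_cast
    field_simp
  rw [oneSubCoeff, oneSubCoeff, this, pow_succ]
  ring

/-- The ratio (k - s)/(k + 1) of consecutive coefficients is negative only for k = 0 and k = 1, so
the sign changes twice and only the coefficient with k = 1 is negative. -/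
lemma oneSubCoeff_nonneg {s : ℝ} (h1 : 1 < s) (h2 : s < 2) : ∀ k : ℕ, k ≠ 1 → 0 ≤ oneSubCoeff s k
  | 0, _ => by rw [oneSubCoeff_zero]; norm_num
  | 1, h => absurd rfl h
  | 2, _ => by
    rw [oneSubCoeff_succ, oneSubCoeff_one]
    push_cast
    rw [show -s * ((1 - s) / (1 + 1)) = s * (s - 1) / 2 by ring]
    have : 0 ≤ s - 1 := by linarith
    positivity
  | k + 3, _ => by
    rw [oneSubCoeff_succ]
    refine mul_nonneg (oneSubCoeff_nonneg h1 h2 (k + 2) (by omega)) (div_nonneg ?_ (by positivity))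
    push_cast
    have : (0 : ℝ) ≤ k := k.cast_nonneg
    linarith

lemma hasSum_oneSub_cpow (s : ℝ) {z : ℂ} (hz : ‖z‖ < 1) :
    HasSum (fun k => (oneSubCoeff s k : ℂ) * z ^ k) ((1 - z) ^ (s : ℂ)) := by
  have h := (Complex.one_add_cpow_hasFPowerSeriesOnBall_zero (a := (s : ℂ))).hasSum (y := -z)
    (by rw [← ENNReal.ofReal_one, Metric.eball_ofReal]; simpa using hz)
  rw [zero_add, ← sub_eq_add_neg] at h
  refine h.congr_fun fun k => ?_
  rw [binomialSeries_apply, oneSubCoeff, List.ofFn_const, List.prod_replicate, neg_pow,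
    ← Complex.ofReal_choose, smul_eq_mul]
  push_cast
  ring

lemma hasSum_oneSub_rpow (s : ℝ) {r : ℝ} (h0 : 0 ≤ r) (h1 : r < 1) :
    HasSum (fun k => oneSubCoeff s k * r ^ k) ((1 - r) ^ s) := by
  have h := hasSum_oneSub_cpow s (z := (r : ℂ)) (by rw [Complex.norm_real, Real.norm_of_nonneg h0]; exact h1)
  rw [← Complex.ofReal_one, ← Complex.ofReal_sub, ← Complex.ofReal_cpow (by linarith)] at h
  exact_mod_cast h

/-- The factor e^{iηξ} shifts the frequencies so that the only negative Taylor term, k = 1, becomes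
a constant. Adding a constant to the exponent cancels it, and only multiplies the exponential by a
positive number. Taking r < 1 keeps the binomial series inside its disc of convergence. -/
lemma gaussPositive_exp_oneSub {δ s r l : ℝ} (hδ : 0 < δ) (hs1 : 1 < s) (hs2 : s < 2)
    (hr0 : 0 < r) (hr1 : r < 1) (hl : 0 ≤ l) (η : ℝ) :
    GaussPositive δ (fun ξ => Complex.exp (l * (Complex.exp (Complex.I * (η : ℂ) * (ξ : ℂ)) *
      (1 - r * Complex.exp (Complex.I * ((-η : ℝ) : ℂ) * (ξ : ℂ))) ^ (s : ℂ)))) ∧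
    ∀ ξ : ℝ, ‖Complex.exp (l * (Complex.exp (Complex.I * (η : ℂ) * (ξ : ℂ)) *
      (1 - r * Complex.exp (Complex.I * ((-η : ℝ) : ℂ) * (ξ : ℂ))) ^ (s : ℂ)))‖ ≤
      Real.exp (l * (1 - r) ^ s) := by
  -- The correction at k = 1 makes that coefficient exactly zero; its total effect `l * (s * r)` is
  -- divided out again in `eD`.
  set c : ℕ → ℝ := fun k => l * (oneSubCoeff s k * r ^ k + if k = 1 then s * r else 0) with hc
  set y : ℕ → ℝ := fun k => -η * (k - 1) with hy
  set D : ℝ → ℂ := fun ξ => l * (Complex.exp (Complex.I * (η : ℂ) * (ξ : ℂ)) *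
      (1 - r * Complex.exp (Complex.I * ((-η : ℝ) : ℂ) * (ξ : ℂ))) ^ (s : ℂ)) with hD
  have hz : ∀ ξ : ℝ, ‖(r : ℂ) * Complex.exp (Complex.I * ((-η : ℝ) : ℂ) * (ξ : ℂ))‖ < 1 := by
    intro ξ
    rw [norm_mul, norm_exp_I_mul, mul_one, Complex.norm_real, Real.norm_of_nonneg hr0.le]
    exact hr1
  have hc0 : ∀ k, 0 ≤ c k := by
    intro k
    refine mul_nonneg hl ?_
    by_cases hk : k = 1
    · subst hk; rw [oneSubCoeff_one]; simp
    · rw [if_neg hk, add_zero]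
      exact mul_nonneg (oneSubCoeff_nonneg hs1 hs2 k hk) (by positivity)
  have hsum : HasSum c (l * ((1 - r) ^ s + s * r)) :=
    ((hasSum_oneSub_rpow s hr0.le hr1).add (hasSum_ite_eq 1 (s * r))).mul_left l
  have hH : ∀ ξ : ℝ, HasSum (fun k => (c k : ℂ) * Complex.exp (Complex.I * (y k : ℂ) * (ξ : ℂ)))
      (D ξ + ((l * (s * r) : ℝ) : ℂ)) := by
    intro ξ
    have h1 := (hasSum_oneSub_cpow s (hz ξ)).mul_left (Complex.exp (Complex.I * (η : ℂ) * (ξ : ℂ)))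
    have h2 := (h1.add (hasSum_ite_eq 1 ((s * r : ℝ) : ℂ))).mul_left (l : ℂ)
    have e : (l : ℂ) * (Complex.exp (Complex.I * (η : ℂ) * (ξ : ℂ)) *
      (1 - r * Complex.exp (Complex.I * ((-η : ℝ) : ℂ) * (ξ : ℂ))) ^ (s : ℂ) + ((s * r : ℝ) : ℂ)) =
      D ξ + ((l * (s * r) : ℝ) : ℂ) := by
      simp only [hD]; push_cast; ring
    rw [e] at h2
    refine h2.congr_fun fun k => ?_
    have e2 : Complex.exp (Complex.I * (η : ℂ) * (ξ : ℂ)) *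
        (Complex.exp (Complex.I * ((-η : ℝ) : ℂ) * (ξ : ℂ))) ^ k =
        Complex.exp (Complex.I * (y k : ℂ) * (ξ : ℂ)) := by
      rw [← Complex.exp_nat_mul, ← Complex.exp_add]
      congr 1
      simp only [hy]; push_cast; ring
    by_cases hk : k = 1
    · subst hk
      simp [hc, oneSubCoeff_one, hy]
      rw [show Complex.exp (Complex.I * η * ξ) * (s * (r * Complex.exp (-(Complex.I * η * ξ)))) =
        s * r * (Complex.exp (Complex.I * η * ξ) * Complex.exp (-(Complex.I * η * ξ))) by ring,
        ← Complex.exp_add]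
      simp
    · simp only [hc, if_neg hk, add_zero]
      rw [← e2, mul_pow]
      push_cast
      ring
  have hDc : Continuous D := by
    rw [continuous_iff_continuousAt]
    intro ξ
    have : ContinuousAt (fun ξ : ℝ =>
        (1 - r * Complex.exp (Complex.I * ((-η : ℝ) : ℂ) * (ξ : ℂ))) ^ (s : ℂ)) ξ := by
      apply ContinuousAt.cpow (by fun_prop) (by fun_prop)
      rw [sub_eq_add_neg]
      exact Complex.mem_slitPlane_of_norm_lt_one (by rw [norm_neg]; exact hz ξ)
    simp only [hD]
    fun_prop
  have hG := (GaussPositive.exp_charSeries hδ hc0 hsum.summable (by fun_prop) hH).const_mul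
    (Real.exp_pos (-(l * (s * r)))).le
  have eD : ∀ ξ, ((Real.exp (-(l * (s * r))) : ℝ) : ℂ) *
      Complex.exp (D ξ + ((l * (s * r) : ℝ) : ℂ)) = Complex.exp (D ξ) := by
    intro ξ
    rw [Complex.ofReal_exp, ← Complex.exp_add]
    congr 1
    push_cast; ring
  refine ⟨?_, fun ξ => ?_⟩
  · simpa only [eD] using hG
  · have hn : ‖D ξ + ((l * (s * r) : ℝ) : ℂ)‖ ≤ l * ((1 - r) ^ s + s * r) := by
      rw [← (hH ξ).tsum_eq]
      refine tsum_of_norm_bounded hsum fun k => ?_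
      rw [norm_mul, norm_exp_I_mul, mul_one, Complex.norm_real, Real.norm_of_nonneg (hc0 k)]
    have h3 := (Complex.re_le_norm _).trans hn
    rw [Complex.add_re, Complex.ofReal_re] at h3
    change ‖Complex.exp (D ξ)‖ ≤ _
    rw [Complex.norm_exp, Real.exp_le_exp]
    linarith

/-- `(e^{iηξ} (1 - (1-η²) e^{-iηξ})^s) / η^s → (iξ)^s` as `η → 0⁺`. -/
lemma tendsto_gruenwald (s : ℝ) {ξ : ℝ} (hξ : ξ ≠ 0) :
    Filter.Tendsto (fun η : ℝ => ((η ^ (-s) : ℝ) : ℂ) * (Complex.exp (Complex.I * (η : ℂ) * (ξ : ℂ)) *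
      (1 - ((1 - η ^ 2 : ℝ) : ℂ) * Complex.exp (Complex.I * ((-η : ℝ) : ℂ) * (ξ : ℂ))) ^ (s : ℂ)))
      (nhdsWithin 0 (Ioi 0)) (nhds ((Complex.I * (ξ : ℂ)) ^ (s : ℂ))) := by
  set E : ℝ → ℂ := fun η => Complex.exp (Complex.I * ((-η : ℝ) : ℂ) * (ξ : ℂ)) with hE
  have hE0 : E 0 = 1 := by simp [hE]
  have hEd : HasDerivAt E (-(Complex.I * ξ)) 0 := by
    have e3 : HasDerivAt (fun y : ℝ => ((-y : ℝ) : ℂ)) ((-1 : ℝ) : ℂ) 0 :=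
      (hasDerivAt_id (0 : ℝ)).neg.ofReal_comp
    refine (((e3.const_mul Complex.I).mul_const (ξ : ℂ)).cexp).congr_deriv ?_
    simp
  have hslope : Filter.Tendsto (fun η : ℝ => ((η⁻¹ : ℝ) : ℂ) * (1 - E η)) (nhdsWithin 0 (Ioi 0))
      (nhds (Complex.I * ξ)) := by
    have h := (hEd.tendsto_slope_zero_right).neg
    rw [neg_neg] at h
    refine h.congr fun η => ?_
    rw [zero_add, hE0, Complex.real_smul]
    push_cast
    ring
  have hbase : Filter.Tendsto (fun η : ℝ => ((η⁻¹ : ℝ) : ℂ) *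
      (1 - ((1 - η ^ 2 : ℝ) : ℂ) * E η)) (nhdsWithin 0 (Ioi 0)) (nhds (Complex.I * ξ)) := by
    -- With r = 1 - η² instead of 1, the base changes by η² e^{-iηξ}, which is still negligible
    -- after division by η.
    have hc : Filter.Tendsto (fun η : ℝ => (η : ℂ) * E η) (nhdsWithin 0 (Ioi 0)) (nhds 0) := by
      have : Continuous fun η : ℝ => (η : ℂ) * E η := by simp only [hE]; fun_prop
      have h := (this.tendsto 0).mono_left (nhdsWithin_le_nhds (s := Ioi 0))
      simpa using h
    have h := hslope.add hc
    rw [add_zero] at h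
    refine h.congr' ?_
    filter_upwards [self_mem_nhdsWithin] with η hη
    have : (η : ℂ) ≠ 0 := by exact_mod_cast (ne_of_gt hη)
    push_cast
    field_simp
    ring
  have hpow : Filter.Tendsto (fun η : ℝ => (((η⁻¹ : ℝ) : ℂ) *
      (1 - ((1 - η ^ 2 : ℝ) : ℂ) * E η)) ^ (s : ℂ)) (nhdsWithin 0 (Ioi 0))
      (nhds ((Complex.I * ξ) ^ (s : ℂ))) := by
    refine Filter.Tendsto.cpow hbase tendsto_const_nhds ?_
    rw [Complex.mem_slitPlane_iff]
    right
    simpa using hξ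
  have hexp : Filter.Tendsto (fun η : ℝ => Complex.exp (Complex.I * (η : ℂ) * (ξ : ℂ)))
      (nhdsWithin 0 (Ioi 0)) (nhds 1) := by
    have : Continuous fun η : ℝ => Complex.exp (Complex.I * (η : ℂ) * (ξ : ℂ)) := by fun_prop
    have h := (this.tendsto 0).mono_left (nhdsWithin_le_nhds (s := Ioi 0))
    simpa using h
  have h := hexp.mul hpow
  rw [one_mul] at h
  refine h.congr' ?_
  filter_upwards [Ioo_mem_nhdsGT (zero_lt_one)] with η hη
  have hη0 : 0 < η := hη.1
  have hne : 1 - ((1 - η ^ 2 : ℝ) : ℂ) * E η ≠ 0 := by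
    intro h0
    have h1 : ((1 - η ^ 2 : ℝ) : ℂ) * E η = 1 := (sub_eq_zero.1 h0).symm
    have h2 := congrArg norm h1
    rw [norm_mul, norm_exp_I_mul, mul_one, Complex.norm_real, norm_one, Real.norm_eq_abs,
      abs_of_nonneg (by nlinarith [hη.2])] at h2
    nlinarith
  have hin : ((η⁻¹ : ℝ) : ℂ) ^ (s : ℂ) = ((η ^ (-s) : ℝ) : ℂ) := by
    rw [← Complex.ofReal_cpow (by positivity), Real.inv_rpow hη0.le, Real.rpow_neg hη0.le]
  have hm : (((η⁻¹ : ℝ) : ℂ) * (1 - ((1 - η ^ 2 : ℝ) : ℂ) * E η)) ^ (s : ℂ) =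
      ((η⁻¹ : ℝ) : ℂ) ^ (s : ℂ) * (1 - ((1 - η ^ 2 : ℝ) : ℂ) * E η) ^ (s : ℂ) := by
    have hη' : ((η⁻¹ : ℝ) : ℂ) ≠ 0 := by exact_mod_cast (inv_pos.2 hη0).ne'
    rw [Complex.cpow_def_of_ne_zero (mul_ne_zero hη' hne), Complex.log_ofReal_mul (by positivity) hne,
      add_mul, Complex.exp_add, ← Complex.cpow_def_of_ne_zero hne,
      Complex.ofReal_log (by positivity), ← Complex.cpow_def_of_ne_zero hη']
  rw [hm, hin]
  ring

lemma gaussPositive_kernelSymbol {α t δ : ℝ} (hα : 0 < α) (hα1 : α < 1) (ht : 0 < t)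
    (hδ : 0 < δ) : GaussPositive δ (kernelSymbol α t) := by
  set η : ℕ → ℝ := fun n => 1 / ((n : ℝ) + 2) with hη
  have hηpos : ∀ n, 0 < η n := fun n => by simp only [hη]; positivity
  have hη1 : ∀ n, η n < 1 := fun n => by
    simp only [hη]
    rw [div_lt_one (by positivity)]
    have : (0 : ℝ) ≤ n := n.cast_nonneg
    linarith
  have hηlim : Filter.Tendsto η Filter.atTop (nhdsWithin 0 (Ioi 0)) := by
    refine tendsto_nhdsWithin_iff.2 ⟨?_, Filter.Eventually.of_forall hηpos⟩
    have h := (tendsto_one_div_add_atTop_nhds_zero_nat (𝕜 := ℝ)).comp (Filter.tendsto_add_atTop_nat 1)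
    refine h.congr fun n => ?_
    simp only [hη, Function.comp_apply]
    push_cast
    ring_nf
  have hr0 : ∀ n, 0 < 1 - η n ^ 2 := fun n => by nlinarith [hηpos n, hη1 n]
  have hr1 : ∀ n, 1 - η n ^ 2 < 1 := fun n => by nlinarith [hηpos n, hη1 n]
  have hl : ∀ n, 0 ≤ t * η n ^ (-(1 + α)) := fun n =>
    mul_nonneg ht.le (Real.rpow_nonneg (hηpos n).le _)
  have hmain := fun n => gaussPositive_exp_oneSub hδ (by linarith : 1 < 1 + α)
    (by linarith : 1 + α < 2) (hr0 n) (hr1 n) (hl n) (η n)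
  refine GaussPositive.of_tendsto hδ (B := Real.exp t) (fun n => (hmain n).1) (fun n ξ => ?_)
    (continuous_kernelSymbol hα t) (fun ξ hξ => ?_)
  · refine ((hmain n).2 ξ).trans (Real.exp_le_exp.2 ?_)
    -- Here l (1-r)^s = t η^(-s) η^(2s) = t η^s ≤ t with s = 1 + α, which gives a bound independent
    -- of n.
    rw [sub_sub_cancel, ← Real.rpow_natCast, ← Real.rpow_mul (hηpos n).le, mul_assoc,
      ← Real.rpow_add (hηpos n)]
    have : η n ^ (-(1 + α) + ((2 : ℕ) : ℝ) * (1 + α)) ≤ 1 :=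
      Real.rpow_le_one (hηpos n).le (hη1 n).le (by push_cast; linarith)
    nlinarith
  · have h := (tendsto_gruenwald (1 + α) hξ).comp hηlim
    have h2 := (h.mul_const (t : ℂ)).cexp
    refine h2.congr fun n => ?_
    simp only [Function.comp_apply]
    congr 1
    push_cast
    ring

/-- The Gaussian regularisation is removed by letting its width parameter tend to zero; the
multiplier itself is integrable and dominates. -/
lemma kernelIntegral_nonneg {α t : ℝ} (hα : 0 < α) (hα1 : α < 1) (ht : 0 < t) (x : ℝ) :
    0 ≤ ∫ ξ : ℝ, kernelSymbol α t ξ * Complex.exp (Complex.I * (x : ℂ) * (ξ : ℂ)) := by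
  have hlim := tendsto_integral_of_dominated_convergence (μ := volume)
    (F := fun (n : ℕ) (ξ : ℝ) => kernelSymbol α t ξ * (Complex.exp (Complex.I * (x : ℂ) * (ξ : ℂ)) *
      Complex.exp (-((1 / ((n : ℝ) + 1) : ℝ) : ℂ) * (ξ : ℂ) ^ 2)))
    (f := fun ξ : ℝ => kernelSymbol α t ξ * Complex.exp (Complex.I * (x : ℂ) * (ξ : ℂ)))
    (fun ξ => ‖kernelSymbol α t ξ‖)
    (fun n => by
      have := continuous_kernelSymbol hα t
      exact Continuous.aestronglyMeasurable (by fun_prop))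
    (integrable_kernelSymbol hα hα1 ht).norm
    (fun n => Filter.Eventually.of_forall fun ξ => by
      rw [norm_mul, GaussPositive.norm_gauss]
      refine mul_le_of_le_one_right (norm_nonneg _) (Real.exp_le_one_iff.2 ?_)
      have : 0 ≤ 1 / ((n : ℝ) + 1) * ξ ^ 2 := by positivity
      linarith)
    (Filter.Eventually.of_forall fun ξ => by
      have h1 := (tendsto_one_div_add_atTop_nhds_zero_nat (𝕜 := ℝ))
      have h2 : Continuous fun δ : ℝ => kernelSymbol α t ξ *
        (Complex.exp (Complex.I * (x : ℂ) * (ξ : ℂ)) *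
        Complex.exp (-((δ : ℝ) : ℂ) * (ξ : ℂ) ^ 2)) := by fun_prop
      have h3 := (h2.tendsto 0).comp h1
      simp only [Complex.ofReal_zero, neg_zero, zero_mul, Complex.exp_zero, mul_one] at h3
      exact h3)
  exact ge_of_tendsto hlim (Filter.Eventually.of_forall fun n =>
    (gaussPositive_kernelSymbol hα hα1 ht (by positivity)).nonneg x)

lemma kernelK_nonneg {α t : ℝ} (hα : 0 < α) (hα1 : α < 1) (ht : 0 < t) (x : ℝ) :
    0 ≤ kernelK α t x :=
  mul_nonneg (by positivity) (Complex.nonneg_iff.1 (kernelIntegral_nonneg hα hα1 ht x)).1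

/-- Nonnegativity in the order of ℂ includes vanishing of the imaginary part, so the real part in
the definition of the kernel loses nothing. -/
lemma ofReal_kernelK {α t : ℝ} (hα : 0 < α) (hα1 : α < 1) (ht : 0 < t) (x : ℝ) :
    (kernelK α t x : ℂ) = (2 * Real.pi : ℂ)⁻¹ *
      ∫ ξ : ℝ, kernelSymbol α t ξ * Complex.exp (Complex.I * (x : ℂ) * (ξ : ℂ)) := by
  have h := (Complex.nonneg_iff.1 (kernelIntegral_nonneg hα hα1 ht x)).2
  have e : ((∫ ξ : ℝ, kernelSymbol α t ξ * Complex.exp (Complex.I * (x : ℂ) * (ξ : ℂ))).re : ℂ) =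
      ∫ ξ : ℝ, kernelSymbol α t ξ * Complex.exp (Complex.I * (x : ℂ) * (ξ : ℂ)) :=
    Complex.ext (by simp) (by simpa using h)
  rw [← e]
  have e2 : kernelK α t x = (2 * Real.pi)⁻¹ * (∫ ξ : ℝ, kernelSymbol α t ξ *
    Complex.exp (Complex.I * (x : ℂ) * (ξ : ℂ))).re := rfl
  rw [e2]
  push_cast
  rfl

end

/-! ### Derivative, mass and semigroup property of the kernel. -/

noncomputable section

/-- The scaling factor `t^(-1/(1+α))`. -/
def kernelScale (α t : ℝ) : ℝ := t ^ (-(1 + α)⁻¹)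

lemma kernelScale_pos (α : ℝ) {t : ℝ} (ht : 0 < t) : 0 < kernelScale α t := Real.rpow_pos_of_pos ht _

section
variable {α : ℝ} (hα : 0 < α) (hα1 : α < 1)
include hα hα1

lemma hasDerivAt_kernelK {t : ℝ} (ht : 0 < t) (x : ℝ) :
    HasDerivAt (fun y => kernelK α t y)
      (kernelScale α t * (kernelScale α t * profileDeriv α (kernelScale α t * x))) x := by
  have e : (fun y => kernelK α t y) =
      fun y => kernelScale α t * kernelK α 1 (kernelScale α t * y) := by
    ext y; exact kernelK_scaling hα hα1 ht y
  rw [e]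
  have h := (hasDerivAt_profile hα hα1 (kernelScale α t * x)).comp x
    ((hasDerivAt_id x).const_mul (kernelScale α t))
  refine (h.const_mul (kernelScale α t)).congr_deriv ?_
  ring

lemma kernelKx_eq {t : ℝ} (ht : 0 < t) (x : ℝ) :
    kernelKx α t x =
      kernelScale α t * (kernelScale α t * profileDeriv α (kernelScale α t * x)) :=
  (hasDerivAt_kernelK hα hα1 ht x).deriv

lemma hasDerivAt_kernelK' {t : ℝ} (ht : 0 < t) (x : ℝ) :
    HasDerivAt (fun y => kernelK α t y) (kernelKx α t x) x := by
  rw [kernelKx_eq hα hα1 ht]; exact hasDerivAt_kernelK hα hα1 ht x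

lemma continuous_profile : Continuous (kernelK α 1) :=
  continuous_iff_continuousAt.2 fun x => (hasDerivAt_profile hα hα1 x).continuousAt

lemma continuous_profileDeriv : Continuous (profileDeriv α) :=
  continuous_iff_continuousAt.2 fun x => (hasDerivAt_profileDeriv hα hα1 x).continuousAt

lemma continuous_kernelK {t : ℝ} (ht : 0 < t) : Continuous (kernelK α t) :=
  continuous_iff_continuousAt.2 fun x => (hasDerivAt_kernelK hα hα1 ht x).continuousAt

lemma continuous_kernelKx {t : ℝ} (ht : 0 < t) : Continuous (kernelKx α t) := by
  have h : Continuous fun x => kernelScale α t *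
      (kernelScale α t * profileDeriv α (kernelScale α t * x)) :=
    continuous_const.mul (continuous_const.mul
      ((continuous_profileDeriv hα hα1).comp (continuous_const.mul continuous_id)))
  exact h.congr fun x => (kernelKx_eq hα hα1 ht x).symm

lemma integrable_profile : Integrable (kernelK α 1) := by
  obtain ⟨C, _, hC⟩ := exists_profile_decay hα hα1
  exact (integrable_inv_one_add_sq.const_mul C).mono' (continuous_profile hα hα1).aestronglyMeasurable
    (Filter.Eventually.of_forall fun x => (hC x).1)

lemma integrable_profileDeriv : Integrable (profileDeriv α) := by
  obtain ⟨C, _, hC⟩ := exists_profile_decay hα hα1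
  exact (integrable_inv_one_add_sq.const_mul C).mono'
    (continuous_profileDeriv hα hα1).aestronglyMeasurable
    (Filter.Eventually.of_forall fun x => (hC x).2.1)

lemma integrable_kernelK {t : ℝ} (ht : 0 < t) : Integrable (kernelK α t) := by
  have h := ((integrable_profile hα hα1).comp_mul_left' (kernelScale_pos α ht).ne').const_mul
    (kernelScale α t)
  exact h.congr (Filter.Eventually.of_forall fun x => (kernelK_scaling hα hα1 ht x).symm)

lemma integrable_kernelKx {t : ℝ} (ht : 0 < t) : Integrable (kernelKx α t) := by
  have h := (((integrable_profileDeriv hα hα1).comp_mul_left'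
    (kernelScale_pos α ht).ne').const_mul (kernelScale α t)).const_mul (kernelScale α t)
  exact h.congr (Filter.Eventually.of_forall fun x => (kernelKx_eq hα hα1 ht x).symm)

open scoped FourierTransform in
/-- The Fourier transform of `K(t,·)` is the multiplier. -/
lemma integral_kernelK_mul_exp {t : ℝ} (ht : 0 < t) (ξ : ℝ) :
    ∫ y : ℝ, (kernelK α t y : ℂ) * Complex.exp (-(Complex.I * (y : ℂ) * (ξ : ℂ))) =
      kernelSymbol α t ξ := by
  -- Rescaling by 2π matches the normalisation of `𝓕`; the claim is then Fourier inversion,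
  -- legitimate because both `f` and its transform are integrable.
  set f : ℝ → ℂ := fun v => kernelSymbol α t (2 * Real.pi * v) with hf
  have hp : (2 * Real.pi) ≠ 0 := by positivity
  have hfc : Continuous f := (continuous_kernelSymbol hα t).comp (by fun_prop)
  have hfi : Integrable f := (integrable_kernelSymbol hα hα1 ht).comp_mul_left' hp
  have hF : ∀ x : ℝ, 𝓕 f x = (kernelK α t (-x) : ℂ) := by
    intro x
    rw [Real.fourier_real_eq_integral_exp_smul, ofReal_kernelK hα hα1 ht]
    have h := Measure.integral_comp_mul_left (fun ξ : ℝ => kernelSymbol α t ξ *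
      Complex.exp (Complex.I * ((-x : ℝ) : ℂ) * (ξ : ℂ))) (2 * Real.pi)
    rw [abs_of_pos (by positivity), Complex.real_smul] at h
    push_cast at h ⊢
    rw [← h]
    refine integral_congr_ae (Filter.Eventually.of_forall fun v => ?_)
    simp only [hf, smul_eq_mul]
    rw [mul_comm]
    congr 2
    ring
  have hFi : Integrable (𝓕 f) := by
    have h : Integrable fun x : ℝ => (kernelK α t (-x) : ℂ) :=
      (integrable_kernelK hα hα1 ht).comp_neg.ofReal
    exact h.congr (Filter.Eventually.of_forall fun x => (hF x).symm)
  have key := congrFun (hfc.fourierInv_fourier_eq hfi hFi) (ξ / (2 * Real.pi))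
  rw [Real.fourierInv_eq_fourier_neg, Real.fourier_real_eq_integral_exp_smul] at key
  have e1 : f (ξ / (2 * Real.pi)) = kernelSymbol α t ξ := by
    simp only [hf]; rw [mul_div_cancel₀ _ hp]
  rw [e1] at key
  rw [← key, ← integral_neg_eq_self]
  refine integral_congr_ae (Filter.Eventually.of_forall fun v => ?_)
  simp only [hF, smul_eq_mul]
  rw [mul_comm]
  congr 2
  have : (Real.pi : ℂ) ≠ 0 := by exact_mod_cast Real.pi_ne_zero
  push_cast
  field_simp

lemma integral_kernelK {t : ℝ} (ht : 0 < t) : ∫ y : ℝ, kernelK α t y = 1 := by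
  have h := integral_kernelK_mul_exp hα hα1 ht 0
  simp only [Complex.ofReal_zero, mul_zero, neg_zero, Complex.exp_zero, mul_one] at h
  rw [kernelSymbol_zero hα, integral_complex_ofReal] at h
  exact_mod_cast h

omit hα hα1 in
lemma kernelSymbol_add (h t ξ : ℝ) :
    kernelSymbol α (h + t) ξ = kernelSymbol α h ξ * kernelSymbol α t ξ := by
  rw [kernelSymbol, kernelSymbol, kernelSymbol, ← Complex.exp_add]
  congr 1
  push_cast; ring

/-- The multipliers multiply. Writing one of them as the Fourier integral of K(h,·) and exchanging
the integrals gives the convolution without a convolution theorem. -/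
lemma kernelK_add {h t : ℝ} (hh : 0 < h) (ht : 0 < t) (x : ℝ) :
    kernelK α (h + t) x = ∫ y : ℝ, kernelK α h y * kernelK α t (x - y) := by
  have key : (kernelK α (h + t) x : ℂ) = ∫ y : ℝ, ((kernelK α h y * kernelK α t (x - y) : ℝ) : ℂ) := by
    rw [ofReal_kernelK hα hα1 (add_pos hh ht)]
    have e1 : ∀ ξ : ℝ, kernelSymbol α (h + t) ξ * Complex.exp (Complex.I * (x : ℂ) * (ξ : ℂ)) =
        ∫ y : ℝ, (kernelK α h y : ℂ) * Complex.exp (-(Complex.I * (y : ℂ) * (ξ : ℂ))) *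
          (kernelSymbol α t ξ * Complex.exp (Complex.I * (x : ℂ) * (ξ : ℂ))) := by
      intro ξ
      rw [integral_mul_const, integral_kernelK_mul_exp hα hα1 hh, kernelSymbol_add, mul_assoc]
    simp_rw [e1]
    rw [integral_integral_swap]
    · rw [← integral_const_mul]
      refine integral_congr_ae (Filter.Eventually.of_forall fun y => ?_)
      simp only
      rw [Complex.ofReal_mul, ofReal_kernelK hα hα1 ht (x - y), ← integral_const_mul,
        ← integral_const_mul, ← integral_const_mul]
      refine integral_congr_ae (Filter.Eventually.of_forall fun ξ => ?_)
      simp only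
      have : Complex.exp (Complex.I * ((x - y : ℝ) : ℂ) * (ξ : ℂ)) =
          Complex.exp (-(Complex.I * (y : ℂ) * (ξ : ℂ))) *
            Complex.exp (Complex.I * (x : ℂ) * (ξ : ℂ)) := by
        rw [← Complex.exp_add]; congr 1; push_cast; ring
      rw [this]; ring
    · have hb : Integrable (fun p : ℝ × ℝ => kernelSymbol α t p.1 * (kernelK α h p.2 : ℂ))
          (volume.prod volume) :=
        (integrable_kernelSymbol hα hα1 ht).mul_prod (integrable_kernelK hα hα1 hh).ofReal
      refine hb.mono ?_ (Filter.Eventually.of_forall fun p => ?_)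
      · have c1 := continuous_kernelSymbol hα t
        have c2 := continuous_kernelK hα hα1 hh
        apply Continuous.aestronglyMeasurable
        simp only [Function.uncurry_def]
        fun_prop
      · simp only [Function.uncurry_def]
        rw [norm_mul, norm_mul, norm_mul, norm_mul, norm_exp_I_mul, mul_one, mul_comm]
        have : ‖Complex.exp (-(Complex.I * (p.2 : ℂ) * (p.1 : ℂ)))‖ = 1 := by
          rw [Complex.norm_exp]; simp
        rw [this, mul_one]
  rw [integral_complex_ofReal] at key
  exact_mod_cast key

lemma exists_kernelKx_bound {t : ℝ} (ht : 0 < t) : ∃ C : ℝ, ∀ x, |kernelKx α t x| ≤ C := by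
  obtain ⟨C, hC0, hC⟩ := exists_profile_decay hα hα1
  refine ⟨kernelScale α t * (kernelScale α t * C), fun x => ?_⟩
  have hs := kernelScale_pos α ht
  rw [kernelKx_eq hα hα1 ht, abs_mul, abs_mul, abs_of_pos hs]
  gcongr
  refine ((hC _).2.1).trans ?_
  exact mul_le_of_le_one_right hC0.le (inv_le_one_of_one_le₀ (by nlinarith [sq_nonneg (kernelScale α t * x)]))

lemma exists_kernelK_bound {t : ℝ} (ht : 0 < t) : ∃ C : ℝ, ∀ x, |kernelK α t x| ≤ C := by
  obtain ⟨C, hC0, hC⟩ := exists_profile_decay hα hα1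
  refine ⟨kernelScale α t * C, fun x => ?_⟩
  have hs := kernelScale_pos α ht
  have e : kernelK α t x = kernelScale α t * kernelK α 1 (kernelScale α t * x) :=
    kernelK_scaling hα hα1 ht x
  rw [e, abs_mul, abs_of_pos hs]
  gcongr
  refine ((hC _).1).trans ?_
  exact mul_le_of_le_one_right hC0.le (inv_le_one_of_one_le₀ (by nlinarith [sq_nonneg (kernelScale α t * x)]))

lemma kernelKx_add {h t : ℝ} (hh : 0 < h) (ht : 0 < t) (x : ℝ) :
    kernelKx α (h + t) x = ∫ y : ℝ, kernelK α h y * kernelKx α t (x - y) := by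
  obtain ⟨C, hC⟩ := exists_kernelKx_bound hα hα1 ht
  obtain ⟨C', hC'⟩ := exists_kernelK_bound hα hα1 ht
  have c0 := continuous_kernelK hα hα1 hh
  have c1 := continuous_kernelK hα hα1 ht
  have c2 := continuous_kernelKx hα hα1 ht
  have hi := integrable_kernelK hα hα1 hh
  have := hasDerivAt_integral_of_dominated_loc_of_deriv_le (μ := volume)
    (F := fun (x y : ℝ) => kernelK α h y * kernelK α t (x - y))
    (F' := fun (x y : ℝ) => kernelK α h y * kernelKx α t (x - y))
    (x₀ := x) (s := univ) (bound := fun y => ‖kernelK α h y‖ * C)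
    Filter.univ_mem
    (Filter.Eventually.of_forall fun x => Continuous.aestronglyMeasurable (by fun_prop))
    ((hi.norm.mul_const C').mono' (Continuous.aestronglyMeasurable (by fun_prop))
      (Filter.Eventually.of_forall fun y => by
        rw [norm_mul]; exact mul_le_mul_of_nonneg_left (hC' _) (norm_nonneg _)))
    (Continuous.aestronglyMeasurable (by fun_prop))
    (Filter.Eventually.of_forall fun y x _ => by
        rw [norm_mul]; exact mul_le_mul_of_nonneg_left (hC _) (norm_nonneg _))
    (hi.norm.mul_const C)
    (Filter.Eventually.of_forall fun y x _ => by
      have h1 := (hasDerivAt_kernelK' hα hα1 ht (x - y)).comp x ((hasDerivAt_id x).sub_const y)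
      refine (h1.const_mul (kernelK α h y)).congr_deriv ?_
      ring)
  have h2 := this.2
  simp_rw [← kernelK_add hα hα1 hh ht] at h2
  exact h2.deriv

end

end

/-! ### Scaling estimates for the kernel in L¹. -/

noncomputable section

lemma inv_one_add_sq_shift_le {y k : ℝ} (hk : |k| ≤ 1) :
    (1 + (y + k) ^ 2)⁻¹ ≤ 3 * (1 + y ^ 2)⁻¹ := by
  rw [← div_eq_mul_inv, inv_eq_one_div, div_le_div_iff₀ (by positivity) (by positivity)]
  have : k ^ 2 ≤ 1 := by rw [← sq_abs]; nlinarith [abs_nonneg k]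
  nlinarith [sq_nonneg (y + 2 * k), sq_nonneg (y + k)]

/-- `L¹` modulus of continuity of a differentiable function with quadratic decay. -/
lemma exists_integral_shift_sub_le {f f' : ℝ → ℝ} (hd : ∀ x, HasDerivAt f (f' x) x) {C : ℝ}
    (hC : ∀ x, |f x| ≤ C * (1 + x ^ 2)⁻¹) (hC' : ∀ x, |f' x| ≤ C * (1 + x ^ 2)⁻¹) :
    ∃ A : ℝ, 0 < A ∧ ∀ θ : ℝ, 0 ≤ θ → θ ≤ 1 → ∀ k : ℝ,
      ∫ y : ℝ, |f (y + k) - f y| ≤ A * |k| ^ θ := by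
  have hfc : Continuous f := continuous_iff_continuousAt.2 fun x => (hd x).continuousAt
  have hC0 : 0 ≤ C := by
    have := (abs_nonneg _).trans (hC 0)
    simpa using this
  have hdi : Integrable fun x : ℝ => C * (1 + x ^ 2)⁻¹ := integrable_inv_one_add_sq.const_mul C
  have hfi : Integrable f := hdi.mono' hfc.aestronglyMeasurable (Filter.Eventually.of_forall hC)
  have hI : 0 ≤ ∫ x : ℝ, C * (1 + x ^ 2)⁻¹ := integral_nonneg fun x => by positivity
  refine ⟨3 * (∫ x : ℝ, C * (1 + x ^ 2)⁻¹) + 1, by positivity, fun θ h0 h1 k => ?_⟩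
  by_cases hk : |k| ≤ 1
  -- Small shifts: the mean value inequality, where moving the majorant of f' by at most 1 costs a
  -- factor 3.
  · have hk' : |k| ≤ |k| ^ θ := by
      rcases eq_or_lt_of_le (abs_nonneg k) with h | h
      · rw [← h]; exact Real.rpow_nonneg le_rfl _
      · calc |k| = |k| ^ (1 : ℝ) := (Real.rpow_one _).symm
          _ ≤ |k| ^ θ := Real.rpow_le_rpow_of_exponent_ge h hk h1
    have hpt : ∀ y : ℝ, |f (y + k) - f y| ≤ |k| * (3 * (C * (1 + y ^ 2)⁻¹)) := by
      intro y
      have := Convex.norm_image_sub_le_of_norm_hasDerivWithin_le (f := f) (f' := f')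
        (s := uIcc y (y + k)) (x := y) (y := y + k) (C := 3 * (C * (1 + y ^ 2)⁻¹))
        (fun z _ => (hd z).hasDerivWithinAt) (fun z hz => ?_) (convex_uIcc _ _)
        left_mem_uIcc right_mem_uIcc
      · rw [Real.norm_eq_abs, Real.norm_eq_abs, add_sub_cancel_left] at this
        linarith
      · rw [Real.norm_eq_abs]
        refine (hC' z).trans ?_
        have hz' : |z - y| ≤ 1 := by
          refine le_trans ?_ hk
          have := abs_sub_left_of_mem_uIcc hz
          simpa using this
        have := inv_one_add_sq_shift_le (y := y) hz'
        rw [add_sub_cancel] at this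
        nlinarith
    calc ∫ y : ℝ, |f (y + k) - f y| ≤ ∫ y : ℝ, |k| * (3 * (C * (1 + y ^ 2)⁻¹)) :=
          integral_mono_of_nonneg (Filter.Eventually.of_forall fun y => abs_nonneg _)
            ((hdi.const_mul 3).const_mul |k|) (Filter.Eventually.of_forall hpt)
      _ = |k| * (3 * ∫ x : ℝ, C * (1 + x ^ 2)⁻¹) := by rw [integral_const_mul, integral_const_mul]
      _ ≤ |k| ^ θ * (3 * (∫ x : ℝ, C * (1 + x ^ 2)⁻¹) + 1) :=
          mul_le_mul hk' (by linarith) (by positivity) (by positivity)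
      _ = _ := mul_comm _ _
  -- Large shifts: twice the L¹ norm is enough.
  · have hk1 : 1 ≤ |k| ^ θ := Real.one_le_rpow (le_of_lt (not_le.1 hk)) h0
    have hsh : Integrable fun y => f (y + k) := hfi.comp_add_right k
    have hle : ∫ y : ℝ, |f y| ≤ ∫ x : ℝ, C * (1 + x ^ 2)⁻¹ :=
      integral_mono_of_nonneg (Filter.Eventually.of_forall fun y => abs_nonneg _) hdi
        (Filter.Eventually.of_forall hC)
    calc ∫ y : ℝ, |f (y + k) - f y| ≤ ∫ y : ℝ, (|f (y + k)| + |f y|) :=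
          integral_mono_of_nonneg (Filter.Eventually.of_forall fun y => abs_nonneg _)
            (hsh.abs.add hfi.abs) (Filter.Eventually.of_forall fun y => abs_sub _ _)
      _ = (∫ y : ℝ, |f (y + k)|) + ∫ y : ℝ, |f y| := integral_add hsh.abs hfi.abs
      _ = (∫ y : ℝ, |f y|) + ∫ y : ℝ, |f y| := by
          rw [integral_add_right_eq_self (fun y => |f y|) k]
      _ ≤ (3 * (∫ x : ℝ, C * (1 + x ^ 2)⁻¹) + 1) * 1 := by linarith
      _ ≤ _ := mul_le_mul_of_nonneg_left hk1 (by positivity)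

lemma integral_scale (g : ℝ → ℝ) {c : ℝ} (hc : 0 < c) :
    ∫ y : ℝ, c * g (c * y) = ∫ y : ℝ, g y := by
  rw [integral_const_mul, Measure.integral_comp_mul_left, abs_of_pos (inv_pos.2 hc), smul_eq_mul,
    mul_inv_cancel_left₀ hc.ne']

lemma kernelScale_rpow (α : ℝ) {t : ℝ} (ht : 0 < t) (b : ℝ) :
    kernelScale α t ^ b = t ^ (-((1 + α)⁻¹ * b)) := by
  rw [kernelScale, ← Real.rpow_mul ht.le, neg_mul]

section
variable {α : ℝ} (hα : 0 < α) (hα1 : α < 1)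
include hα hα1

/-- Scaling estimates for the kernel in `L¹`, with exponent `a = 1/(1+α)`. -/
lemma exists_kernel_estimates {θ : ℝ} (h0 : 0 < θ) (h1 : θ < 1) : ∃ A : ℝ, 0 < A ∧ ∀ t : ℝ, 0 < t →
    (∫ y : ℝ, |kernelKx α t y| ≤ A * t ^ (-(1 + α)⁻¹)) ∧
    (∀ k : ℝ, ∫ y : ℝ, |kernelK α t (y + k) - kernelK α t y| ≤ A * (|k| * t ^ (-(1 + α)⁻¹))) ∧
    (∀ k : ℝ, ∫ y : ℝ, |kernelK α t (y + k) - kernelK α t y| ≤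
      A * (|k| ^ θ * t ^ (-((1 + α)⁻¹ * θ)))) ∧
    (∀ k : ℝ, ∫ y : ℝ, |kernelKx α t (y + k) - kernelKx α t y| ≤
      A * (|k| ^ θ * t ^ (-((1 + α)⁻¹ * (1 + θ))))) ∧
    Integrable (fun y : ℝ => kernelK α t y * |y| ^ θ) ∧
    (∫ y : ℝ, kernelK α t y * |y| ^ θ ≤ A * t ^ ((1 + α)⁻¹ * θ)) := by
  obtain ⟨C, hC0, hC⟩ := exists_profile_decay hα hα1
  obtain ⟨A0, hA0, h_0⟩ := exists_integral_shift_sub_le (hasDerivAt_profile hα hα1)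
    (fun x => (hC x).1) (fun x => (hC x).2.1)
  obtain ⟨A1, hA1, h_1⟩ := exists_integral_shift_sub_le (hasDerivAt_profileDeriv hα hα1)
    (fun x => (hC x).2.1) (fun x => (hC x).2.2)
  set B1 := ∫ y : ℝ, |profileDeriv α y| with hB1
  set B2 := ∫ y : ℝ, kernelK α 1 y * |y| ^ θ with hB2
  have hB1n : 0 ≤ B1 := integral_nonneg fun y => abs_nonneg _
  have hB2n : 0 ≤ B2 := integral_nonneg fun y =>
    mul_nonneg (kernelK_nonneg hα hα1 one_pos y) (Real.rpow_nonneg (abs_nonneg _) _)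
  have hmom : Integrable fun y : ℝ => kernelK α 1 y * |y| ^ θ := by
    -- The product of |y|^θ and the quadratic decay behaves like |y|^(θ-2), integrable on the line
    -- because θ < 1.
    have hbd : Integrable fun y : ℝ => C * (1 + ‖y‖ ^ 2) ^ (-(2 - θ) / 2) := by
      refine (integrable_rpow_neg_one_add_norm_sq (μ := (volume : Measure ℝ)) ?_).const_mul C
      rw [Module.finrank_self]; push_cast; linarith
    have hc := continuous_profile hα hα1
    have hr : Continuous fun y : ℝ => |y| ^ θ := continuous_abs.rpow_const fun _ => Or.inr h0.le
    refine hbd.mono' (hc.mul hr).aestronglyMeasurable (Filter.Eventually.of_forall fun y => ?_)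
    rw [norm_mul, Real.norm_eq_abs, Real.norm_of_nonneg (Real.rpow_nonneg (abs_nonneg _) _)]
    have e1 : |y| ^ θ ≤ (1 + ‖y‖ ^ 2) ^ (θ / 2) := by
      calc |y| ^ θ = (|y| ^ (2 : ℝ)) ^ (θ / 2) := by
            rw [← Real.rpow_mul (abs_nonneg _)]; congr 1; ring
        _ ≤ _ := by
            refine Real.rpow_le_rpow (by positivity) ?_ (by positivity)
            rw [Real.rpow_two, Real.norm_eq_abs]; linarith
    have e2 : (1 + ‖y‖ ^ 2) ^ (-(2 - θ) / 2) = (1 + y ^ 2)⁻¹ * (1 + ‖y‖ ^ 2) ^ (θ / 2) := by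
      rw [Real.norm_eq_abs, sq_abs, ← Real.rpow_neg_one, ← Real.rpow_add (by positivity)]
      congr 1; ring
    rw [e2, ← mul_assoc]
    exact mul_le_mul (hC y).1 e1 (by positivity) (by positivity)
  refine ⟨A0 + A1 + B1 + B2, by positivity, fun t ht => ?_⟩
  have hc := kernelScale_pos α ht
  set c := kernelScale α t with hcdef
  have hK : ∀ y, kernelK α t y = c * kernelK α 1 (c * y) := kernelK_scaling hα hα1 ht
  have hKx : ∀ y, kernelKx α t y = c * (c * profileDeriv α (c * y)) := kernelKx_eq hα hα1 ht
  have ec : t ^ (-(1 + α)⁻¹) = c := rfl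
  have shiftK : ∀ k, ∫ y : ℝ, |kernelK α t (y + k) - kernelK α t y| =
      ∫ y : ℝ, |kernelK α 1 (y + c * k) - kernelK α 1 y| := by
    intro k
    rw [← integral_scale (fun y => |kernelK α 1 (y + c * k) - kernelK α 1 y|) hc]
    refine integral_congr_ae (Filter.Eventually.of_forall fun y => ?_)
    simp only
    rw [hK, hK, ← mul_sub, abs_mul, abs_of_pos hc, mul_add]
  refine ⟨?_, fun k => ?_, fun k => ?_, fun k => ?_, ?_, ?_⟩
  · rw [ec]
    have : ∫ y : ℝ, |kernelKx α t y| = c * B1 := by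
      rw [hB1, ← integral_scale (fun y => |profileDeriv α y|) hc, ← integral_const_mul]
      refine integral_congr_ae (Filter.Eventually.of_forall fun y => ?_)
      simp only
      rw [hKx, abs_mul, abs_mul, abs_of_pos hc]
    rw [this, mul_comm]
    gcongr
    linarith
  · rw [shiftK, ec]
    have := h_0 1 zero_le_one le_rfl (c * k)
    rw [Real.rpow_one, abs_mul, abs_of_pos hc, mul_comm c |k|] at this
    refine this.trans ?_
    gcongr
    linarith
  · rw [shiftK, ← kernelScale_rpow α ht, ← hcdef]
    have := h_0 θ h0.le h1.le (c * k)
    rw [abs_mul, abs_of_pos hc, Real.mul_rpow hc.le (abs_nonneg _), mul_comm (c ^ θ)] at this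
    refine this.trans ?_
    gcongr
    linarith
  · have e : ∫ y : ℝ, |kernelKx α t (y + k) - kernelKx α t y| =
        c * ∫ y : ℝ, |profileDeriv α (y + c * k) - profileDeriv α y| := by
      rw [← integral_scale (fun y => |profileDeriv α (y + c * k) - profileDeriv α y|) hc,
        ← integral_const_mul]
      refine integral_congr_ae (Filter.Eventually.of_forall fun y => ?_)
      simp only
      rw [hKx, hKx, ← mul_sub, ← mul_sub, abs_mul, abs_mul, abs_of_pos hc, mul_add]
    rw [e, ← kernelScale_rpow α ht, ← hcdef, Real.rpow_add hc, Real.rpow_one]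
    have := h_1 θ h0.le h1.le (c * k)
    rw [abs_mul, abs_of_pos hc, Real.mul_rpow hc.le (abs_nonneg _)] at this
    calc _ ≤ c * (A1 * (c ^ θ * |k| ^ θ)) := mul_le_mul_of_nonneg_left this hc.le
      _ = A1 * (|k| ^ θ * (c * c ^ θ)) := by ring
      _ ≤ _ := by gcongr; linarith
  · have h := ((hmom.comp_mul_left' hc.ne').const_mul c).const_mul (c ^ θ)⁻¹
    refine h.congr (Filter.Eventually.of_forall fun y => ?_)
    simp only
    rw [hK, abs_mul, abs_of_pos hc, Real.mul_rpow hc.le (abs_nonneg _)]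
    have : c ^ θ ≠ 0 := (Real.rpow_pos_of_pos hc θ).ne'
    field_simp
  · have e : ∫ y : ℝ, kernelK α t y * |y| ^ θ = (c ^ θ)⁻¹ * B2 := by
      rw [hB2, ← integral_scale (fun y => kernelK α 1 y * |y| ^ θ) hc, ← integral_const_mul]
      refine integral_congr_ae (Filter.Eventually.of_forall fun y => ?_)
      simp only
      rw [hK, abs_mul, abs_of_pos hc, Real.mul_rpow hc.le (abs_nonneg _)]
      have : c ^ θ ≠ 0 := (Real.rpow_pos_of_pos hc θ).ne'
      field_simp
    rw [e, hcdef, kernelScale_rpow α ht, ← Real.rpow_neg ht.le, neg_neg, mul_comm]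
    gcongr
    linarith

end

end

/-! ### Convolutions and the Duhamel term. -/

noncomputable section

section Convolution

lemma integrable_mul_shift {k g : ℝ → ℝ} (hk : Integrable k) (hg : Measurable g) {m : ℝ}
    (hm : ∀ x, |g x| ≤ m) (x : ℝ) : Integrable fun y => k y * g (x - y) :=
  hk.mul_bdd (c := m) (hg.comp (measurable_const.sub measurable_id)).aestronglyMeasurable
    (Filter.Eventually.of_forall fun y => hm (x - y))

lemma conv_comm (k g : ℝ → ℝ) (x : ℝ) : ∫ y, k (x - y) * g y = ∫ y, k y * g (x - y) := by
  rw [← integral_sub_left_eq_self (fun y => k y * g (x - y)) volume x]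
  simp

lemma abs_conv_le {k g : ℝ → ℝ} (hk : Integrable k) {m : ℝ}
    (hm : ∀ x, |g x| ≤ m) (x : ℝ) : |∫ y, k y * g (x - y)| ≤ (∫ y, |k y|) * m := by
  rw [← integral_mul_const]
  refine norm_integral_le_of_norm_le (f := fun y => k y * g (x - y)) (hk.abs.mul_const m) (Filter.Eventually.of_forall fun y => ?_)
  rw [norm_mul, Real.norm_eq_abs, Real.norm_eq_abs]
  exact mul_le_mul_of_nonneg_left (hm _) (abs_nonneg _)

/-- The translation is moved onto the kernel, so `g` only has to be bounded and measurable. -/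
lemma abs_conv_sub_le {k g : ℝ → ℝ} (hk : Integrable k) (hg : Measurable g) {m : ℝ}
    (hm : ∀ x, |g x| ≤ m) (x x' : ℝ) :
    |(∫ y, k y * g (x - y)) - ∫ y, k y * g (x' - y)| ≤ (∫ y, |k (y + (x - x')) - k y|) * m := by
  have i1 : Integrable fun y => k (x - y) * g y :=
    (hk.comp_sub_left x).mul_bdd (c := m) hg.aestronglyMeasurable (Filter.Eventually.of_forall hm)
  have i2 : Integrable fun y => k (x' - y) * g y :=
    (hk.comp_sub_left x').mul_bdd (c := m) hg.aestronglyMeasurable (Filter.Eventually.of_forall hm)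
  rw [← conv_comm, ← conv_comm, ← integral_sub i1 i2]
  have e : ∫ y, |k (y + (x - x')) - k y| = ∫ y, |k (x - y) - k (x' - y)| := by
    rw [← integral_sub_left_eq_self (fun y => |k (y + (x - x')) - k y|) volume x']
    congr 1
    ext y
    congr 3
    ring
  rw [e, ← integral_mul_const]
  refine norm_integral_le_of_norm_le (f := fun y => k (x - y) * g y - k (x' - y) * g y)
    (((hk.comp_sub_left x).sub (hk.comp_sub_left x')).abs.mul_const m)
    (Filter.Eventually.of_forall fun y => ?_)
  rw [← sub_mul, norm_mul, Real.norm_eq_abs, Real.norm_eq_abs]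
  exact mul_le_mul_of_nonneg_left (hm _) (abs_nonneg _)

lemma conv_assoc {k₁ k₂ g : ℝ → ℝ} (h1 : Integrable k₁) (h2 : Integrable k₂) (hg : Measurable g)
    {m : ℝ} (hm : ∀ x, |g x| ≤ m) (x : ℝ) :
    ∫ y, (∫ z, k₁ z * k₂ (y - z)) * g (x - y) =
      ∫ z, k₁ z * ∫ y, k₂ y * g (x - z - y) := by
  have hi : Integrable (fun p : ℝ × ℝ => k₁ p.2 * k₂ (p.1 - p.2) * g (x - p.1))
      (volume.prod volume) := by
    have h := h1.convolution_integrand (ContinuousLinearMap.mul ℝ ℝ) h2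
    refine Integrable.mul_bdd (c := m) h ?_ (Filter.Eventually.of_forall fun p => hm _)
    exact (hg.comp (measurable_const.sub measurable_fst)).aestronglyMeasurable
  calc ∫ y, (∫ z, k₁ z * k₂ (y - z)) * g (x - y)
      = ∫ y, ∫ z, k₁ z * k₂ (y - z) * g (x - y) := by simp_rw [integral_mul_const]
    _ = ∫ z, ∫ y, k₁ z * k₂ (y - z) * g (x - y) := integral_integral_swap hi
    _ = ∫ z, k₁ z * ∫ y, k₂ y * g (x - z - y) := by
      congr 1
      ext z
      rw [← integral_const_mul,
        ← integral_sub_right_eq_self (fun y => k₁ z * (k₂ y * g (x - z - y))) z]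
      congr 1
      ext y
      rw [mul_assoc]
      congr 3
      ring

end Convolution

/-- The `L¹` estimates for the kernel, with a common constant. -/
structure KernelEst (α θ A : ℝ) : Prop where
  hα : 0 < α
  hα1 : α < 1
  hθ : 0 < θ
  hθα : θ < α
  hA : 0 < A
  norm_kx : ∀ t, 0 < t → ∫ y : ℝ, |kernelKx α t y| ≤ A * t ^ (-(1 + α)⁻¹)
  shift_k : ∀ t, 0 < t → ∀ k : ℝ,
    ∫ y : ℝ, |kernelK α t (y + k) - kernelK α t y| ≤ A * (|k| * t ^ (-(1 + α)⁻¹))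
  shift_k_rpow : ∀ t, 0 < t → ∀ k : ℝ, ∫ y : ℝ, |kernelK α t (y + k) - kernelK α t y| ≤
      A * (|k| ^ θ * t ^ (-((1 + α)⁻¹ * θ)))
  shift_kx : ∀ t, 0 < t → ∀ k : ℝ, ∫ y : ℝ, |kernelKx α t (y + k) - kernelKx α t y| ≤
      A * (|k| ^ θ * t ^ (-((1 + α)⁻¹ * (1 + θ))))
  integrable_moment : ∀ t, 0 < t → Integrable (fun y : ℝ => kernelK α t y * |y| ^ θ)
  moment : ∀ t, 0 < t → ∫ y : ℝ, kernelK α t y * |y| ^ θ ≤ A * t ^ ((1 + α)⁻¹ * θ)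

lemma exists_kernelEst {α θ : ℝ} (hα : 0 < α) (hα1 : α < 1) (hθ : 0 < θ) (hθα : θ < α) :
    ∃ A, KernelEst α θ A := by
  obtain ⟨A, hA, h⟩ := exists_kernel_estimates hα hα1 hθ (hθα.trans hα1)
  exact ⟨A, hα, hα1, hθ, hθα, hA, fun t ht => (h t ht).1, fun t ht => (h t ht).2.1,
    fun t ht => (h t ht).2.2.1, fun t ht => (h t ht).2.2.2.1, fun t ht => (h t ht).2.2.2.2.1,
    fun t ht => (h t ht).2.2.2.2.2⟩

/-- The Duhamel term `∫₀ᵗ ∂ₓK(σ) * φ(t-σ) dσ`. -/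
def duhamel (α : ℝ) (φ : ℝ → ℝ → ℝ) (t x : ℝ) : ℝ :=
  ∫ σ in (0 : ℝ)..t, ∫ y : ℝ, kernelKx α σ y * φ (t - σ) (x - y)

/-- Sources that are continuous and bounded for positive times. -/
structure Source (m : ℝ) (φ : ℝ → ℝ → ℝ) : Prop where
  continuousOn : ContinuousOn (fun p : ℝ × ℝ => φ p.1 p.2) (Ioi (0 : ℝ) ×ˢ (univ : Set ℝ))
  bound : ∀ t, 0 < t → ∀ x, |φ t x| ≤ m

namespace Source
variable {m : ℝ} {φ : ℝ → ℝ → ℝ}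

lemma continuousAt (hφ : Source m φ) {t : ℝ} (ht : 0 < t) (x : ℝ) :
    ContinuousAt (fun p : ℝ × ℝ => φ p.1 p.2) (t, x) :=
  hφ.continuousOn.continuousAt ((isOpen_Ioi.prod isOpen_univ).mem_nhds ⟨ht, mem_univ _⟩)

lemma continuous (hφ : Source m φ) {t : ℝ} (ht : 0 < t) : Continuous (φ t) :=
  continuous_iff_continuousAt.2 fun x =>
    (hφ.continuousAt ht x).comp (f := fun x : ℝ => (t, x)) (by fun_prop)

lemma nonneg (hφ : Source m φ) : 0 ≤ m := (abs_nonneg _).trans (hφ.bound 1 one_pos 0)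

lemma shift_time (hφ : Source m φ) {t₀ : ℝ} (ht : 0 ≤ t₀) : Source m (fun t => φ (t₀ + t)) := by
  refine ⟨?_, fun t h x => hφ.bound _ (by linarith) x⟩
  refine hφ.continuousOn.comp (f := fun p : ℝ × ℝ => (t₀ + p.1, p.2)) (by fun_prop) ?_
  intro p hp
  exact ⟨by have := hp.1; simp only [mem_Ioi] at this ⊢; linarith, mem_univ _⟩

end Source

namespace KernelEst
variable {α θ A : ℝ}

lemma exp_pos (h : KernelEst α θ A) : 0 < (1 + α)⁻¹ := inv_pos.2 (by linarith [h.hα])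

lemma exp_lt_one (h : KernelEst α θ A) : (1 + α)⁻¹ < 1 := inv_lt_one_of_one_lt₀ (by linarith [h.hα])

/-- This makes the Hölder seminorm of ∂ₓK(σ) integrable at σ = 0. For θ = q - 1 it is the condition
q < 1 + α. -/
lemma exp_mul_lt_one (h : KernelEst α θ A) : (1 + α)⁻¹ * (1 + θ) < 1 := by
  have : 0 < 1 + α := by linarith [h.hα]
  rw [inv_mul_lt_iff₀ this]; linarith [h.hθα]

variable {m : ℝ} {φ : ℝ → ℝ → ℝ}

/-- Joint continuity of the integrand of the Duhamel term. -/
lemma continuousAt_inner (h : KernelEst α θ A) (hφ : Source m φ) {σ t : ℝ} (hσ : 0 < σ)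
    (hσt : σ < t) (x : ℝ) :
    ContinuousAt (fun p : ℝ × ℝ × ℝ => ∫ y : ℝ, kernelKx α p.1 y * φ (p.2.1 - p.1) (p.2.2 - y))
      (σ, t, x) := by
  set c : ℝ → ℝ := kernelScale α with hc
  have hopen : ∀ᶠ p : ℝ × ℝ × ℝ in nhds (σ, t, x), 0 < p.1 ∧ p.1 < p.2.1 := by
    have h1 : IsOpen {p : ℝ × ℝ × ℝ | 0 < p.1 ∧ p.1 < p.2.1} :=
      (isOpen_lt continuous_const continuous_fst).inter
        (isOpen_lt continuous_fst (continuous_fst.comp continuous_snd))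
    exact h1.mem_nhds ⟨hσ, hσt⟩
  have hcc : ContinuousAt (fun p : ℝ × ℝ × ℝ => c p.1) (σ, t, x) :=
    ContinuousAt.comp (g := c) (f := fun p : ℝ × ℝ × ℝ => p.1) (x := (σ, t, x))
      (Real.continuousAt_rpow_const _ _ (Or.inl hσ.ne')) continuousAt_fst
  -- Rescaling y moves the time dependence from the kernel into the argument of φ, so the fixed
  -- profile dominates.
  have key : ContinuousAt (fun p : ℝ × ℝ × ℝ => c p.1 *
      ∫ y : ℝ, profileDeriv α y * φ (p.2.1 - p.1) (p.2.2 - (c p.1)⁻¹ * y)) (σ, t, x) := by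
    refine hcc.mul ?_
    have hPc := continuous_profileDeriv h.hα h.hα1
    refine continuousAt_of_dominated (bound := fun y => ‖profileDeriv α y‖ * m) ?_ ?_
      ((integrable_profileDeriv h.hα h.hα1).norm.mul_const m) ?_
    · filter_upwards [hopen] with p hp
      have := hφ.continuous (sub_pos.2 hp.2)
      exact Continuous.aestronglyMeasurable (by fun_prop)
    · filter_upwards [hopen] with p hp
      refine Filter.Eventually.of_forall fun y => ?_
      rw [norm_mul]
      exact mul_le_mul_of_nonneg_left (hφ.bound _ (sub_pos.2 hp.2) _) (norm_nonneg _)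
    · refine Filter.Eventually.of_forall fun y => continuousAt_const.mul ?_
      refine ContinuousAt.comp (x := (σ, t, x))
        (f := fun p : ℝ × ℝ × ℝ => (p.2.1 - p.1, p.2.2 - (c p.1)⁻¹ * y))
        (hφ.continuousAt (sub_pos.2 hσt) (x - (c σ)⁻¹ * y)) ?_
      have hne : c σ ≠ 0 := (kernelScale_pos α hσ).ne'
      have h1 : ContinuousAt (fun p : ℝ × ℝ × ℝ => p.2.1 - p.1) (σ, t, x) := by fun_prop
      have h2 : ContinuousAt (fun p : ℝ × ℝ × ℝ => p.2.2 - (c p.1)⁻¹ * y) (σ, t, x) :=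
        (by fun_prop : ContinuousAt (fun p : ℝ × ℝ × ℝ => p.2.2) (σ, t, x)).sub
          ((hcc.inv₀ hne).mul continuousAt_const)
      exact h1.prodMk h2
  refine key.congr ?_
  filter_upwards [hopen] with p hp
  have hcp := kernelScale_pos α hp.1
  rw [← integral_const_mul, ← integral_scale (fun y => c p.1 *
    (profileDeriv α y * φ (p.2.1 - p.1) (p.2.2 - (c p.1)⁻¹ * y))) hcp]
  refine integral_congr_ae (Filter.Eventually.of_forall fun y => ?_)
  simp only
  rw [kernelKx_eq h.hα h.hα1 hp.1, inv_mul_cancel_left₀ hcp.ne']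
  ring

lemma abs_inner_le (h : KernelEst α θ A) {σ m : ℝ} (hσ : 0 < σ) {g : ℝ → ℝ} (hm : ∀ x, |g x| ≤ m)
    (x : ℝ) : |∫ y : ℝ, kernelKx α σ y * g (x - y)| ≤ A * σ ^ (-(1 + α)⁻¹) * m :=
  (abs_conv_le (integrable_kernelKx h.hα h.hα1 hσ) hm x).trans
    (mul_le_mul_of_nonneg_right (h.norm_kx σ hσ) ((abs_nonneg _).trans (hm 0)))

lemma abs_inner_sub_le (h : KernelEst α θ A) {σ m : ℝ} (hσ : 0 < σ) {g : ℝ → ℝ} (hg : Measurable g)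
    (hm : ∀ x, |g x| ≤ m) (x x' : ℝ) :
    |(∫ y : ℝ, kernelKx α σ y * g (x - y)) - ∫ y : ℝ, kernelKx α σ y * g (x' - y)| ≤
      A * (|x - x'| ^ θ * σ ^ (-((1 + α)⁻¹ * (1 + θ)))) * m :=
  (abs_conv_sub_le (integrable_kernelKx h.hα h.hα1 hσ) hg hm x x').trans
    (mul_le_mul_of_nonneg_right (h.shift_kx σ hσ _) ((abs_nonneg _).trans (hm 0)))

lemma intervalIntegrable_rpow_neg {b : ℝ} (hb : b < 1) (t : ℝ) :
    IntervalIntegrable (fun σ : ℝ => σ ^ (-b)) volume 0 t :=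
  intervalIntegral.intervalIntegrable_rpow' (by linarith)

lemma continuousOn_inner (h : KernelEst α θ A) (hφ : Source m φ) (t x : ℝ) :
    ContinuousOn (fun σ => ∫ y : ℝ, kernelKx α σ y * φ (t - σ) (x - y)) (Ioo 0 t) := fun σ hσ =>
  ((h.continuousAt_inner hφ hσ.1 hσ.2 x).comp (f := fun σ : ℝ => (σ, t, x))
    (by fun_prop)).continuousWithinAt

lemma intervalIntegrable_inner (h : KernelEst α θ A) (hφ : Source m φ) {t : ℝ} (ht : 0 ≤ t)
    (x : ℝ) :
    IntervalIntegrable (fun σ => ∫ y : ℝ, kernelKx α σ y * φ (t - σ) (x - y)) volume 0 t := by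
  have hi : IntervalIntegrable (fun σ : ℝ => A * σ ^ (-(1 + α)⁻¹) * m) volume 0 t :=
    ((intervalIntegrable_rpow_neg h.exp_lt_one t).const_mul A).mul_const m
  rw [intervalIntegrable_iff_integrableOn_Ioo_of_le ht] at hi ⊢
  refine hi.mono' ((h.continuousOn_inner hφ t x).aestronglyMeasurable measurableSet_Ioo) ?_
  filter_upwards [ae_restrict_mem measurableSet_Ioo] with σ hσ
  exact h.abs_inner_le hσ.1 (hφ.bound _ (sub_pos.2 hσ.2)) x

lemma abs_duhamel_le_integral (_h : KernelEst α θ A) {t : ℝ} (ht : 0 ≤ t) {B : ℝ → ℝ}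
    (hB : IntervalIntegrable B volume 0 t) {x : ℝ}
    (hle : ∀ σ ∈ Ioo 0 t, |∫ y : ℝ, kernelKx α σ y * φ (t - σ) (x - y)| ≤ B σ) :
    |duhamel α φ t x| ≤ ∫ σ in (0 : ℝ)..t, B σ := by
  refine intervalIntegral.norm_integral_le_of_norm_le
    (f := fun σ => ∫ y : ℝ, kernelKx α σ y * φ (t - σ) (x - y)) ht ?_ hB
  filter_upwards [compl_mem_ae_iff.2 (measure_singleton t)] with σ hσ hσ'
  exact hle σ ⟨hσ'.1, lt_of_le_of_ne hσ'.2 hσ⟩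

lemma integral_rpow_neg {b : ℝ} (hb : b < 1) (t : ℝ) :
    ∫ σ in (0 : ℝ)..t, σ ^ (-b) = t ^ (1 - b) / (1 - b) := by
  rw [integral_rpow (Or.inl (by linarith)), Real.zero_rpow (by linarith), sub_zero]
  ring_nf

lemma abs_duhamel_le (h : KernelEst α θ A) (hφ : Source m φ) {t : ℝ} (ht : 0 ≤ t) (x : ℝ) :
    |duhamel α φ t x| ≤ A * m * (t ^ (1 - (1 + α)⁻¹) / (1 - (1 + α)⁻¹)) := by
  refine (h.abs_duhamel_le_integral ht
    (((intervalIntegrable_rpow_neg h.exp_lt_one t).const_mul A).mul_const m)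
    (fun σ hσ => h.abs_inner_le hσ.1 (hφ.bound _ (sub_pos.2 hσ.2)) x)).trans_eq ?_
  rw [intervalIntegral.integral_mul_const, intervalIntegral.integral_const_mul,
    integral_rpow_neg h.exp_lt_one]
  ring

lemma abs_duhamel_sub_le (h : KernelEst α θ A) (hφ : Source m φ) {t : ℝ} (ht : 0 ≤ t) (x x' : ℝ) :
    |duhamel α φ t x - duhamel α φ t x'| ≤ A * m * |x - x'| ^ θ *
      (t ^ (1 - (1 + α)⁻¹ * (1 + θ)) / (1 - (1 + α)⁻¹ * (1 + θ))) := by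
  rw [duhamel, duhamel, ← intervalIntegral.integral_sub (h.intervalIntegrable_inner hφ ht x)
    (h.intervalIntegrable_inner hφ ht x')]
  have hi := ((intervalIntegrable_rpow_neg h.exp_mul_lt_one t).const_mul (A * m * |x - x'| ^ θ))
  refine (intervalIntegral.norm_integral_le_of_norm_le
    (f := fun σ => (∫ y : ℝ, kernelKx α σ y * φ (t - σ) (x - y)) -
      ∫ y : ℝ, kernelKx α σ y * φ (t - σ) (x' - y)) ht ?_ hi).trans_eq ?_
  · filter_upwards [compl_mem_ae_iff.2 (measure_singleton t)] with σ hσ hσ'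
    have hσt : σ < t := lt_of_le_of_ne hσ'.2 hσ
    refine (h.abs_inner_sub_le hσ'.1 (hφ.continuous (sub_pos.2 hσt)).measurable
      (hφ.bound _ (sub_pos.2 hσt)) x x').trans_eq ?_
    ring
  · rw [intervalIntegral.integral_const_mul, integral_rpow_neg h.exp_mul_lt_one]

lemma duhamel_sub (h : KernelEst α θ A) {m₁ m₂ : ℝ} {φ ψ : ℝ → ℝ → ℝ} (hφ : Source m₁ φ)
    (hψ : Source m₂ ψ) {t : ℝ} (ht : 0 ≤ t) (x : ℝ) :
    duhamel α (fun s y => φ s y - ψ s y) t x = duhamel α φ t x - duhamel α ψ t x := by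
  rw [duhamel, duhamel, duhamel, ← intervalIntegral.integral_sub (h.intervalIntegrable_inner hφ ht x)
    (h.intervalIntegrable_inner hψ ht x)]
  refine intervalIntegral.integral_congr_ae ?_
  filter_upwards [compl_mem_ae_iff.2 (measure_singleton t)] with σ hσ hσ'
  rw [uIoc_of_le ht] at hσ'
  have hs : 0 < t - σ := sub_pos.2 (lt_of_le_of_ne hσ'.2 hσ)
  rw [← integral_sub (integrable_mul_shift (integrable_kernelKx h.hα h.hα1 hσ'.1)
    (hφ.continuous hs).measurable (hφ.bound _ hs) x)
    (integrable_mul_shift (integrable_kernelKx h.hα h.hα1 hσ'.1)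
    (hψ.continuous hs).measurable (hψ.bound _ hs) x)]
  simp only [mul_sub]

lemma duhamel_shift_space (φ : ℝ → ℝ → ℝ) (k t x : ℝ) :
    duhamel α (fun s y => φ s (y + k)) t x = duhamel α φ t (x + k) := by
  rw [duhamel, duhamel]
  congr 1; ext σ; congr 1; ext y; congr 2; ring

lemma duhamel_const_mul (c : ℝ) (φ : ℝ → ℝ → ℝ) (t x : ℝ) :
    duhamel α (fun s y => c * φ s y) t x = c * duhamel α φ t x := by
  rw [duhamel, duhamel, ← intervalIntegral.integral_const_mul]
  congr 1; ext σ
  rw [← integral_const_mul]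
  congr 1; ext y; ring

/-- Joint continuity of the Duhamel term for positive times. -/
lemma continuousAt_duhamel (h : KernelEst α θ A) (hφ : Source m φ) {t : ℝ} (ht : 0 < t) (x : ℝ) :
    ContinuousAt (fun p : ℝ × ℝ => duhamel α φ p.1 p.2) (t, x) := by
  set G : ℝ × ℝ → ℝ → ℝ := fun p σ => ∫ y : ℝ, kernelKx α σ y * φ (p.1 - σ) (p.2 - y) with hG
  -- An indicator replaces the variable endpoint, so dominated convergence applies on a fixed
  -- interval; continuity in p fails at most at σ = t.
  have e : ∀ p : ℝ × ℝ, 0 < p.1 → p.1 < t + 1 →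
      duhamel α φ p.1 p.2 = ∫ σ in Ioo 0 (t + 1), (Ioo 0 p.1).indicator (G p) σ := by
    intro p hp hp'
    rw [duhamel, intervalIntegral.integral_of_le hp.le, integral_Ioc_eq_integral_Ioo,
      setIntegral_indicator measurableSet_Ioo]
    congr 2
    ext σ
    simp only [mem_inter_iff, mem_Ioo]
    constructor
    · intro hs; exact ⟨⟨hs.1, hs.2.trans hp'⟩, hs⟩
    · intro hs; exact hs.2
  have hev : ∀ᶠ p : ℝ × ℝ in nhds (t, x), 0 < p.1 ∧ p.1 < t + 1 := by
    have h1 : IsOpen {p : ℝ × ℝ | 0 < p.1 ∧ p.1 < t + 1} :=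
      (isOpen_lt continuous_const continuous_fst).inter (isOpen_lt continuous_fst continuous_const)
    exact h1.mem_nhds ⟨ht, by simp⟩
  have hI : IntegrableOn (fun σ : ℝ => A * σ ^ (-(1 + α)⁻¹) * m) (Ioo 0 (t + 1)) := by
    rw [← intervalIntegrable_iff_integrableOn_Ioo_of_le (by linarith)]
    exact ((intervalIntegrable_rpow_neg h.exp_lt_one _).const_mul A).mul_const m
  have key : ContinuousAt (fun p : ℝ × ℝ => ∫ σ in Ioo 0 (t + 1), (Ioo 0 p.1).indicator (G p) σ)
      (t, x) := by
    refine continuousAt_of_dominated (bound := fun σ : ℝ => A * σ ^ (-(1 + α)⁻¹) * m) ?_ ?_ hI ?_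
    · filter_upwards [hev] with p hp
      refine AEStronglyMeasurable.restrict ?_
      rw [aestronglyMeasurable_indicator_iff measurableSet_Ioo]
      exact (h.continuousOn_inner hφ p.1 p.2).aestronglyMeasurable measurableSet_Ioo
    · filter_upwards [hev] with p hp
      filter_upwards [ae_restrict_mem measurableSet_Ioo] with σ hσ
      have hnn : 0 ≤ A * σ ^ (-(1 + α)⁻¹) * m :=
        mul_nonneg (mul_nonneg h.hA.le (Real.rpow_nonneg hσ.1.le _)) hφ.nonneg
      by_cases hs : σ ∈ Ioo 0 p.1
      · rw [indicator_of_mem hs]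
        exact h.abs_inner_le hσ.1 (hφ.bound _ (sub_pos.2 hs.2)) p.2
      · rw [indicator_of_notMem hs, norm_zero]; exact hnn
    · filter_upwards [ae_restrict_mem measurableSet_Ioo,
        ae_restrict_of_ae (compl_mem_ae_iff.2 (measure_singleton t))] with σ hσ hσt
      rcases lt_or_gt_of_ne (show σ ≠ t from hσt) with hlt | hgt
      · have hc : ContinuousAt (fun p : ℝ × ℝ => G p σ) (t, x) :=
          ContinuousAt.comp (x := (t, x)) (f := fun p : ℝ × ℝ => (σ, p.1, p.2))
            (h.continuousAt_inner hφ hσ.1 hlt x) (by fun_prop)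
        refine hc.congr ?_
        filter_upwards [(isOpen_lt continuous_const continuous_fst).mem_nhds
          (show (t, x) ∈ {p : ℝ × ℝ | σ < p.1} from hlt)] with p hp
        rw [indicator_of_mem (show σ ∈ Ioo 0 p.1 from ⟨hσ.1, hp⟩)]
      · refine continuousAt_const.congr (f := fun _ => (0 : ℝ)) ?_
        filter_upwards [(isOpen_lt continuous_fst continuous_const).mem_nhds
          (show (t, x) ∈ {p : ℝ × ℝ | p.1 < σ} from hgt)] with p hp
        rw [indicator_of_notMem (fun hs => lt_asymm hs.2 hp)]
  refine key.congr ?_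
  filter_upwards [hev] with p hp
  exact (e p hp.1 hp.2).symm

/-- Splitting of the Duhamel term at an intermediate time. -/
lemma duhamel_add (h : KernelEst α θ A) (hφ : Source m φ) {t₀ τ : ℝ} (ht : 0 < t₀) (hτ : 0 < τ)
    (x : ℝ) :
    duhamel α φ (t₀ + τ) x = (∫ z, kernelK α τ z * duhamel α φ t₀ (x - z)) +
      duhamel α (fun t => φ (t₀ + t)) τ x := by
  have hi := h.intervalIntegrable_inner hφ (add_pos ht hτ).le x
  have hi1 := hi.mono_set (c := 0) (d := τ) (by
    rw [uIcc_of_le hτ.le, uIcc_of_le (add_pos ht hτ).le]; exact Icc_subset_Icc le_rfl (by linarith))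
  have hi2 := hi.mono_set (c := τ) (d := t₀ + τ) (by
    rw [uIcc_of_le (by linarith), uIcc_of_le (add_pos ht hτ).le]
    exact Icc_subset_Icc hτ.le le_rfl)
  rw [duhamel, ← intervalIntegral.integral_add_adjacent_intervals hi1 hi2, add_comm]
  congr 1
  · have e1 := intervalIntegral.integral_comp_add_right (a := 0) (b := t₀)
      (fun σ => ∫ y : ℝ, kernelKx α σ y * φ (t₀ + τ - σ) (x - y)) τ
    rw [zero_add] at e1
    rw [← e1]
    have hKi := integrable_kernelK h.hα h.hα1 hτ
    -- For kernel times beyond τ, the identity ∂ₓK(τ+r) = K(τ) * ∂ₓK(r) factors out diffusion over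
    -- the last interval of length τ.
    have e2 : ∫ r in (0 : ℝ)..t₀, ∫ y : ℝ, kernelKx α (r + τ) y * φ (t₀ + τ - (r + τ)) (x - y) =
        ∫ r in (0 : ℝ)..t₀, ∫ z, kernelK α τ z * ∫ y, kernelKx α r y * φ (t₀ - r) (x - z - y) := by
      refine intervalIntegral.integral_congr_ae ?_
      filter_upwards [compl_mem_ae_iff.2 (measure_singleton t₀)] with r hr hr'
      rw [uIoc_of_le ht.le] at hr'
      have hs : 0 < t₀ - r := sub_pos.2 (lt_of_le_of_ne hr'.2 hr)
      rw [← conv_assoc hKi (integrable_kernelKx h.hα h.hα1 hr'.1) (hφ.continuous hs).measurable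
        (hφ.bound _ hs) x, add_comm r τ, show t₀ + τ - (τ + r) = t₀ - r by ring]
      congr 1
      ext y
      rw [kernelKx_add h.hα h.hα1 hτ hr'.1]
    rw [e2, intervalIntegral.integral_of_le ht.le, integral_Ioc_eq_integral_Ioo,
      integral_integral_swap]
    · congr 1
      ext z
      rw [duhamel, ← intervalIntegral.integral_const_mul, intervalIntegral.integral_of_le ht.le,
        integral_Ioc_eq_integral_Ioo]
    · have hb : Integrable (fun p : ℝ × ℝ => (A * p.1 ^ (-(1 + α)⁻¹) * m) * kernelK α τ p.2)
          ((volume.restrict (Ioo 0 t₀)).prod volume) := by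
        refine Integrable.mul_prod (f := fun r : ℝ => A * r ^ (-(1 + α)⁻¹) * m) ?_ hKi
        change IntegrableOn _ _ _
        rw [← intervalIntegrable_iff_integrableOn_Ioo_of_le ht.le]
        exact ((intervalIntegrable_rpow_neg h.exp_lt_one _).const_mul A).mul_const m
      have hprod : (volume.restrict (Ioo 0 t₀)).prod (volume : Measure ℝ) =
          (volume : Measure (ℝ × ℝ)).restrict (Ioo 0 t₀ ×ˢ univ) := by
        rw [Measure.volume_eq_prod, ← Measure.prod_restrict, Measure.restrict_univ]
      refine hb.mono' ?_ ?_
      · rw [hprod]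
        refine ContinuousOn.aestronglyMeasurable ?_ (measurableSet_Ioo.prod MeasurableSet.univ)
        intro p hp
        apply ContinuousAt.continuousWithinAt
        have c1 := (continuous_kernelK h.hα h.hα1 hτ)
        refine ContinuousAt.mul (by fun_prop) ?_
        exact (h.continuousAt_inner hφ hp.1.1 hp.1.2 (x - p.2)).comp
          (f := fun p : ℝ × ℝ => (p.1, t₀, x - p.2)) (by fun_prop)
      · rw [hprod]
        filter_upwards [ae_restrict_mem (measurableSet_Ioo.prod MeasurableSet.univ)] with p hp
        simp only [Function.uncurry_def]
        rw [norm_mul, mul_comm, Real.norm_of_nonneg (kernelK_nonneg h.hα h.hα1 hτ p.2)]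
        exact mul_le_mul_of_nonneg_right (h.abs_inner_le hp.1.1 (hφ.bound _ (sub_pos.2 hp.1.2)) _)
          (kernelK_nonneg h.hα h.hα1 hτ p.2)
  · rw [duhamel]
    congr 1; ext σ; congr 1; ext y; congr 2; ring

end KernelEst

end

/-! ### The flux, the linear semigroup and pointwise mild solutions. -/

noncomputable section

section Flux

/-- Subadditivity of the power θ ≤ 1. It gives Hölder continuity of the speed |u|^(q-1) even where u
vanishes. -/
lemma abs_rpow_sub_abs_rpow_le {θ : ℝ} (h0 : 0 < θ) (h1 : θ ≤ 1) (v w : ℝ) :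
    |(|v| ^ θ - |w| ^ θ)| ≤ |v - w| ^ θ := by
  have key : ∀ v w : ℝ, |v| ^ θ - |w| ^ θ ≤ |v - w| ^ θ := by
    intro v w
    have h : |v| ≤ |w| + |v - w| := by
      have := abs_add_le w (v - w); rwa [add_sub_cancel] at this
    have h2 : |v| ^ θ ≤ (|w| + |v - w|) ^ θ := Real.rpow_le_rpow (abs_nonneg _) h h0.le
    have h3 := Real.rpow_add_le_add_rpow (abs_nonneg w) (abs_nonneg (v - w)) h0.le h1
    linarith
  rw [abs_le]
  refine ⟨?_, key v w⟩
  have := key w v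
  rw [abs_sub_comm] at this
  linarith

lemma hasDerivAt_flux {q : ℝ} (hq : 1 < q) (v : ℝ) : HasDerivAt (flux q) (|v| ^ (q - 1)) v := by
  have hpos : ∀ v : ℝ, 0 < v → HasDerivAt (flux q) (|v| ^ (q - 1)) v := by
    intro v hv
    have h := (Real.hasDerivAt_rpow_const (p := q) (Or.inl hv.ne')).div_const q
    rw [mul_div_cancel_left₀ _ (by linarith : q ≠ 0)] at h
    rw [abs_of_pos hv]
    refine h.congr_of_eventuallyEq ?_
    filter_upwards [lt_mem_nhds hv] with x hx
    rw [flux, abs_of_pos hx, ← Real.rpow_add_one hx.ne', sub_add_cancel]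
  rcases lt_trichotomy v 0 with hv | hv | hv
  · have h := (hpos (-v) (by linarith)).comp v (hasDerivAt_neg v)
    have h2 := h.neg
    rw [abs_neg] at h2
    refine (h2.congr_deriv (by ring)).congr_of_eventuallyEq
      (Filter.Eventually.of_forall fun x => ?_)
    simp only [flux, Pi.neg_apply, Function.comp_apply, abs_neg]
    ring
  · subst hv
    rw [abs_zero, Real.zero_rpow (by linarith), hasDerivAt_iff_tendsto_slope]
    have hc : Continuous fun x : ℝ => |x| ^ (q - 1) / q :=
      (continuous_abs.rpow_const fun _ => Or.inr (by linarith)).div_const q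
    have h := (hc.tendsto 0).mono_left (nhdsWithin_le_nhds (s := {0}ᶜ))
    rw [abs_zero, Real.zero_rpow (by linarith), zero_div] at h
    refine h.congr' ?_
    filter_upwards [self_mem_nhdsWithin] with x hx
    have hx' : x ≠ 0 := hx
    rw [slope_def_field, flux, flux]
    field_simp
    ring
  · exact hpos v hv

lemma continuous_flux {q : ℝ} (hq : 1 < q) : Continuous (flux q) :=
  continuous_iff_continuousAt.2 fun v => (hasDerivAt_flux hq v).continuousAt

lemma abs_flux_sub_le {q m : ℝ} (hq : 1 < q) {v w : ℝ} (hv : |v| ≤ m) (hw : |w| ≤ m) :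
    |flux q v - flux q w| ≤ m ^ (q - 1) * |v - w| := by
  refine (convex_Icc (-m) m).norm_image_sub_le_of_norm_hasDerivWithin_le (f := flux q)
    (f' := fun v => |v| ^ (q - 1)) (x := w) (y := v)
    (fun z _ => (hasDerivAt_flux hq z).hasDerivWithinAt) (fun z hz => ?_) (abs_le.1 hw) (abs_le.1 hv)
  rw [Real.norm_of_nonneg (Real.rpow_nonneg (abs_nonneg _) _)]
  exact Real.rpow_le_rpow (abs_nonneg _) (abs_le.2 hz) (by linarith)

lemma abs_flux_le {q m : ℝ} (hq : 1 < q) {v : ℝ} (hv : |v| ≤ m) :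
    |flux q v| ≤ m ^ (q - 1) * m := by
  have h0 : 0 ≤ m := (abs_nonneg _).trans hv
  have h := abs_flux_sub_le hq hv (w := 0) (by rwa [abs_zero])
  have e : flux q 0 = 0 := by simp [flux]
  rw [e, sub_zero, sub_zero] at h
  exact h.trans (mul_le_mul_of_nonneg_left hv (Real.rpow_nonneg h0 _))

end Flux

/-- The solution of the linear problem, `K(t) * v`. -/
def heat (α : ℝ) (v : ℝ → ℝ) (t x : ℝ) : ℝ := ∫ y : ℝ, kernelK α t y * v (x - y)

namespace KernelEst
variable {α θ A : ℝ}

lemma abs_heat_le (h : KernelEst α θ A) {t m : ℝ} (ht : 0 < t) {v : ℝ → ℝ} (hm : ∀ x, |v x| ≤ m)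
    (x : ℝ) : |heat α v t x| ≤ m := by
  have := abs_conv_le (integrable_kernelK h.hα h.hα1 ht) hm x
  have e : ∫ y, |kernelK α t y| = 1 := by
    rw [← integral_kernelK h.hα h.hα1 ht]
    congr 1; ext y
    exact abs_of_nonneg (kernelK_nonneg h.hα h.hα1 ht y)
  rwa [e, one_mul] at this

lemma integrable_heat (h : KernelEst α θ A) {t m : ℝ} (ht : 0 < t) {v : ℝ → ℝ} (hv : Measurable v)
    (hm : ∀ x, |v x| ≤ m) (x : ℝ) : Integrable fun y => kernelK α t y * v (x - y) :=
  integrable_mul_shift (integrable_kernelK h.hα h.hα1 ht) hv hm x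

lemma heat_mono (h : KernelEst α θ A) {t m m' : ℝ} (ht : 0 < t) {v w : ℝ → ℝ} (hv : Measurable v)
    (hm : ∀ x, |v x| ≤ m) (hw : Measurable w) (hm' : ∀ x, |w x| ≤ m') {x x' : ℝ}
    (hle : ∀ y, v (x - y) ≤ w (x' - y)) : heat α v t x ≤ heat α w t x' :=
  integral_mono (h.integrable_heat ht hv hm x) (h.integrable_heat ht hw hm' x') fun y =>
    mul_le_mul_of_nonneg_left (hle y) (kernelK_nonneg h.hα h.hα1 ht y)

lemma heat_const (h : KernelEst α θ A) {t : ℝ} (ht : 0 < t) (c x : ℝ) :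
    heat α (fun _ => c) t x = c := by
  rw [heat, integral_mul_const, integral_kernelK h.hα h.hα1 ht, one_mul]

lemma heat_sub (h : KernelEst α θ A) {t m m' : ℝ} (ht : 0 < t) {v w : ℝ → ℝ} (hv : Measurable v)
    (hm : ∀ x, |v x| ≤ m) (hw : Measurable w) (hm' : ∀ x, |w x| ≤ m') (x : ℝ) :
    heat α (fun y => v y - w y) t x = heat α v t x - heat α w t x := by
  rw [heat, heat, heat, ← integral_sub (h.integrable_heat ht hv hm x) (h.integrable_heat ht hw hm' x)]
  simp only [mul_sub]

lemma heat_const_mul (c : ℝ) (v : ℝ → ℝ) (t x : ℝ) :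
    heat α (fun y => c * v y) t x = c * heat α v t x := by
  rw [heat, heat, ← integral_const_mul]
  congr 1; ext y; ring

lemma heat_shift_space (v : ℝ → ℝ) (k t x : ℝ) :
    heat α (fun y => v (y + k)) t x = heat α v t (x + k) := by
  rw [heat, heat]
  congr 1; ext y; congr 2; ring

lemma heat_add (h : KernelEst α θ A) {t τ m : ℝ} (ht : 0 < t) (hτ : 0 < τ) {v : ℝ → ℝ}
    (hv : Measurable v) (hm : ∀ x, |v x| ≤ m) (x : ℝ) :
    heat α v (τ + t) x = heat α (heat α v t) τ x := by
  have := conv_assoc (integrable_kernelK h.hα h.hα1 hτ) (integrable_kernelK h.hα h.hα1 ht) hv hm x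
  simp_rw [← kernelK_add h.hα h.hα1 hτ ht] at this
  exact this

lemma abs_heat_sub_le (h : KernelEst α θ A) {t m : ℝ} (ht : 0 < t) {v : ℝ → ℝ} (hv : Measurable v)
    (hm : ∀ x, |v x| ≤ m) (x x' : ℝ) :
    |heat α v t x - heat α v t x'| ≤ A * (|x - x'| * t ^ (-(1 + α)⁻¹)) * m :=
  (abs_conv_sub_le (integrable_kernelK h.hα h.hα1 ht) hv hm x x').trans
    (mul_le_mul_of_nonneg_right (h.shift_k t ht _) ((abs_nonneg _).trans (hm 0)))

lemma abs_heat_sub_le_rpow (h : KernelEst α θ A) {t m : ℝ} (ht : 0 < t) {v : ℝ → ℝ}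
    (hv : Measurable v) (hm : ∀ x, |v x| ≤ m) (x x' : ℝ) :
    |heat α v t x - heat α v t x'| ≤ A * (|x - x'| ^ θ * t ^ (-((1 + α)⁻¹ * θ))) * m :=
  (abs_conv_sub_le (integrable_kernelK h.hα h.hα1 ht) hv hm x x').trans
    (mul_le_mul_of_nonneg_right (h.shift_k_rpow t ht _) ((abs_nonneg _).trans (hm 0)))

lemma continuous_heat (h : KernelEst α θ A) {t m : ℝ} (ht : 0 < t) {v : ℝ → ℝ} (hv : Measurable v)
    (hm : ∀ x, |v x| ≤ m) : Continuous (heat α v t) := by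
  have hm0 : 0 ≤ m := (abs_nonneg _).trans (hm 0)
  have h0 : 0 ≤ A * t ^ (-(1 + α)⁻¹) * m :=
    mul_nonneg (mul_nonneg h.hA.le (Real.rpow_nonneg ht.le _)) hm0
  refine LipschitzWith.continuous (K := ⟨A * t ^ (-(1 + α)⁻¹) * m, h0⟩)
    (LipschitzWith.of_dist_le_mul fun x y => ?_)
  rw [Real.dist_eq, Real.dist_eq]
  refine (h.abs_heat_sub_le ht hv hm x y).trans_eq ?_
  change _ = A * t ^ (-(1 + α)⁻¹) * m * |x - y|
  ring

lemma continuousAt_heat_of_continuous (h : KernelEst α θ A) {t m : ℝ} (ht : 0 < t) {v : ℝ → ℝ}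
    (hv : Continuous v) (hm : ∀ x, |v x| ≤ m) (x : ℝ) :
    ContinuousAt (fun p : ℝ × ℝ => heat α v p.1 p.2) (t, x) := by
  have hPc := continuous_profile h.hα h.hα1
  have hcc : ContinuousAt (fun p : ℝ × ℝ => kernelScale α p.1) (t, x) :=
    ContinuousAt.comp (g := kernelScale α) (f := fun p : ℝ × ℝ => p.1) (x := (t, x))
      (Real.continuousAt_rpow_const _ _ (Or.inl ht.ne')) continuousAt_fst
  have key : ContinuousAt (fun p : ℝ × ℝ => ∫ y : ℝ, kernelK α 1 y *
      v (p.2 - (kernelScale α p.1)⁻¹ * y)) (t, x) := by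
    refine continuousAt_of_dominated (bound := fun y => ‖kernelK α 1 y‖ * m) ?_ ?_
      ((integrable_profile h.hα h.hα1).norm.mul_const m) ?_
    · exact Filter.Eventually.of_forall fun p => Continuous.aestronglyMeasurable (by fun_prop)
    · refine Filter.Eventually.of_forall fun p => Filter.Eventually.of_forall fun y => ?_
      rw [norm_mul]
      exact mul_le_mul_of_nonneg_left (hm _) (norm_nonneg _)
    · refine Filter.Eventually.of_forall fun y => continuousAt_const.mul ?_
      have hne : kernelScale α t ≠ 0 := (kernelScale_pos α ht).ne'
      refine hv.continuousAt.comp (f := fun p : ℝ × ℝ => p.2 - (kernelScale α p.1)⁻¹ * y) ?_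
      exact continuousAt_snd.sub ((hcc.inv₀ hne).mul continuousAt_const)
  refine key.congr ?_
  filter_upwards [(isOpen_lt continuous_const continuous_fst).mem_nhds
    (show (t, x) ∈ {p : ℝ × ℝ | 0 < p.1} from ht)] with p hp
  have hcp := kernelScale_pos α hp
  rw [heat, ← integral_scale (fun y => kernelK α 1 y * v (p.2 - (kernelScale α p.1)⁻¹ * y)) hcp]
  refine integral_congr_ae (Filter.Eventually.of_forall fun y => ?_)
  simp only
  have e : kernelK α p.1 y = kernelScale α p.1 * kernelK α 1 (kernelScale α p.1 * y) :=
    kernelK_scaling h.hα h.hα1 hp y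
  rw [e, inv_mul_cancel_left₀ hcp.ne']
  ring

/-- For merely measurable data, the evolution up to time t/2 already produces a continuous function,
to which the previous lemma applies. -/
lemma continuousAt_heat (h : KernelEst α θ A) {t m : ℝ} (ht : 0 < t) {v : ℝ → ℝ}
    (hv : Measurable v) (hm : ∀ x, |v x| ≤ m) (x : ℝ) :
    ContinuousAt (fun p : ℝ × ℝ => heat α v p.1 p.2) (t, x) := by
  have h2 : 0 < t / 2 := by linarith
  have hc := h.continuousAt_heat_of_continuous h2 (h.continuous_heat h2 hv hm) (h.abs_heat_le h2 hm) x
  have ht2 : t - t / 2 = t / 2 := by ring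
  have hcomp : ContinuousAt (fun p : ℝ × ℝ => heat α (heat α v (t / 2)) (p.1 - t / 2) p.2) (t, x) := by
    refine ContinuousAt.comp (x := (t, x)) (g := fun p : ℝ × ℝ => heat α (heat α v (t / 2)) p.1 p.2)
      (f := fun p : ℝ × ℝ => (p.1 - t / 2, p.2)) ?_ (by fun_prop)
    simp only [ht2]
    exact hc
  refine hcomp.congr ?_
  filter_upwards [(isOpen_lt continuous_const continuous_fst).mem_nhds
    (show (t, x) ∈ {p : ℝ × ℝ | t / 2 < p.1} from (half_lt_self ht))] with p hp
  rw [← h.heat_add h2 (sub_pos.2 hp) hv hm, sub_add_cancel]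

end KernelEst

/-- A mild solution for which the integral identity holds at every point. -/
structure MildSol (α q m : ℝ) (v : ℝ → ℝ) (u : ℝ → ℝ → ℝ) : Prop where
  measurable : Measurable v
  bound_init : ∀ x, |v x| ≤ m
  source : Source m u
  eq : ∀ t, 0 < t → ∀ x, u t x = heat α v t x - duhamel α (fun s y => flux q (u s y)) t x

lemma Source.flux {m q : ℝ} (hq : 1 < q) {u : ℝ → ℝ → ℝ} (hu : Source m u) :
    Source (m ^ (q - 1) * m) (fun s y => flux q (u s y)) :=
  ⟨(continuous_flux hq).comp_continuousOn hu.continuousOn,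
    fun t ht x => abs_flux_le hq (hu.bound t ht x)⟩

namespace MildSol
variable {α θ A q m : ℝ} {v : ℝ → ℝ} {u : ℝ → ℝ → ℝ}

/-- Combines the semigroup property with `KernelEst.duhamel_add`. Short-time estimates that depend
only on `m` thus become valid at all later times. -/
lemma restart (hK : KernelEst α θ A) (hq : 1 < q) (hu : MildSol α q m v u) {t₀ : ℝ} (ht : 0 < t₀) :
    MildSol α q m (u t₀) (fun t => u (t₀ + t)) := by
  refine ⟨(hu.source.continuous ht).measurable, hu.source.bound t₀ ht,
    hu.source.shift_time ht.le, fun τ hτ x => ?_⟩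
  have hs := hu.source.flux hq
  have hd : Measurable (duhamel α (fun s y => _root_.flux q (u s y)) t₀) := by
    apply Continuous.measurable
    rw [continuous_iff_continuousAt]
    exact fun y => ContinuousAt.comp (x := y) (f := fun y : ℝ => (t₀, y))
      (hK.continuousAt_duhamel hs ht y) (by fun_prop)
  have hh := (hK.continuous_heat ht hu.measurable hu.bound_init).measurable
  have e : u t₀ = fun y => heat α v t₀ y - duhamel α (fun s y => _root_.flux q (u s y)) t₀ y :=
    funext fun y => hu.eq t₀ ht y
  rw [hu.eq _ (add_pos ht hτ), hK.duhamel_add hs ht hτ, add_comm t₀ τ,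
    hK.heat_add ht hτ hu.measurable hu.bound_init, e,
    hK.heat_sub hτ hh (hK.abs_heat_le ht hu.bound_init) hd (hK.abs_duhamel_le hs ht.le)]
  simp only [heat]
  ring

end MildSol

/-- Every mild solution satisfies the identity everywhere, after changing the datum on a null set. -/
lemma IsMildSolution.exists_mildSol {α θ A q ε : ℝ} (hK : KernelEst α θ A) (hq : 1 < q)
    {u₀ : ℝ → ℝ} (hu₀ : MemLp u₀ ⊤ volume) (hn : ∀ᵐ x : ℝ, 0 ≤ u₀ x) (hε : 0 < ε)
    {u : ℝ → ℝ → ℝ} (hu : IsMildSolution α q (fun x => u₀ x + ε) u) :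
    ∃ m v, 0 < m ∧ MildSol α q m v u ∧ ∀ x, ε ≤ v x := by
  obtain ⟨C, hC⟩ := hu.bounded
  obtain ⟨M, hM⟩ : ∃ M : ℝ, ∀ᵐ x, u₀ x ≤ M := by
    have h := ae_le_eLpNormEssSup (f := u₀) (μ := volume)
    have hlt : eLpNormEssSup u₀ volume ≠ ⊤ := by
      have := hu₀.2.ne; rwa [eLpNorm_exponent_top] at this
    refine ⟨(eLpNormEssSup u₀ volume).toReal, ?_⟩
    filter_upwards [h] with x hx
    refine (le_abs_self _).trans ?_
    have := ENNReal.toReal_mono hlt hx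
    simpa using this
  set g := hu₀.1.mk u₀ with hg
  have hgm : Measurable g := hu₀.1.stronglyMeasurable_mk.measurable
  -- A measurable representative truncated to [ε, M + ε]: it agrees almost everywhere with the datum
  -- and satisfies the bounds at every point.
  set v : ℝ → ℝ := fun x => max ε (min (M + ε) (g x + ε)) with hv
  have hvae : (fun x => u₀ x + ε) =ᵐ[volume] v := by
    filter_upwards [hu₀.1.ae_eq_mk, hM, hn] with x h1 h2 h3
    simp only [hv]
    rw [hg, ← h1, min_eq_right (by linarith), max_eq_right (by linarith)]
  set m := |C| + |M| + ε with hm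
  have hmpos : 0 < m := by positivity
  have hvm : Measurable v := measurable_const.max (measurable_const.min (hgm.add_const ε))
  have hvb : ∀ x, |v x| ≤ m := by
    intro x
    have h1 : ε ≤ v x := le_max_left _ _
    rw [abs_of_pos (hε.trans_le h1)]
    have h2 := le_abs_self M
    have h3 := abs_nonneg C
    have h4 := abs_nonneg M
    exact max_le (by linarith) ((min_le_left _ _).trans (by linarith))
  have hsrc : Source m u := ⟨hu.continuousOn, fun t ht x => (hC t ht x).trans (by
    have h2 := le_abs_self C
    have h4 := abs_nonneg M
    linarith)⟩
  refine ⟨m, v, hmpos, ⟨hvm, hvb, hsrc, ?_⟩, fun x => le_max_left _ _⟩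
  have hopen : IsOpen (Ioi (0 : ℝ) ×ˢ (univ : Set ℝ)) := isOpen_Ioi.prod isOpen_univ
  -- Both sides are continuous on the open half-plane, so equality almost everywhere there is
  -- equality everywhere.
  have heq : EqOn (fun p : ℝ × ℝ => u p.1 p.2)
      (fun p : ℝ × ℝ => heat α v p.1 p.2 - duhamel α (fun s y => flux q (u s y)) p.1 p.2)
      (Ioi (0 : ℝ) ×ˢ (univ : Set ℝ)) := by
    refine Measure.eqOn_open_of_ae_eq (μ := volume) ?_ hopen hu.continuousOn ?_
    · filter_upwards [ae_restrict_of_ae hu.mild, ae_restrict_mem hopen.measurableSet] with p h1 h2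
      rw [h1 h2.1]
      congr 1
      · rw [heat, ← conv_comm]
        refine integral_congr_ae ?_
        filter_upwards [hvae] with y hy
        rw [← hy]
      · rw [duhamel]
        have := intervalIntegral.integral_comp_sub_left (a := 0) (b := p.1) (fun σ : ℝ => ∫ y : ℝ,
          kernelKx α σ (p.2 - y) * flux q (u (p.1 - σ) y)) p.1
        rw [sub_self, sub_zero] at this
        simp only [sub_sub_cancel] at this
        rw [this]
        congr 1
        ext σ
        exact conv_comm _ (fun y => flux q (u (p.1 - σ) y)) _
    · intro p hp
      exact ((hK.continuousAt_heat hp.1 hvm hvb p.2).sub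
        (hK.continuousAt_duhamel (hsrc.flux hq) hp.1 p.2)).continuousWithinAt
  exact fun t ht x => heq (show (t, x) ∈ _ from ⟨ht, mem_univ _⟩)

end

/-! ### Interior regularity in space. -/

noncomputable section

/-- A Lipschitz function whose difference quotients are uniformly Hölder is differentiable, with
Hölder derivative. -/
lemma differentiable_of_diffQuot_holder {f : ℝ → ℝ} {L H θ : ℝ} (hθ : 0 < θ)
    (hL : ∀ x k, |f (x + k) - f x| ≤ L * |k|)
    (hH : ∀ k, k ≠ 0 → ∀ x x', |(f (x + k) - f x) / k - (f (x' + k) - f x') / k| ≤ H * |x - x'| ^ θ)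
    (x : ℝ) : ∃ d, HasDerivAt f d x := by
  have hL0 : 0 ≤ L := by have := (abs_nonneg _).trans (hL 0 1); simpa using this
  have hlip : LipschitzWith ⟨L, hL0⟩ f := LipschitzWith.of_dist_le_mul fun x y => by
    have := hL y (x - y)
    rwa [add_sub_cancel] at this
  -- By Rademacher's theorem differentiability points are dense. The Hölder bound transfers
  -- convergence of the quotients from such a point y to x.
  have hdense := Measure.dense_of_ae (μ := (volume : Measure ℝ)) hlip.ae_differentiableAt_of_real
  have hslope : ∀ {x d : ℝ}, HasDerivAt f d x ↔
      Filter.Tendsto (fun k => (f (x + k) - f x) / k) (nhdsWithin 0 {0}ᶜ) (nhds d) := by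
    intro x d
    rw [hasDerivAt_iff_tendsto_slope_zero]
    simp only [smul_eq_mul, div_eq_inv_mul]
  have hc : Cauchy (Filter.map (fun k => (f (x + k) - f x) / k) (nhdsWithin 0 {0}ᶜ)) := by
    rw [Metric.cauchy_iff]
    refine ⟨inferInstance, fun e he => ?_⟩
    have hcont : Continuous fun y : ℝ => H * |x - y| ^ θ :=
      continuous_const.mul ((continuous_const.sub continuous_id).abs.rpow_const
        fun _ => Or.inr hθ.le)
    have hev : ∀ᶠ y in nhds x, H * |x - y| ^ θ < e / 4 := by
      refine (hcont.tendsto x).eventually_lt_const ?_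
      rw [sub_self, abs_zero, Real.zero_rpow hθ.ne', mul_zero]; positivity
    -- Two quotients at x are compared through y and its derivative, which makes four errors, each
    -- below e/4.
    obtain ⟨y, hy, hyd⟩ := hdense.inter_nhds_nonempty hev
    have hyt := hslope.1 (show DifferentiableAt ℝ f y from hy).hasDerivAt
    have hyd' : H * |x - y| ^ θ < e / 4 := hyd
    have hyt2 := (Metric.tendsto_nhds.1 hyt) (e / 4) (by positivity)
    refine ⟨_, Filter.image_mem_map (Filter.inter_mem hyt2 self_mem_nhdsWithin), ?_⟩
    rintro _ ⟨k, ⟨hk, hk0⟩, rfl⟩ _ ⟨k', ⟨hk', hk0'⟩, rfl⟩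
    have h1 : dist ((f (y + k) - f y) / k) (deriv f y) < e / 4 := hk
    have h2 : dist ((f (y + k') - f y) / k') (deriv f y) < e / 4 := hk'
    have h3 := hH k hk0 x y
    have h4 := hH k' hk0' x y
    rw [Real.dist_eq, abs_lt] at h1 h2 ⊢
    rw [abs_le] at h3 h4
    constructor <;> linarith [h1.1, h1.2, h2.1, h2.2, h3.1, h3.2, h4.1, h4.2]
  obtain ⟨d, hd⟩ := CompleteSpace.complete hc
  exact ⟨d, hslope.2 hd⟩

lemma abs_deriv_sub_le_of_diffQuot_holder {f : ℝ → ℝ} {H θ : ℝ}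
    (hd : ∀ x, DifferentiableAt ℝ f x)
    (hH : ∀ k, k ≠ 0 → ∀ x x', |(f (x + k) - f x) / k - (f (x' + k) - f x') / k| ≤ H * |x - x'| ^ θ)
    (x x' : ℝ) : |deriv f x - deriv f x'| ≤ H * |x - x'| ^ θ := by
  have h1 := hasDerivAt_iff_tendsto_slope_zero.1 (hd x).hasDerivAt
  have h2 := hasDerivAt_iff_tendsto_slope_zero.1 (hd x').hasDerivAt
  refine le_of_tendsto (h1.sub h2).abs ?_
  filter_upwards [self_mem_nhdsWithin] with k hk
  have := hH k hk x x'
  rwa [div_eq_inv_mul, div_eq_inv_mul] at this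

namespace MildSol
variable {α θ A q m : ℝ} {v : ℝ → ℝ} {u : ℝ → ℝ → ℝ}

/-- One of σ and t - σ is at least t/2, which separates the two endpoint singularities of the
Gronwall integrand. -/
lemma rpow_neg_mul_rpow_neg_le {a : ℝ} (ha : 0 < a) {σ t : ℝ} (hσ : 0 < σ) (hσt : σ < t) :
    σ ^ (-a) * (t - σ) ^ (-a) ≤ (t / 2) ^ (-a) * (σ ^ (-a) + (t - σ) ^ (-a)) := by
  have ht : 0 < t / 2 := by linarith
  have h1 : 0 < σ ^ (-a) := Real.rpow_pos_of_pos hσ _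
  have h2 : 0 < (t - σ) ^ (-a) := Real.rpow_pos_of_pos (sub_pos.2 hσt) _
  have h3 : 0 < (t / 2) ^ (-a) := Real.rpow_pos_of_pos ht _
  rcases le_total σ (t / 2) with h | h
  · have : (t - σ) ^ (-a) ≤ (t / 2) ^ (-a) :=
      Real.rpow_le_rpow_of_nonpos ht (by linarith) (by linarith)
    nlinarith [mul_pos h3 h2]
  · have : σ ^ (-a) ≤ (t / 2) ^ (-a) := Real.rpow_le_rpow_of_nonpos ht h (by linarith)
    nlinarith [mul_pos h3 h1]

/-- One step of the singular Gronwall argument. -/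
lemma weighted_diff_le (hK : KernelEst α θ A) (hq : 1 < q) (hu : MildSol α q m v u) {t k N : ℝ}
    (ht : 0 < t) (hN : ∀ s, 0 < s → s ≤ t → ∀ x, s ^ (1 + α)⁻¹ * |u s (x + k) - u s x| ≤ N) (x : ℝ) :
    t ^ (1 + α)⁻¹ * |u t (x + k) - u t x| ≤ A * m * |k| +
      (8 * A * m ^ (q - 1) / (1 - (1 + α)⁻¹)) * t ^ (1 - (1 + α)⁻¹) / 2 * N := by
  have ha := hK.exp_pos
  have ha1 := hK.exp_lt_one
  set a := (1 + α)⁻¹ with hadef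
  have hm0 : 0 ≤ m := hu.source.nonneg
  set F := m ^ (q - 1) with hF
  have hF0 : 0 ≤ F := Real.rpow_nonneg hm0 _
  have hN0 : 0 ≤ N := (mul_nonneg (Real.rpow_nonneg ht.le _) (abs_nonneg _)).trans (hN t ht le_rfl x)
  have hs := hu.source.flux hq
  have hsk : Source (F * m) (fun s y => flux q (u s (y + k))) := by
    refine ⟨?_, fun t ht x => hs.bound t ht _⟩
    exact hs.continuousOn.comp (f := fun p : ℝ × ℝ => (p.1, p.2 + k)) (by fun_prop)
      fun p hp => ⟨hp.1, mem_univ _⟩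
  have hint1 : IntervalIntegrable (fun σ : ℝ => σ ^ (-a)) volume 0 t :=
    KernelEst.intervalIntegrable_rpow_neg ha1 t
  have hint2 : IntervalIntegrable (fun σ : ℝ => (t - σ) ^ (-a)) volume 0 t := by
    have := (hint1.comp_sub_left t).symm
    simpa using this
  have hduh : |duhamel α (fun s y => flux q (u s (y + k)) - flux q (u s y)) t x| ≤
      ∫ σ in (0 : ℝ)..t, A * F * N * ((t / 2) ^ (-a) * (σ ^ (-a) + (t - σ) ^ (-a))) := by
    refine hK.abs_duhamel_le_integral ht.le (((hint1.add hint2).const_mul _).const_mul _) ?_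
    intro σ hσ
    have hts : 0 < t - σ := sub_pos.2 hσ.2
    have hb : ∀ y, |flux q (u (t - σ) (y + k)) - flux q (u (t - σ) y)| ≤ F * (N * (t - σ) ^ (-a)) := by
      intro y
      refine (abs_flux_sub_le hq (hu.source.bound _ hts _) (hu.source.bound _ hts _)).trans ?_
      refine mul_le_mul_of_nonneg_left ?_ hF0
      have h1 := hN _ hts (by linarith [hσ.1]) y
      rw [Real.rpow_neg hts.le, ← div_eq_mul_inv, le_div_iff₀ (Real.rpow_pos_of_pos hts _), mul_comm]
      exact h1
    refine (hK.abs_inner_le hσ.1 hb x).trans ?_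
    have := rpow_neg_mul_rpow_neg_le ha hσ.1 hσ.2
    calc A * σ ^ (-a) * (F * (N * (t - σ) ^ (-a))) = A * F * N * (σ ^ (-a) * (t - σ) ^ (-a)) := by ring
      _ ≤ _ := mul_le_mul_of_nonneg_left this
          (mul_nonneg (mul_nonneg hK.hA.le hF0) hN0)
  have hval : ∫ σ in (0 : ℝ)..t, A * F * N * ((t / 2) ^ (-a) * (σ ^ (-a) + (t - σ) ^ (-a))) =
      A * F * N * ((t / 2) ^ (-a) * (2 * (t ^ (1 - a) / (1 - a)))) := by
    have e2 : ∫ σ in (0 : ℝ)..t, (t - σ) ^ (-a) = ∫ σ in (0 : ℝ)..t, σ ^ (-a) := by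
      have := intervalIntegral.integral_comp_sub_left (a := 0) (b := t) (fun σ : ℝ => σ ^ (-a)) t
      simpa using this
    rw [intervalIntegral.integral_const_mul, intervalIntegral.integral_const_mul,
      intervalIntegral.integral_add hint1 hint2, e2, KernelEst.integral_rpow_neg ha1]
    ring
  rw [hval] at hduh
  have hheat := hK.abs_heat_sub_le ht hu.measurable hu.bound_init (x + k) x
  rw [add_sub_cancel_left] at hheat
  have hdiff : |u t (x + k) - u t x| ≤ A * (|k| * t ^ (-a)) * m +
      A * F * N * ((t / 2) ^ (-a) * (2 * (t ^ (1 - a) / (1 - a)))) := by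
    rw [hK.duhamel_sub hsk hs ht.le,
      KernelEst.duhamel_shift_space (fun s y => flux q (u s y))] at hduh
    rw [hu.eq t ht, hu.eq t ht]
    calc _ = |(heat α v t (x + k) - heat α v t x) -
          (duhamel α (fun s y => flux q (u s y)) t (x + k) -
            duhamel α (fun s y => flux q (u s y)) t x)| := by congr 1; ring
      _ ≤ _ := (abs_sub _ _).trans (add_le_add hheat hduh)
  have hta : t ^ a * t ^ (-a) = 1 := by rw [← Real.rpow_add ht, add_neg_cancel, Real.rpow_zero]
  have hta2 : t ^ a * (t / 2) ^ (-a) ≤ 2 := by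
    rw [Real.div_rpow ht.le two_pos.le, ← mul_div_assoc, hta, Real.rpow_neg two_pos.le, one_div,
      inv_inv]
    calc (2 : ℝ) ^ a ≤ 2 ^ (1 : ℝ) := Real.rpow_le_rpow_of_exponent_le one_le_two ha1.le
      _ = 2 := Real.rpow_one 2
  have hnn : 0 ≤ A * F * N * (2 * (t ^ (1 - a) / (1 - a))) := by
    have h1 : 0 < 1 - a := by linarith
    have h2 := hK.hA.le
    have h3 := Real.rpow_nonneg ht.le (1 - a)
    positivity
  calc t ^ a * |u t (x + k) - u t x| ≤ t ^ a * (A * (|k| * t ^ (-a)) * m +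
      A * F * N * ((t / 2) ^ (-a) * (2 * (t ^ (1 - a) / (1 - a))))) :=
        mul_le_mul_of_nonneg_left hdiff (Real.rpow_nonneg ht.le _)
    _ = A * m * |k| * (t ^ a * t ^ (-a)) + (t ^ a * (t / 2) ^ (-a)) *
        (A * F * N * (2 * (t ^ (1 - a) / (1 - a)))) := by ring
    _ ≤ A * m * |k| * 1 + 2 * (A * F * N * (2 * (t ^ (1 - a) / (1 - a)))) := by
        rw [hta]
        exact add_le_add le_rfl (mul_le_mul_of_nonneg_right hta2 hnn)
    _ = _ := by ring

/-- Mild solutions become Lipschitz in space after a short time. -/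
lemma exists_lipschitz_small (hK : KernelEst α θ A) (hq : 1 < q) (hm : 0 < m) :
    ∃ T₀ : ℝ, 0 < T₀ ∧ ∀ T, 0 < T → T ≤ T₀ → ∃ L : ℝ, ∀ v u, MildSol α q m v u →
      ∀ x k, |u T (x + k) - u T x| ≤ L * |k| := by
  have ha := hK.exp_pos
  have ha1 := hK.exp_lt_one
  set a := (1 + α)⁻¹ with hadef
  set F := m ^ (q - 1) with hF
  have hF0 : 0 < F := Real.rpow_pos_of_pos hm _
  set c := 8 * A * F / (1 - a) with hc
  have hA := hK.hA
  have h1a : 0 < 1 - a := by linarith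
  have hc0 : 0 < c := by positivity
  -- Chosen so that c T₀^(1-a) = 1: the Duhamel contribution is then at most half of the supremum
  -- and can be absorbed.
  refine ⟨(c⁻¹) ^ (1 - a)⁻¹, Real.rpow_pos_of_pos (inv_pos.2 hc0) _, fun T hT hTT =>
    ⟨2 * (A * m) * T ^ (-a), fun v u hu x k => ?_⟩⟩
  have hcT : ∀ t, 0 < t → t ≤ T → c * t ^ (1 - a) ≤ 1 := by
    intro t ht htT
    have h1 : t ^ (1 - a) ≤ ((c⁻¹) ^ (1 - a)⁻¹) ^ (1 - a) :=
      Real.rpow_le_rpow ht.le (htT.trans hTT) h1a.le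
    rw [← Real.rpow_mul (inv_pos.2 hc0).le, inv_mul_cancel₀ h1a.ne', Real.rpow_one] at h1
    calc c * t ^ (1 - a) ≤ c * c⁻¹ := mul_le_mul_of_nonneg_left h1 hc0.le
      _ = 1 := mul_inv_cancel₀ hc0.ne'
  set S : Set ℝ := {z | ∃ s, 0 < s ∧ s ≤ T ∧ ∃ x, z = s ^ a * |u s (x + k) - u s x|} with hS
  have hne : S.Nonempty := ⟨_, T, hT, le_rfl, 0, rfl⟩
  -- The increment is not divided by k, so boundedness of u alone makes the supremum finite; no
  -- prior smoothness is needed for absorption.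
  have hbdd : BddAbove S := by
    refine ⟨T ^ a * (m + m), ?_⟩
    rintro _ ⟨s, hs, hsT, x, rfl⟩
    refine mul_le_mul (Real.rpow_le_rpow hs.le hsT ha.le) ?_ (abs_nonneg _)
      (Real.rpow_nonneg hT.le _)
    exact (abs_sub _ _).trans (add_le_add (hu.source.bound s hs _) (hu.source.bound s hs _))
  set N := sSup S with hNdef
  have hmem : ∀ s, 0 < s → s ≤ T → ∀ x, s ^ a * |u s (x + k) - u s x| ≤ N := fun s hs hsT x =>
    le_csSup hbdd ⟨s, hs, hsT, x, rfl⟩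
  have hN0 : 0 ≤ N := (mul_nonneg (Real.rpow_nonneg hT.le _) (abs_nonneg _)).trans (hmem T hT le_rfl 0)
  have hNle : N ≤ A * m * |k| + 1 / 2 * N := by
    refine csSup_le hne ?_
    rintro _ ⟨s, hs, hsT, x, rfl⟩
    refine (hu.weighted_diff_le hK hq hs (fun r hr hrs x => hmem r hr (hrs.trans hsT) x) x).trans ?_
    have := hcT s hs hsT
    have h2 : c * s ^ (1 - a) / 2 * N ≤ 1 / 2 * N := by nlinarith
    linarith
  have h1 := hmem T hT le_rfl x
  have h2 : T ^ a * |u T (x + k) - u T x| ≤ 2 * (A * m) * |k| := by linarith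
  have hpos := Real.rpow_pos_of_pos hT a
  rw [Real.rpow_neg hT.le]
  calc |u T (x + k) - u T x| = (T ^ a)⁻¹ * (T ^ a * |u T (x + k) - u T x|) := by
        rw [inv_mul_cancel_left₀ hpos.ne']
    _ ≤ (T ^ a)⁻¹ * (2 * (A * m) * |k|) := mul_le_mul_of_nonneg_left h2 (inv_pos.2 hpos).le
    _ = _ := by ring

/-- The short time depends on u only through the bound m, so restarting just before t gives one
constant for all t ≥ τ. -/
lemma exists_lipschitz (hK : KernelEst α θ A) (hq : 1 < q) (hm : 0 < m) {τ : ℝ} (hτ : 0 < τ) :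
    ∃ L : ℝ, 0 < L ∧ ∀ v u, MildSol α q m v u → ∀ t, τ ≤ t → ∀ x k,
      |u t (x + k) - u t x| ≤ L * |k| := by
  obtain ⟨T₀, hT₀, h⟩ := exists_lipschitz_small hK hq hm
  obtain ⟨L, hL⟩ := h (min (τ / 2) T₀) (lt_min (by linarith) hT₀) (min_le_right _ _)
  refine ⟨|L| + 1, by positivity, fun v u hu t ht x k => ?_⟩
  have hlt : 0 < t - min (τ / 2) T₀ := by
    have := min_le_left (τ / 2) T₀
    linarith
  have := hL _ _ (hu.restart hK hq hlt) x k
  rw [sub_add_cancel] at this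
  refine this.trans (mul_le_mul_of_nonneg_right ?_ (abs_nonneg _))
  linarith [le_abs_self L]

/-- Uniform Hölder bound for difference quotients at a fixed time. -/
lemma exists_diffQuot_holder (hK : KernelEst α θ A) (hq : 1 < q) (hm : 0 ≤ m) {T : ℝ} (hT : 0 < T)
    {L : ℝ} (hL : 0 ≤ L) :
    ∃ H : ℝ, 0 < H ∧ ∀ v u, MildSol α q m v u → (∀ x k, |v (x + k) - v x| ≤ L * |k|) →
      (∀ t, 0 < t → ∀ x k, |u t (x + k) - u t x| ≤ L * |k|) → ∀ k, k ≠ 0 → ∀ x x',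
      |(u T (x + k) - u T x) / k - (u T (x' + k) - u T x') / k| ≤ H * |x - x'| ^ θ := by
  set F := m ^ (q - 1) with hF
  have hF0 : 0 ≤ F := Real.rpow_nonneg hm _
  have hb1 := hK.exp_mul_lt_one
  set b := (1 + α)⁻¹ * (1 + θ) with hb
  have hA := hK.hA
  have hTb := Real.rpow_nonneg hT.le (1 - b)
  have hTc := Real.rpow_nonneg hT.le (-((1 + α)⁻¹ * θ))
  have h1b : 0 < 1 - b := by linarith
  refine ⟨A * T ^ (-((1 + α)⁻¹ * θ)) * L + A * (F * L) * (T ^ (1 - b) / (1 - b)) + 1, by positivity,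
    fun v u hu hv hul k hk x x' => ?_⟩
  have hs := hu.source.flux hq
  have hsk : Source (F * m) (fun s y => flux q (u s (y + k))) := by
    refine ⟨?_, fun t ht x => hs.bound t ht _⟩
    exact hs.continuousOn.comp (f := fun p : ℝ × ℝ => (p.1, p.2 + k)) (by fun_prop)
      fun p hp => ⟨hp.1, mem_univ _⟩
  -- The difference quotient satisfies a mild formula with datum `V` and source `Ψ`, both bounded
  -- independently of k by the Lipschitz bound. Smoothing by the kernel then gives a Hölder bound
  -- uniform in k.
  set V : ℝ → ℝ := fun y => k⁻¹ * (v (y + k) - v y) with hV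
  set Ψ : ℝ → ℝ → ℝ := fun s y => k⁻¹ * (flux q (u s (y + k)) - flux q (u s y)) with hΨ
  have hki : ∀ z B : ℝ, |z| ≤ B * |k| → |k⁻¹ * z| ≤ B := by
    intro z B h
    rw [abs_mul, abs_inv, inv_mul_le_iff₀ (abs_pos.2 hk), mul_comm]; exact h
  have hvk : Measurable fun y => v (y + k) := hu.measurable.comp (measurable_id.add_const k)
  have hVm : Measurable V := (hvk.sub hu.measurable).const_mul _
  have hVb : ∀ y, |V y| ≤ L := fun y => hki _ _ (hv y k)
  have hΨs : Source (F * L) Ψ := by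
    refine ⟨continuousOn_const.mul (hsk.continuousOn.sub hs.continuousOn), fun t ht y => ?_⟩
    refine hki _ _ ((abs_flux_sub_le hq (hu.source.bound _ ht _) (hu.source.bound _ ht _)).trans ?_)
    rw [mul_assoc]
    exact mul_le_mul_of_nonneg_left (hul t ht y k) hF0
  have hrep : ∀ x, (u T (x + k) - u T x) / k = heat α V T x - duhamel α Ψ T x := by
    intro x
    rw [hV, KernelEst.heat_const_mul, hK.heat_sub hT hvk (fun y => hu.bound_init _) hu.measurable
      hu.bound_init, KernelEst.heat_shift_space, hΨ,
      KernelEst.duhamel_const_mul k⁻¹ (fun s y => flux q (u s (y + k)) - flux q (u s y)),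
      hK.duhamel_sub hsk hs hT.le,
      KernelEst.duhamel_shift_space (fun s y => flux q (u s y)), hu.eq T hT, hu.eq T hT]
    ring
  rw [hrep, hrep]
  have h1 := hK.abs_heat_sub_le_rpow hT hVm hVb x x'
  have h2 := hK.abs_duhamel_sub_le hΨs hT.le x x'
  have hx : 0 ≤ |x - x'| ^ θ := Real.rpow_nonneg (abs_nonneg _) _
  calc _ = |(heat α V T x - heat α V T x') - (duhamel α Ψ T x - duhamel α Ψ T x')| := by
        congr 1; ring
    _ ≤ _ := (abs_sub _ _).trans (add_le_add h1 h2)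
    _ = (A * T ^ (-((1 + α)⁻¹ * θ)) * L + A * (F * L) * (T ^ (1 - b) / (1 - b))) *
        |x - x'| ^ θ := by ring
    _ ≤ _ := mul_le_mul_of_nonneg_right (by linarith) hx

/-- Interior regularity: `u(t,·)` is `C^{1,θ}`, uniformly for `t ≥ τ`. -/
lemma exists_regularity (hK : KernelEst α θ A) (hq : 1 < q) (hm : 0 < m) {τ : ℝ} (hτ : 0 < τ)
    (hu : MildSol α q m v u) :
    ∃ L H : ℝ, 0 < L ∧ 0 < H ∧ ∀ t, τ ≤ t →
      (∀ x x', |u t x - u t x'| ≤ L * |x - x'|) ∧ (∀ x, DifferentiableAt ℝ (u t) x) ∧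
      (∀ x, |deriv (u t) x| ≤ L) ∧ ∀ x x', |deriv (u t) x - deriv (u t) x'| ≤ H * |x - x'| ^ θ := by
  have hτ2 : 0 < τ / 2 := by linarith
  obtain ⟨L, hL0, hL⟩ := exists_lipschitz hK hq hm hτ2
  obtain ⟨H, hH0, hH⟩ := exists_diffQuot_holder hK hq hm.le hτ2 hL0.le
  refine ⟨L, H, hL0, hH0, fun t ht => ?_⟩
  have hlt : 0 < t - τ / 2 := by linarith
  have hlip := hL v u hu t (by linarith)
  have hq' := hH _ _ (hu.restart hK hq hlt) (hL v u hu _ (by linarith))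
    (fun s hs => hL v u hu _ (by linarith))
  rw [sub_add_cancel] at hq'
  have hdiff : ∀ x, DifferentiableAt ℝ (u t) x := fun x =>
    (differentiable_of_diffQuot_holder hK.hθ hlip hq' x).choose_spec.differentiableAt
  have hlip' : ∀ x x', |u t x - u t x'| ≤ L * |x - x'| := fun x x' => by
    have := hlip x' (x - x'); rwa [add_sub_cancel] at this
  refine ⟨hlip', hdiff, fun x => ?_, abs_deriv_sub_le_of_diffQuot_holder hdiff hq'⟩
  have hl : LipschitzWith ⟨L, hL0.le⟩ (u t) := LipschitzWith.of_dist_le_mul fun x y => hlip' x y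
  exact norm_deriv_le_of_lipschitz hl

end MildSol

end

/-! ### Regularity in time and the splitting step. -/

noncomputable section

/-- Mean value inequality for f minus the linear function with slope f'(x). -/
lemma abs_taylor_le {f : ℝ → ℝ} {H θ : ℝ} (hH : 0 ≤ H) (hθ : 0 ≤ θ)
    (hd : ∀ x, DifferentiableAt ℝ f x)
    (hh : ∀ x x', |deriv f x - deriv f x'| ≤ H * |x - x'| ^ θ) (x k : ℝ) :
    |f (x + k) - f x - k * deriv f x| ≤ H * |k| ^ θ * |k| := by
  have := Convex.norm_image_sub_le_of_norm_hasDerivWithin_le (f := fun z => f z - z * deriv f x)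
    (f' := fun z => deriv f z - deriv f x)
    (s := uIcc x (x + k)) (x := x) (y := x + k) (C := H * |k| ^ θ)
    (fun z _ => ?_) (fun z hz => ?_) (convex_uIcc _ _) left_mem_uIcc right_mem_uIcc
  · rw [Real.norm_eq_abs, Real.norm_eq_abs, add_sub_cancel_left] at this
    convert this using 2
    ring
  · have h1 := (hd z).hasDerivAt.sub ((hasDerivAt_id z).mul_const (deriv f x))
    rw [one_mul] at h1
    exact h1.hasDerivWithinAt
  · refine (hh z x).trans (mul_le_mul_of_nonneg_left ?_ hH)
    refine Real.rpow_le_rpow (abs_nonneg _) ?_ hθ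
    have := abs_sub_left_of_mem_uIcc hz
    simpa using this

namespace KernelEst
variable {α θ A : ℝ}

/-- Since the kernel has mass one, the difference averages increments of g, and the moment of order
θ controls them. -/
lemma abs_heat_sub_self_le (h : KernelEst α θ A) {s m G : ℝ} (hs : 0 < s) {g : ℝ → ℝ}
    (hg : Measurable g) (hm : ∀ x, |g x| ≤ m) (hG : ∀ x x', |g x - g x'| ≤ G * |x - x'| ^ θ)
    (hG0 : 0 ≤ G) (x : ℝ) : |heat α g s x - g x| ≤ G * (A * s ^ ((1 + α)⁻¹ * θ)) := by
  have e : heat α g s x - g x = ∫ y, kernelK α s y * (g (x - y) - g x) := by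
    have h1 := h.integrable_heat hs hg hm x
    have h2 := (integrable_kernelK h.hα h.hα1 hs).mul_const (g x)
    simp_rw [mul_sub]
    rw [integral_sub h1 h2, integral_mul_const, integral_kernelK h.hα h.hα1 hs, one_mul]
    rfl
  rw [e]
  refine (norm_integral_le_of_norm_le (f := fun y => kernelK α s y * (g (x - y) - g x))
    ((h.integrable_moment s hs).const_mul G)
    (Filter.Eventually.of_forall fun y => ?_)).trans ?_
  · have hk := kernelK_nonneg h.hα h.hα1 hs y
    rw [norm_mul, Real.norm_of_nonneg hk, Real.norm_eq_abs]
    have := hG (x - y) x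
    rw [show x - y - x = -y by ring, abs_neg] at this
    calc _ ≤ kernelK α s y * (G * |y| ^ θ) := mul_le_mul_of_nonneg_left this hk
      _ = _ := by ring
  · rw [integral_const_mul]
    exact mul_le_mul_of_nonneg_left (h.moment s hs) hG0

/-- Integration by parts against the kernel. -/
lemma integral_kernelKx_mul (h : KernelEst α θ A) {s m m' : ℝ} (hs : 0 < s) {F g : ℝ → ℝ}
    (hF : ∀ x, HasDerivAt F (g x) x) (hFm : ∀ x, |F x| ≤ m) (hg : Measurable g)
    (hgm : ∀ x, |g x| ≤ m') (x : ℝ) :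
    ∫ y, kernelKx α s y * F (x - y) = heat α g s x := by
  have hFc : Continuous F := continuous_iff_continuousAt.2 fun x => (hF x).continuousAt
  have hK := integrable_kernelK h.hα h.hα1 hs
  have hKx := integrable_kernelKx h.hα h.hα1 hs
  have i1 := integrable_mul_shift hK hg hgm x
  have i2 := integrable_mul_shift hKx hFc.measurable hFm x
  have i3 := integrable_mul_shift hK hFc.measurable hFm x
  have := integral_mul_deriv_eq_deriv_mul_of_integrable (u := kernelK α s) (u' := kernelKx α s)
    (v := fun y => F (x - y)) (v' := fun y => -g (x - y))
    (fun y _ => hasDerivAt_kernelK' h.hα h.hα1 hs y)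
    (fun y _ => by
      have h1 := (hF (x - y)).comp y ((hasDerivAt_id y).const_sub x)
      exact h1.congr_deriv (by ring))
    (by refine i1.neg.congr (Filter.Eventually.of_forall fun y => ?_); simp)
    i2 i3
  simp only [mul_neg, integral_neg, neg_inj] at this
  rw [← this, heat]

end KernelEst

namespace MildSol
variable {α A q m : ℝ} {v : ℝ → ℝ} {u : ℝ → ℝ → ℝ}

/-- Use the Lipschitz bound at distances below 1 and the uniform bound beyond. -/
lemma abs_le_rpow_of_lipschitz_of_bound {z d L m θ : ℝ} (hL : 0 ≤ L) (hm : 0 ≤ m) (h0 : 0 ≤ θ)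
    (h1 : θ ≤ 1) (hd : 0 ≤ d) (hz1 : z ≤ L * d) (hz2 : z ≤ m) : z ≤ (L + m) * d ^ θ := by
  have hdθ := Real.rpow_nonneg hd θ
  rcases le_total d 1 with hd1 | hd1
  · have h : d ≤ d ^ θ := by
      rcases hd.eq_or_lt with h | h
      · rw [← h]; exact Real.rpow_nonneg le_rfl _
      · calc d = d ^ (1 : ℝ) := (Real.rpow_one _).symm
          _ ≤ d ^ θ := Real.rpow_le_rpow_of_exponent_ge h hd1 h1
    nlinarith
  · have h : 1 ≤ d ^ θ := Real.one_le_rpow hd1 h0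
    nlinarith

/-- Hölder continuity in time of `u` and `∂ₓu`, for `t ≥ τ`. -/
lemma exists_time_regularity (hK : KernelEst α (q - 1) A) (hu : MildSol α q m v u)
    {τ L H : ℝ} (hτ : 0 < τ) (hL : 0 < L) (hH : 0 < H)
    (hreg : ∀ t, τ ≤ t →
      (∀ x x', |u t x - u t x'| ≤ L * |x - x'|) ∧ (∀ x, DifferentiableAt ℝ (u t) x) ∧
      (∀ x, |deriv (u t) x| ≤ L) ∧
      ∀ x x', |deriv (u t) x - deriv (u t) x'| ≤ H * |x - x'| ^ (q - 1)) :
    ∃ C : ℝ, 0 < C ∧ ∀ t, τ ≤ t → ∀ s, 0 < s → s ≤ 1 → ∀ x,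
      |u (t + s) x - u t x| ≤ C * s ^ ((1 + α)⁻¹ * (q - 1)) ∧
      |deriv (u (t + s)) x - deriv (u t) x| ≤ C * s ^ ((1 + α)⁻¹ * (q - 1) * (q - 1) / 2) := by
  have hq : 1 < q := by linarith [hK.hθ]
  have hm : 0 ≤ m := hu.source.nonneg
  have ha := hK.exp_pos
  have ha1 := hK.exp_lt_one
  have hb1 := hK.exp_mul_lt_one
  have hA := hK.hA
  have hθ := hK.hθ
  have hθ1 : q - 1 < 1 := hK.hθα.trans hK.hα1
  set θ := q - 1 with hθdef
  set a := (1 + α)⁻¹ with hadef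
  have h1a : 0 < 1 - a := by linarith
  set C₁ := (L + 2 * m) * A + A * (m ^ θ * m) / (1 - a) with hC₁
  have hmθ : 0 ≤ m ^ θ := Real.rpow_nonneg hm _
  have hC₁0 : 0 < C₁ := by positivity
  have hu1 : ∀ t, τ ≤ t → ∀ s, 0 < s → s ≤ 1 → ∀ x, |u (t + s) x - u t x| ≤ C₁ * s ^ (a * θ) := by
    intro t ht s hs hs1 x
    have ht0 : 0 < t := hτ.trans_le ht
    have hr := hu.restart hK hq ht0
    have h1 : |heat α (u t) s x - u t x| ≤ (L + 2 * m) * (A * s ^ (a * θ)) := by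
      refine hK.abs_heat_sub_self_le hs hr.measurable hr.bound_init (fun y y' => ?_) (by positivity) x
      refine abs_le_rpow_of_lipschitz_of_bound hL.le (by positivity) hθ.le hθ1.le (abs_nonneg _)
        ((hreg t ht).1 y y') ((abs_sub _ _).trans ?_)
      linarith [hu.source.bound t ht0 y, hu.source.bound t ht0 y']
    have h2 := hK.abs_duhamel_le (hr.source.flux hq) hs.le x
    -- Equivalent to a(1+θ) ≤ 1, so the Duhamel part is no rougher in time than the linear part.
    have h3 : s ^ (1 - a) ≤ s ^ (a * θ) :=
      Real.rpow_le_rpow_of_exponent_ge hs hs1 (by nlinarith)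
    have h4 : A * (m ^ θ * m) * (s ^ (1 - a) / (1 - a)) ≤
        A * (m ^ θ * m) / (1 - a) * s ^ (a * θ) := by
      rw [mul_div_assoc', div_mul_eq_mul_div]
      gcongr
    have e := hr.eq s hs x
    rw [e]
    calc _ = |(heat α (u t) s x - u t x) - duhamel α (fun r y => flux q (u (t + r) y)) s x| := by
          congr 1; ring
      _ ≤ _ := (abs_sub _ _).trans (add_le_add h1 (h2.trans h4))
      _ = _ := by ring
  refine ⟨C₁ + (2 * H + 2 * C₁), by positivity, fun t ht s hs hs1 x => ⟨?_, ?_⟩⟩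
  · refine (hu1 t ht s hs hs1 x).trans (mul_le_mul_of_nonneg_right (by linarith) ?_)
    exact Real.rpow_nonneg hs.le _
  -- Interpolation: ∂ₓu is replaced by a quotient of step k. The Taylor error is k^θ, the time error
  -- s^(aθ)/k; this k turns the latter into k itself.
  · set k := s ^ (a * θ / 2) with hk
    have hk0 : 0 < k := Real.rpow_pos_of_pos hs _
    have hkθ : k ^ θ = s ^ (a * θ * θ / 2) := by
      rw [hk, ← Real.rpow_mul hs.le]; congr 1; ring
    have hkk : s ^ (a * θ) = k * k := by
      rw [hk, ← Real.rpow_add hs]; congr 1; ring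
    have hkle : k ≤ s ^ (a * θ * θ / 2) := by
      refine Real.rpow_le_rpow_of_exponent_ge hs hs1 ?_
      have : 0 < a * θ := by positivity
      nlinarith
    have hts : τ ≤ t + s := by linarith
    have t1 := abs_taylor_le hH.le hθ.le (hreg t ht).2.1 (hreg t ht).2.2.2 x k
    have t2 := abs_taylor_le hH.le hθ.le (hreg _ hts).2.1 (hreg _ hts).2.2.2 x k
    rw [abs_of_pos hk0] at t1 t2
    have d1 := hu1 t ht s hs hs1 x
    have d2 := hu1 t ht s hs hs1 (x + k)
    rw [hkk] at d1 d2
    have hmain : k * |deriv (u (t + s)) x - deriv (u t) x| ≤ k * (2 * H * k ^ θ + 2 * C₁ * k) := by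
      rw [← abs_of_pos hk0, ← abs_mul, abs_of_pos hk0]
      rw [abs_le] at t1 t2 d1 d2 ⊢
      rw [mul_sub]
      have e : k * (2 * H * k ^ θ + 2 * C₁ * k) =
        2 * (H * k ^ θ * k) + 2 * (C₁ * (k * k)) := by ring
      rw [e]
      constructor <;> linarith [t1.1, t1.2, t2.1, t2.2, d1.1, d1.2, d2.1, d2.2]
    have hmain2 := le_of_mul_le_mul_left hmain hk0
    refine hmain2.trans ?_
    rw [hkθ]
    have hnn : 0 ≤ s ^ (a * θ * θ / 2) := Real.rpow_nonneg hs.le _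
    nlinarith

/-- The advected profile `x ↦ u(t, x - h |u(t,x)|^(q-1))`. -/
def advect (q h : ℝ) (w : ℝ → ℝ) (x : ℝ) : ℝ := w (x - h * |w x| ^ (q - 1))

lemma continuous_advect {q h : ℝ} (hq : 1 < q) {w : ℝ → ℝ} (hw : Continuous w) :
    Continuous (advect q h w) := by
  have : Continuous fun x => |w x| ^ (q - 1) :=
    hw.abs.rpow_const fun _ => Or.inr (by linarith)
  unfold advect
  fun_prop

/-- Advection followed by linear diffusion approximates the solution to order `o(h)`, uniformly. -/
lemma exists_step_estimate (hK : KernelEst α (q - 1) A) (hu : MildSol α q m v u)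
    {τ L H : ℝ} (hτ : 0 < τ) (hL : 0 < L) (hH : 0 < H)
    (hreg : ∀ t, τ ≤ t →
      (∀ x x', |u t x - u t x'| ≤ L * |x - x'|) ∧ (∀ x, DifferentiableAt ℝ (u t) x) ∧
      (∀ x, |deriv (u t) x| ≤ L) ∧
      ∀ x x', |deriv (u t) x - deriv (u t) x'| ≤ H * |x - x'| ^ (q - 1)) :
    ∃ C κ : ℝ, 0 < C ∧ 0 < κ ∧ κ ≤ 1 ∧ ∀ t, τ ≤ t → ∀ h, 0 < h → h ≤ 1 → ∀ x,
      |u (t + h) x - heat α (advect q h (u t)) h x| ≤ C * (h * h ^ κ) := by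
  obtain ⟨C₂, hC₂0, hC₂⟩ := exists_time_regularity hK hu hτ hL hH hreg
  have hq : 1 < q := by linarith [hK.hθ]
  have hm : 0 ≤ m := hu.source.nonneg
  have ha := hK.exp_pos
  have ha1 := hK.exp_lt_one
  have hA := hK.hA
  have hθ := hK.hθ
  have hθ1 : q - 1 < 1 := hK.hθα.trans hK.hα1
  set θ := q - 1 with hθdef
  set a := (1 + α)⁻¹ with hadef
  have hmθ : 0 ≤ m ^ θ := Real.rpow_nonneg hm _
  -- The weakest rate among those that occur: time regularity of ∂ₓu. The rates aθ, aθ² and θ are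
  -- all at least κ.
  set κ := a * θ * θ / 2 with hκ
  have haθ : 0 < a * θ := by positivity
  have hκ0 : 0 < κ := by positivity
  have hκγ : κ ≤ a * θ := by rw [hκ]; nlinarith
  have hκγθ : κ ≤ a * θ * θ := by rw [hκ]; nlinarith [mul_pos haθ hθ]
  have hκθ : κ ≤ θ := by rw [hκ]; nlinarith
  set g : ℝ → ℝ → ℝ := fun t x => |u t x| ^ θ * deriv (u t) x with hg
  have hbd : ∀ t, τ ≤ t → ∀ x, |u t x| ≤ m := fun t ht x => hu.source.bound t (hτ.trans_le ht) x
  have hub : ∀ t, τ ≤ t → ∀ x, |u t x| ^ θ ≤ m ^ θ := fun t ht x =>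
    Real.rpow_le_rpow (abs_nonneg _) (hbd t ht x) hθ.le
  have hun : ∀ t x, 0 ≤ |u t x| ^ θ := fun t x => Real.rpow_nonneg (abs_nonneg _) _
  have hgb : ∀ t, τ ≤ t → ∀ x, |g t x| ≤ m ^ θ * L := by
    intro t ht x
    rw [hg, abs_mul, abs_of_nonneg (hun t x)]
    exact mul_le_mul (hub t ht x) ((hreg t ht).2.2.1 x) (abs_nonneg _) hmθ
  have hgd : ∀ t t' x x', τ ≤ t → τ ≤ t' → |g t x - g t' x'| ≤
      |u t x - u t' x'| ^ θ * L + m ^ θ * |deriv (u t) x - deriv (u t') x'| := by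
    intro t t' x x' ht ht'
    have e : g t x - g t' x' = (|u t x| ^ θ - |u t' x'| ^ θ) * deriv (u t) x +
        |u t' x'| ^ θ * (deriv (u t) x - deriv (u t') x') := by simp only [hg]; ring
    rw [e]
    refine (abs_add_le _ _).trans (add_le_add ?_ ?_)
    · rw [abs_mul]
      exact mul_le_mul (abs_rpow_sub_abs_rpow_le hθ hθ1.le _ _) ((hreg t ht).2.2.1 x)
        (abs_nonneg _) (Real.rpow_nonneg (abs_nonneg _) _)
    · rw [abs_mul, abs_of_nonneg (hun t' x')]
      exact mul_le_mul_of_nonneg_right (hub t' ht' x') (abs_nonneg _)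
  set G := L ^ θ * L + m ^ θ * H with hG
  have hLθ : 0 ≤ L ^ θ := Real.rpow_nonneg hL.le _
  have hG0 : 0 ≤ G := by positivity
  have hgx : ∀ t, τ ≤ t → ∀ x x', |g t x - g t x'| ≤ G * |x - x'| ^ θ := by
    intro t ht x x'
    refine (hgd t t x x' ht ht).trans ?_
    have h1 : |u t x - u t x'| ^ θ ≤ L ^ θ * |x - x'| ^ θ := by
      rw [← Real.mul_rpow hL.le (abs_nonneg _)]
      exact Real.rpow_le_rpow (abs_nonneg _) ((hreg t ht).1 x x') hθ.le
    calc _ ≤ L ^ θ * |x - x'| ^ θ * L + m ^ θ * (H * |x - x'| ^ θ) :=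
          add_le_add (mul_le_mul_of_nonneg_right h1 hL.le)
            (mul_le_mul_of_nonneg_left ((hreg t ht).2.2.2 x x') hmθ)
      _ = _ := by ring
  have hgc : ∀ t, τ ≤ t → Measurable (g t) := fun t ht =>
    ((hu.source.continuous (hτ.trans_le ht)).measurable.abs.pow_const θ).mul (measurable_deriv _)
  set G' := C₂ ^ θ * L + m ^ θ * C₂ with hG'
  have hC₂θ : 0 ≤ C₂ ^ θ := Real.rpow_nonneg hC₂0.le _
  have hG'0 : 0 ≤ G' := by positivity
  have hgt : ∀ t, τ ≤ t → ∀ s, 0 < s → s ≤ 1 → ∀ x, |g (t + s) x - g t x| ≤ G' * s ^ κ := by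
    intro t ht s hs hs1 x
    refine (hgd (t + s) t x x (by linarith) ht).trans ?_
    obtain ⟨h1, h2⟩ := hC₂ t ht s hs hs1 x
    have h3 : |u (t + s) x - u t x| ^ θ ≤ C₂ ^ θ * s ^ κ := by
      calc _ ≤ (C₂ * s ^ (a * θ)) ^ θ := Real.rpow_le_rpow (abs_nonneg _) h1 hθ.le
        _ = C₂ ^ θ * s ^ (a * θ * θ) := by
            rw [Real.mul_rpow hC₂0.le (Real.rpow_nonneg hs.le _), ← Real.rpow_mul hs.le]
        _ ≤ _ := mul_le_mul_of_nonneg_left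
            (Real.rpow_le_rpow_of_exponent_ge hs hs1 hκγθ) hC₂θ
    calc _ ≤ C₂ ^ θ * s ^ κ * L + m ^ θ * (C₂ * s ^ κ) :=
          add_le_add (mul_le_mul_of_nonneg_right h3 hL.le) (mul_le_mul_of_nonneg_left h2 hmθ)
      _ = _ := by ring
  set B := m ^ θ with hB
  refine ⟨(G * A + G') + H * B ^ θ * B + G * A + 1, κ, by positivity, hκ0,
    hκθ.trans hθ1.le, fun t ht h hh hh1 x => ?_⟩
  have ht0 : 0 < t := hτ.trans_le ht
  have hr := hu.restart hK hq ht0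
  have hhκ : 0 ≤ h ^ κ := Real.rpow_nonneg hh.le _
  -- the Duhamel term
  have hduh : |duhamel α (fun s y => flux q (u (t + s) y)) h x - h * g t x| ≤
      (G * A + G') * (h * h ^ κ) := by
    have hint := hK.intervalIntegrable_inner (hr.source.flux hq) hh.le x
    have e : duhamel α (fun s y => flux q (u (t + s) y)) h x - h * g t x =
        ∫ σ in (0 : ℝ)..h, ((∫ y, kernelKx α σ y * flux q (u (t + (h - σ)) (x - y))) - g t x) := by
      rw [intervalIntegral.integral_sub hint intervalIntegrable_const,
        intervalIntegral.integral_const, sub_zero, smul_eq_mul]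
      rfl
    rw [e]
    refine (intervalIntegral.norm_integral_le_of_norm_le
      (f := fun σ => (∫ y, kernelKx α σ y * flux q (u (t + (h - σ)) (x - y))) - g t x)
      (g := fun _ => (G * A + G') * h ^ κ) hh.le ?_ intervalIntegrable_const).trans_eq ?_
    · filter_upwards [compl_mem_ae_iff.2 (measure_singleton h)] with σ hσ hσ'
      have hσh : σ < h := lt_of_le_of_ne hσ'.2 hσ
      have hs : 0 < h - σ := sub_pos.2 hσh
      have hts : τ ≤ t + (h - σ) := by linarith
      have hF : ∀ y, HasDerivAt (fun y => flux q (u (t + (h - σ)) y)) (g (t + (h - σ)) y) y := fun y =>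
        (hasDerivAt_flux hq _).comp y ((hreg _ hts).2.1 y).hasDerivAt
      -- The derivative is moved from the kernel to the flux, leaving K(σ) * g, which is close to g
      -- without any singularity in σ.
      rw [hK.integral_kernelKx_mul hσ'.1 hF (fun y => abs_flux_le hq (hbd _ hts y)) (hgc _ hts)
        (hgb _ hts) x, Real.norm_eq_abs]
      have h1 := hK.abs_heat_sub_self_le hσ'.1 (hgc _ hts) (hgb _ hts) (hgx _ hts) hG0 x
      have h2 := hgt t ht _ hs (by linarith [hσ'.1]) x
      have h3 : σ ^ (a * θ) ≤ h ^ κ :=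
        (Real.rpow_le_rpow hσ'.1.le hσ'.2 haθ.le).trans
          (Real.rpow_le_rpow_of_exponent_ge hh hh1 hκγ)
      have h4 : (h - σ) ^ κ ≤ h ^ κ := Real.rpow_le_rpow hs.le (by linarith [hσ'.1]) hκ0.le
      calc _ = |(heat α (g (t + (h - σ))) σ x - g (t + (h - σ)) x) +
            (g (t + (h - σ)) x - g t x)| := by congr 1; ring
        _ ≤ G * (A * h ^ κ) + G' * h ^ κ := (abs_add_le _ _).trans (add_le_add
            (h1.trans (by gcongr)) (h2.trans (by gcongr)))
        _ = _ := by ring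
    · rw [intervalIntegral.integral_const, sub_zero, smul_eq_mul]; ring
  -- the advection step
  have hadv : ∀ y, |advect q h (u t) y - (u t y - h * g t y)| ≤ H * B ^ θ * B * (h * h ^ κ) := by
    intro y
    have h1 := abs_taylor_le hH.le hθ.le (hreg t ht).2.1 (hreg t ht).2.2.2 y (-(h * |u t y| ^ θ))
    rw [abs_neg, abs_of_nonneg (mul_nonneg hh.le (hun t y))] at h1
    have h2 : h * |u t y| ^ θ ≤ h * B := mul_le_mul_of_nonneg_left (hub t ht y) hh.le
    have h3 : (h * |u t y| ^ θ) ^ θ ≤ h ^ κ * B ^ θ := by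
      calc _ ≤ (h * B) ^ θ := Real.rpow_le_rpow (mul_nonneg hh.le (hun t y)) h2 hθ.le
        _ = h ^ θ * B ^ θ := Real.mul_rpow hh.le hmθ
        _ ≤ _ := mul_le_mul_of_nonneg_right (Real.rpow_le_rpow_of_exponent_ge hh hh1 hκθ)
            (Real.rpow_nonneg hmθ _)
    have e : advect q h (u t) y - (u t y - h * g t y) =
        u t (y + -(h * |u t y| ^ θ)) - u t y - -(h * |u t y| ^ θ) * deriv (u t) y := by
      simp only [advect, hg, ← sub_eq_add_neg]; ring
    rw [e]
    refine h1.trans ?_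
    have hBθ := Real.rpow_nonneg hmθ θ
    calc _ ≤ H * (h ^ κ * B ^ θ) * (h * B) := by
          refine mul_le_mul (mul_le_mul_of_nonneg_left h3 hH.le) h2 (mul_nonneg hh.le (hun t y)) ?_
          positivity
      _ = _ := by ring
  have hutm := hr.measurable
  have hutb := hr.bound_init
  have hghm : Measurable fun y => h * g t y := (hgc t ht).const_mul h
  have hghb : ∀ y, |h * g t y| ≤ h * (B * L) := fun y => by
    rw [abs_mul, abs_of_pos hh]; exact mul_le_mul_of_nonneg_left (hgb t ht y) hh.le
  have hdm : Measurable fun y => u t y - h * g t y := hutm.sub hghm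
  have hdb : ∀ y, |u t y - h * g t y| ≤ m + h * (B * L) := fun y =>
    (abs_sub _ _).trans (add_le_add (hutb y) (hghb y))
  have hadvm : Measurable (advect q h (u t)) :=
    (continuous_advect hq (hu.source.continuous ht0)).measurable
  -- The advected profile is u - h g up to O(h^(1+κ)). Diffusion is an L^∞ contraction, and
  -- replacing h K(h)*g by h g costs the same order; K(h)*u then cancels between the two sides.
  have h5 := hK.abs_heat_le hh hadv x
  rw [hK.heat_sub hh hadvm (fun y => hbd t ht _) hdm hdb, hK.heat_sub hh hutm hutb hghm hghb,
    KernelEst.heat_const_mul] at h5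
  have h6 := hK.abs_heat_sub_self_le hh (hgc t ht) (hgb t ht) (hgx t ht) hG0 x
  have h7 : |h * (heat α (g t) h x - g t x)| ≤ G * A * (h * h ^ κ) := by
    rw [abs_mul, abs_of_pos hh]
    have h8 : h ^ (a * θ) ≤ h ^ κ := Real.rpow_le_rpow_of_exponent_ge hh hh1 hκγ
    calc h * |heat α (g t) h x - g t x| ≤ h * (G * (A * h ^ κ)) :=
          mul_le_mul_of_nonneg_left (h6.trans (by gcongr)) hh.le
      _ = _ := by ring
  have e := hr.eq h hh x
  rw [e]
  have hhh : 0 ≤ h * h ^ κ := mul_nonneg hh.le hhκ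
  rw [mul_sub] at h7
  have e2 : ((G * A + G') + H * B ^ θ * B + G * A + 1) * (h * h ^ κ) = (G * A + G') * (h * h ^ κ) +
    H * B ^ θ * B * (h * h ^ κ) + G * A * (h * h ^ κ) + h * h ^ κ := by ring
  rw [e2]
  rw [abs_le] at hduh h5 h7 ⊢
  constructor <;> linarith [hduh.1, hduh.2, h5.1, h5.2, h7.1, h7.2]

end MildSol

end

/-! ### Propagation of bounds: the minimum principle and the one-sided estimate. -/

noncomputable section

/-- A property which is propagated over short times up to errors `o(h)` is propagated over
finite times up to arbitrarily small errors. -/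
lemma propagate_of_step {P : ℝ → ℝ → Prop} {C κ h₀ τ T M η : ℝ} (hκ : 0 < κ)
    (hh₀ : 0 < h₀) (hτT : τ < T) (hη : 0 < η) (hmono : ∀ M M', M ≤ M' → P T M → P T M')
    (hstep : ∀ t, τ ≤ t → ∀ h, 0 < h → h ≤ h₀ → t + h ≤ T → ∀ M, P t M → P (t + h) (M + C * (h * h ^ κ)))
    (h0 : P τ M) : P T (M + η) := by
  set D := T - τ with hD
  have hD0 : 0 < D := sub_pos.2 hτT
  have hlim : Filter.Tendsto (fun n : ℕ => D * (1 / ((n : ℝ) + 1))) Filter.atTop (nhds 0) := by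
    simpa using (tendsto_one_div_add_atTop_nhds_zero_nat (𝕜 := ℝ)).const_mul D
  have hcont : Filter.Tendsto (fun h : ℝ => C * (D * h ^ κ)) (nhds 0) (nhds 0) := by
    have : Continuous fun h : ℝ => C * (D * h ^ κ) :=
      continuous_const.mul (continuous_const.mul (Real.continuous_rpow_const hκ.le))
    have h := this.tendsto 0
    rwa [Real.zero_rpow hκ.ne', mul_zero, mul_zero] at h
  -- With n + 1 equal steps of length h, the accumulated error is C D h^κ, and n is taken large
  -- enough to make it less than η.
  obtain ⟨n, hn1, hn2⟩ := ((hlim.eventually_lt_const hh₀).and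
    ((hcont.comp hlim).eventually_lt_const hη)).exists
  set h := D * (1 / ((n : ℝ) + 1)) with hh
  have hpos : 0 < h := by positivity
  have hnh : ((n : ℝ) + 1) * h = D := by rw [hh]; field_simp
  have key : ∀ j : ℕ, j ≤ n + 1 → P (τ + j * h) (M + j * (C * (h * h ^ κ))) := by
    intro j
    induction j with
    | zero => intro _; simpa using h0
    | succ j ih =>
      intro hj
      have hjn : (j : ℝ) + 1 ≤ n + 1 := by exact_mod_cast hj
      have h1 := hstep (τ + j * h) (by have := hpos.le; nlinarith [mul_nonneg (Nat.cast_nonneg (α := ℝ) j) this])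
        h hpos hn1.le (by nlinarith [mul_le_mul_of_nonneg_right hjn hpos.le]) _ (ih (by omega))
      convert h1 using 1 <;> push_cast <;> ring
  have h1 := key (n + 1) le_rfl
  push_cast at h1
  rw [hnh] at h1
  have e : τ + D = T := by rw [hD]; ring
  rw [e] at h1
  refine hmono _ _ ?_ h1
  have e2 : ((n : ℝ) + 1) * (C * (h * h ^ κ)) = C * ((((n : ℝ) + 1) * h) * h ^ κ) := by ring
  rw [e2, hnh]
  have : C * (D * h ^ κ) < η := hn2
  linarith

lemma abs_rpow_sub_rpow_le {ε θ a b : ℝ} (hε : 0 < ε) (h0 : 0 < θ) (h1 : θ < 1) (ha : ε ≤ a)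
    (hb : ε ≤ b) : |a ^ θ - b ^ θ| ≤ θ * ε ^ (θ - 1) * |a - b| := by
  refine (convex_Ici ε).norm_image_sub_le_of_norm_hasDerivWithin_le (f := fun x : ℝ => x ^ θ)
    (f' := fun x => θ * x ^ (θ - 1)) (x := b) (y := a) (fun x hx => ?_) (fun x hx => ?_) hb ha
  · exact (Real.hasDerivAt_rpow_const (Or.inl (hε.trans_le hx).ne')).hasDerivWithinAt
  · have hx0 : 0 < x := hε.trans_le hx
    rw [Real.norm_of_nonneg (mul_nonneg h0.le (Real.rpow_nonneg hx0.le _))]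
    exact mul_le_mul_of_nonneg_left (Real.rpow_le_rpow_of_nonpos hε hx (by linarith)) h0.le

/-- Minkowski's inequality for the probability density `K(t,·)`, with exponent `1/θ`. -/
lemma KernelEst.heat_rpow_le {α θ A : ℝ} (h : KernelEst α θ A) {t m ε d : ℝ} (ht : 0 < t)
    (hε : 0 < ε) (hd : 0 ≤ d) {w : ℝ → ℝ} (hw : Measurable w) (hm : ∀ x, |w x| ≤ m)
    (hwε : ∀ x, ε ≤ w x) {x y : ℝ} (hle : ∀ z, w (x - z) ^ θ ≤ w (y - z) ^ θ + d) :
    heat α w t x ^ θ ≤ heat α w t y ^ θ + d := by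
  have hθ := h.hθ
  have hθ1 : θ < 1 := h.hθα.trans h.hα1
  have hge : ∀ x, ε ≤ heat α w t x := by
    intro x
    rw [← h.heat_const ht ε x]
    exact h.heat_mono ht measurable_const (fun _ => le_rfl) hw hm fun z => hwε _
  set a := heat α w t y ^ θ with ha
  have hy0 : 0 < heat α w t y := hε.trans_le (hge y)
  have ha0 : 0 < a := Real.rpow_pos_of_pos hy0 _
  have had : 0 < a + d := by linarith
  set p := θ⁻¹ with hp
  have hp1 : 1 ≤ p := (one_le_inv₀ hθ).2 hθ1.le
  have hap : a ^ p = heat α w t y := by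
    rw [ha, ← Real.rpow_mul hy0.le, mul_inv_cancel₀ hθ.ne', Real.rpow_one]
  -- Coefficients of an affine bound for w(x-z) in terms of w(y-z). They are chosen so that
  -- integration against the kernel yields exactly (a+d)^p.
  set c₁ := (a + d) ^ p * (a / (a + d)) * (a ^ p)⁻¹ with hc₁
  set c₂ := (a + d) ^ p * (d / (a + d)) with hc₂
  have hpt : ∀ z, w (x - z) ≤ c₁ * w (y - z) - (-c₂) := by
    intro z
    have hwy : 0 < w (y - z) := hε.trans_le (hwε _)
    have hwx : 0 < w (x - z) := hε.trans_le (hwε _)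
    set b := w (y - z) ^ θ with hb
    have hb0 : 0 < b := Real.rpow_pos_of_pos hwy _
    have hbp : b ^ p = w (y - z) := by
      rw [hb, ← Real.rpow_mul hwy.le, mul_inv_cancel₀ hθ.ne', Real.rpow_one]
    have h1 : w (x - z) ≤ (b + d) ^ p := by
      have := Real.rpow_le_rpow (Real.rpow_nonneg hwx.le θ) (hle z) (by linarith : 0 ≤ p)
      rwa [← Real.rpow_mul hwx.le, mul_inv_cancel₀ hθ.ne', Real.rpow_one] at this
    -- Convexity of s ↦ s^p for (b+d)/(a+d), the mean of b/a and 1 with weights a/(a+d) and d/(a+d).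
    -- The result is affine in b^p = w(y-z), so only linearity and positivity of the kernel are
    -- needed.
    have hconv := (convexOn_rpow hp1).2 (mem_Ici.2 (by positivity : (0 : ℝ) ≤ b / a))
      (mem_Ici.2 (zero_le_one : (0 : ℝ) ≤ 1)) (by positivity : 0 ≤ a / (a + d))
      (by positivity : 0 ≤ d / (a + d)) (by field_simp)
    simp only [smul_eq_mul, Real.one_rpow, mul_one] at hconv
    have e1 : a / (a + d) * (b / a) + d / (a + d) = (b + d) / (a + d) := by field_simp
    rw [e1, Real.div_rpow (by linarith) had.le, Real.div_rpow hb0.le ha0.le, hbp,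
      div_le_iff₀ (Real.rpow_pos_of_pos had p)] at hconv
    refine h1.trans (hconv.trans_eq ?_)
    rw [hc₁, hc₂]
    ring
  have hint : heat α w t x ≤ c₁ * heat α w t y - (-c₂) := by
    have hm1 : Measurable fun z => c₁ * w z := hw.const_mul c₁
    have hb1 : ∀ z, |c₁ * w z| ≤ |c₁| * m := fun z => by
      rw [abs_mul]; exact mul_le_mul_of_nonneg_left (hm z) (abs_nonneg _)
    have := h.heat_mono ht hw hm (w := fun z => c₁ * w z - (-c₂)) (m' := |c₁| * m + |(-c₂)|)
      (hm1.sub measurable_const) (fun z => (abs_sub _ _).trans (add_le_add (hb1 z) le_rfl)) hpt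
    rwa [h.heat_sub ht hm1 hb1 measurable_const (fun _ => le_rfl), h.heat_const ht,
      KernelEst.heat_const_mul] at this
  have hfin : c₁ * heat α w t y - (-c₂) = (a + d) ^ p := by
    have : a ^ p ≠ 0 := (Real.rpow_pos_of_pos ha0 p).ne'
    rw [← hap, hc₁, hc₂]
    field_simp
    ring
  rw [hfin] at hint
  have hx0 : 0 < heat α w t x := hε.trans_le (hge x)
  have := Real.rpow_le_rpow hx0.le hint hθ.le
  rwa [← Real.rpow_mul had.le, inv_mul_cancel₀ hθ.ne', Real.rpow_one] at this

namespace MildSol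
variable {α A q m ε : ℝ} {v : ℝ → ℝ} {u : ℝ → ℝ → ℝ}

/-- Minimum principle. -/
lemma ge_of_init_ge (hK : KernelEst α (q - 1) A) (hm : 0 < m) (hu : MildSol α q m v u)
    (hv : ∀ x, ε ≤ v x) {T : ℝ} (hT : 0 < T) (x : ℝ) : ε ≤ u T x := by
  have hq : 1 < q := by linarith [hK.hθ]
  -- The bound on the Duhamel term: the deficit in the lower bound at the starting time, which
  -- vanishes as τ → 0.
  set b : ℝ → ℝ := fun τ => A * (m ^ (q - 1) * m) * (τ ^ (1 - (1 + α)⁻¹) / (1 - (1 + α)⁻¹)) with hb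
  have hstart : ∀ τ, 0 < τ → ∀ x, ε - b τ ≤ u τ x := by
    intro τ hτ x
    have h1 : ε ≤ heat α v τ x := by
      rw [← hK.heat_const hτ ε x]
      exact hK.heat_mono hτ measurable_const (fun _ => le_rfl) hu.measurable hu.bound_init
        fun z => hv _
    have h2 := le_of_abs_le (hK.abs_duhamel_le (hu.source.flux hq) hτ.le x)
    rw [hu.eq τ hτ]
    linarith
  have hmain : ∀ τ, 0 < τ → τ < T → ε - b τ ≤ u T x := by
    intro τ hτ hτT
    obtain ⟨L, H, hL, hH, hreg⟩ := exists_regularity hK hq hm hτ hu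
    obtain ⟨C, κ, _, hκ, _, hst⟩ := exists_step_estimate hK hu hτ hL hH hreg
    refine le_of_forall_pos_le_add fun η hη => ?_
    have := propagate_of_step (P := fun t M => ∀ x, ε - M ≤ u t x) (M := b τ) (C := C) hκ one_pos hτT hη
      (fun M M' hM hP x => by linarith [hP x]) (fun t ht h hh hh1 _ M hP x => ?_) (hstart τ hτ) x
    · linarith
    · have ht0 : 0 < t := hτ.trans_le ht
      have h1 := hst t ht h hh hh1 x
      -- Advection only rearranges values and diffusion averages them, so neither lowers the
      -- infimum.
      have h2 : ε - M ≤ heat α (advect q h (u t)) h x := by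
        rw [← hK.heat_const hh (ε - M) x]
        exact hK.heat_mono hh measurable_const (fun _ => le_rfl)
          (continuous_advect hq (hu.source.continuous ht0)).measurable
          (fun y => hu.source.bound t ht0 _) fun z => hP _
      linarith [(abs_le.1 h1).1]
  have hlim : Filter.Tendsto (fun τ => ε - b τ) (nhdsWithin 0 (Ioi 0)) (nhds ε) := by
    have h1a : 0 < 1 - (1 + α)⁻¹ := by linarith [hK.exp_lt_one]
    have hc : Continuous fun τ => ε - b τ := continuous_const.sub (continuous_const.mul
      ((Real.continuous_rpow_const h1a.le).div_const _))
    have h := (hc.tendsto 0).mono_left (nhdsWithin_le_nhds (s := Ioi 0))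
    simp only [hb, Real.zero_rpow h1a.ne', zero_div, mul_zero, sub_zero] at h
    exact h
  refine le_of_tendsto hlim ?_
  filter_upwards [Ioo_mem_nhdsGT hT] with τ hτ
  exact hmain τ hτ.1 hτ.2

/-- The one-sided Lipschitz (Oleinik) estimate for `u^(q-1)`. -/
lemma oleinik (hK : KernelEst α (q - 1) A) (hm : 0 < m) (hu : MildSol α q m v u) (hε : 0 < ε)
    (hv : ∀ x, ε ≤ v x) {T : ℝ} (hT : 0 < T) {x y : ℝ} (hxy : y ≤ x) :
    T * (u T x ^ (q - 1) - u T y ^ (q - 1)) ≤ x - y := by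
  have hq : 1 < q := by linarith [hK.hθ]
  have hθ := hK.hθ
  have hθ1 : q - 1 < 1 := hK.hθα.trans hK.hα1
  have hge : ∀ t, 0 < t → ∀ x, ε ≤ u t x := fun t ht x => hu.ge_of_init_ge hK hm hv ht x
  set θ := q - 1 with hθdef
  set B := m ^ θ with hB
  have hB0 : 0 ≤ B := Real.rpow_nonneg hm.le _
  have hwB : ∀ t, 0 < t → ∀ x, u t x ^ θ ≤ B := fun t ht x =>
    Real.rpow_le_rpow (hε.le.trans (hge t ht x)) (le_of_abs_le (hu.source.bound t ht x)) hθ.le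
  have hw0 : ∀ t, 0 < t → ∀ x, 0 ≤ u t x ^ θ := fun t ht x =>
    Real.rpow_nonneg (hε.le.trans (hge t ht x)) _
  have hmain : ∀ τ, 0 < τ → τ < T → T * (u T x ^ θ - u T y ^ θ) ≤ x - y + τ * B := by
    intro τ hτ hτT
    obtain ⟨L, H, hL, hH, hreg⟩ := exists_regularity hK hq hm hτ hu
    obtain ⟨C, κ, hC, hκ, hκ1, hst⟩ := exists_step_estimate hK hu hτ hL hH hreg
    set Lθ := θ * ε ^ (θ - 1) with hLθ
    have hLθ0 : 0 < Lθ := mul_pos hθ (Real.rpow_pos_of_pos hε _)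
    set Λ := Lθ * L with hΛ
    have hΛ0 : 0 < Λ := mul_pos hLθ0 hL
    have hlip : ∀ t, τ ≤ t → ∀ x y, |u t x ^ θ - u t y ^ θ| ≤ Λ * |x - y| := by
      intro t ht x y
      have ht0 : 0 < t := hτ.trans_le ht
      refine (abs_rpow_sub_rpow_le hε hθ hθ1 (hge t ht0 x) (hge t ht0 y)).trans ?_
      calc Lθ * |u t x - u t y| ≤ Lθ * (L * |x - y|) :=
            mul_le_mul_of_nonneg_left ((hreg t ht).1 x y) hLθ0.le
        _ = Λ * |x - y| := by rw [hΛ]; ring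
    refine le_of_forall_pos_le_add fun η hη => ?_
    -- The condition 0 ≤ M keeps the increment in Minkowski's inequality nonnegative. The bound h ≤
    -- 1 is for the splitting estimate and h ≤ Λ⁻¹ prevents the feet of characteristics from
    -- crossing.
    have hprop := propagate_of_step (P := fun t M => 0 ≤ M ∧ ∀ x y, y ≤ x →
        t * (u t x ^ θ - u t y ^ θ) ≤ x - y + M) (M := τ * B)
      (C := 2 * Λ * B + 2 * T * Lθ * C) (h₀ := min 1 Λ⁻¹) hκ
      (lt_min one_pos (inv_pos.2 hΛ0)) hτT hη
      (fun M M' hM hP => ⟨hP.1.trans hM, fun x y hxy => (hP.2 x y hxy).trans (by linarith)⟩) ?_ ?_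
    · have := hprop.2 x y hxy
      linarith
    · rintro t ht h hh hh₀ htT M ⟨hM, hP⟩
      have ht0 : 0 < t := hτ.trans_le ht
      have hh1 : h ≤ 1 := hh₀.trans (min_le_left _ _)
      have hhΛ : Λ * h ≤ 1 := by
        have := mul_le_mul_of_nonneg_left (hh₀.trans (min_le_right _ _)) hΛ0.le
        rwa [mul_inv_cancel₀ hΛ0.ne'] at this
      have hhκ : h ≤ h ^ κ := by
        calc h = h ^ (1 : ℝ) := (Real.rpow_one h).symm
          _ ≤ h ^ κ := Real.rpow_le_rpow_of_exponent_ge hh hh1 hκ1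
      have hhh : h * h ≤ h * h ^ κ := mul_le_mul_of_nonneg_left hhκ hh.le
      have hnn : 0 ≤ h * h ^ κ := (mul_nonneg hh.le hh.le).trans hhh
      refine ⟨by positivity, fun x y hxy => ?_⟩
      set U := advect q h (u t) with hU
      have hUe : ∀ x, U x = u t (x - h * u t x ^ θ) := by
        intro x
        rw [hU, advect, abs_of_pos (hε.trans_le (hge t ht0 x))]
      -- the advected profile
      have hadv : ∀ x y, y ≤ x → (t + h) * (U x ^ θ - U y ^ θ) ≤ x - y + (M + 2 * Λ * B * (h * h)) := by
        intro x y hxy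
        have hl := (abs_le.1 (hlip t ht x y)).2
        rw [abs_of_nonneg (sub_nonneg.2 hxy)] at hl
        -- The feet stay ordered because h Λ ≤ 1, so the induction hypothesis applies to them.
        have hord : y - h * u t y ^ θ ≤ x - h * u t x ^ θ := by
          have h1 : h * (u t x ^ θ - u t y ^ θ) ≤ h * (Λ * (x - y)) :=
            mul_le_mul_of_nonneg_left hl hh.le
          have h2 : (Λ * h) * (x - y) ≤ 1 * (x - y) :=
            mul_le_mul_of_nonneg_right hhΛ (sub_nonneg.2 hxy)
          linarith
        have h1 := hP _ _ hord
        have hclose : ∀ z, |U z ^ θ - u t z ^ θ| ≤ Λ * (h * B) := by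
          intro z
          rw [hUe]
          refine (hlip t ht _ _).trans (mul_le_mul_of_nonneg_left ?_ hΛ0.le)
          rw [sub_sub_cancel_left, abs_neg, abs_of_nonneg (mul_nonneg hh.le (hw0 t ht0 z))]
          exact mul_le_mul_of_nonneg_left (hwB t ht0 z) hh.le
        have h2 := mul_le_mul_of_nonneg_left (abs_le.1 (hclose x)).2 hh.le
        have h3 := mul_le_mul_of_nonneg_left (abs_le.1 (hclose y)).1 hh.le
        -- The distance between the feet is x - y - h(w(x) - w(y)). Replacing w by its advected
        -- value costs O(h²) and moves this term to the left, turning the factor t into t + h.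
        rw [← hUe, ← hUe] at h1
        linarith
      -- This increment is the same for all common translates of x and y, as Minkowski's inequality
      -- requires.
      set d := (x - y + (M + 2 * Λ * B * (h * h))) / (t + h) with hd
      have hth : 0 < t + h := by linarith
      have hd0 : 0 ≤ d := div_nonneg (add_nonneg (sub_nonneg.2 hxy) (by positivity)) hth.le
      have hUd : ∀ z, U (x - z) ^ θ ≤ U (y - z) ^ θ + d := by
        intro z
        have h1 := hadv (x - z) (y - z) (by linarith)
        rw [sub_sub_sub_cancel_right] at h1
        have h2 : U (x - z) ^ θ - U (y - z) ^ θ ≤ d := by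
          rw [hd, le_div_iff₀ hth]; linarith
        linarith
      have hUm : Measurable U := (continuous_advect hq (hu.source.continuous ht0)).measurable
      have hUb : ∀ z, |U z| ≤ m := fun z => hu.source.bound t ht0 _
      have hUε : ∀ z, ε ≤ U z := fun z => hge t ht0 _
      have hmink := hK.heat_rpow_le hh hε hd0 hUm hUb hUε hUd
      have hheatε : ∀ z, ε ≤ heat α U h z := by
        intro z
        rw [← hK.heat_const hh ε z]
        exact hK.heat_mono hh measurable_const (fun _ => le_rfl) hUm hUb fun _ => hUε _
      have hclose : ∀ z, |u (t + h) z ^ θ - heat α U h z ^ θ| ≤ Lθ * (C * (h * h ^ κ)) := fun z =>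
        (abs_rpow_sub_rpow_le hε hθ hθ1 (hge _ hth z) (hheatε z)).trans
          (mul_le_mul_of_nonneg_left (hst t ht h hh hh1 z) hLθ0.le)
      have h1 := (abs_le.1 (hclose x)).2
      have h2 := (abs_le.1 (hclose y)).1
      have h3 : u (t + h) x ^ θ - u (t + h) y ^ θ ≤ d + 2 * (Lθ * (C * (h * h ^ κ))) := by linarith
      have h4 : (t + h) * d = x - y + (M + 2 * Λ * B * (h * h)) := by rw [hd]; field_simp
      have h5 : 0 ≤ 2 * (Lθ * (C * (h * h ^ κ))) := by positivity
      calc (t + h) * (u (t + h) x ^ θ - u (t + h) y ^ θ)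
          ≤ (t + h) * (d + 2 * (Lθ * (C * (h * h ^ κ)))) := mul_le_mul_of_nonneg_left h3 hth.le
        _ = x - y + (M + 2 * Λ * B * (h * h)) + (t + h) * (2 * (Lθ * (C * (h * h ^ κ)))) := by
            rw [mul_add, h4]
        _ ≤ x - y + (M + 2 * Λ * B * (h * h ^ κ)) + T * (2 * (Lθ * (C * (h * h ^ κ)))) := by
            have h6 : 2 * Λ * B * (h * h) ≤ 2 * Λ * B * (h * h ^ κ) :=
              mul_le_mul_of_nonneg_left hhh (by positivity)
            have h7 := mul_le_mul_of_nonneg_right htT h5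
            linarith
        _ = _ := by ring
    · refine ⟨by positivity, fun x y hxy => ?_⟩
      -- At the starting time only 0 ≤ w ≤ B is used; the resulting constant τ B vanishes as τ → 0.
      have h1 := hwB τ hτ x
      have h2 := hw0 τ hτ y
      have h3 : τ * (u τ x ^ θ - u τ y ^ θ) ≤ τ * B := mul_le_mul_of_nonneg_left (by linarith) hτ.le
      linarith
  have hlim : Filter.Tendsto (fun τ => x - y + τ * B) (nhdsWithin 0 (Ioi 0)) (nhds (x - y)) := by
    have hc : Continuous fun τ : ℝ => x - y + τ * B := by fun_prop
    have h := (hc.tendsto 0).mono_left (nhdsWithin_le_nhds (s := Ioi 0))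
    simpa using h
  refine ge_of_tendsto hlim ?_
  filter_upwards [Ioo_mem_nhdsGT hT] with τ hτ
  exact hmain τ hτ.1 hτ.2

end MildSol

end

theorem proposition3 (α q : ℝ) (hα0 : 0 < α) (hα1 : α < 1) (hq1 : 1 < q) (hqα : q < 1 + α)
    (u₀ : ℝ → ℝ) (hu₀ : MemLp u₀ ⊤ volume) (hu₀_nonneg : ∀ᵐ x : ℝ, 0 ≤ u₀ x)
    (ε : ℝ) (hε : 0 < ε)
    (u : ℝ → ℝ → ℝ) (hu : IsMildSolution α q (fun x => u₀ x + ε) u) :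
    ∀ t : ℝ, 0 < t → ∀ x : ℝ,
      0 < u t x ∧
      DifferentiableAt ℝ (fun y : ℝ => u t y ^ (q - 1)) x ∧
      deriv (fun y : ℝ => u t y ^ (q - 1)) x ≤ 1 / t := by
  intro t ht x
  -- With θ = q - 1 the Hölder exponent coincides with that of the speed |u|^(q-1); admissibility θ
  -- < α is the hypothesis q < 1 + α.
  obtain ⟨A, hK⟩ := exists_kernelEst hα0 hα1 (θ := q - 1) (by linarith) (by linarith)
  obtain ⟨m, v, hm, hsol, hv⟩ := hu.exists_mildSol hK hq1 hu₀ hu₀_nonneg hε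
  have hpos : 0 < u t x := hε.trans_le (hsol.ge_of_init_ge hK hm hv ht x)
  obtain ⟨L, H, _, _, hreg⟩ := MildSol.exists_regularity hK hq1 hm ht hsol
  have hd : DifferentiableAt ℝ (fun y : ℝ => u t y ^ (q - 1)) x :=
    ((hreg t le_rfl).2.1 x).rpow_const (Or.inl hpos.ne')
  refine ⟨hpos, hd, ?_⟩
  refine le_of_tendsto hd.hasDerivAt.tendsto_slope_zero_right ?_
  filter_upwards [self_mem_nhdsWithin] with k hk
  have hk0 : (0 : ℝ) < k := hk
  -- The estimate bounds every right difference quotient by 1/t, and the bound passes to the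
  -- derivative.
  have h := hsol.oleinik hK hm hε hv ht (x := x + k) (y := x) (by linarith)
  rw [add_sub_cancel_left] at h
  rw [smul_eq_mul, inv_mul_le_iff₀ hk0, mul_one_div, le_div_iff₀ ht]
  linarith
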